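/- **Setting.** Let $\mathcal X$ be a set of individuals, $\hat{\mathcal Y}$ a finite nonempty set of decisions, $\mathcal D$ a discrete distribution on $\mathcal X$ and $p^*:\mathcal X\times\hat{\mathcal Y}\to[0,1]$. Let $\mathcal H$ be a finite nonempty class of maps $h:\mathcal X\to\hat{\mathcal Y}$ and $\mathcal L$ a finite nonempty class of losses $\ell:\mathcal X\times\hat{\mathcal Y}\times\{0,1\}\to[0,\ell_{\max}]$, $\ell_{\max}>0$. For $p:\mathcal X\times\hat{\mathcal Y}\to[0,1]$ put $R_p(\ell,h)=\mathbb E_{x\sim\mathcal D,\,y\sim \mathrm{Ber}(p(x,h(x)))}[\ell(x,h(x),y)]$ and let $f_{\ell}^{p}(x)=\arg\min_{\hat y}\mathbb E_{y\sim \mathrm{Ber}(p(x,\hat y))}[\ell(x,\hat y,y)]$ (first minimiser). For $\epsilon\ge 0$, $p$ is $(\mathcal L,\mathcal H,\epsilon)$-POI if $|R_{p}(\ell,h)-R_{p^*}(\ell,h)|\le\epsilon$ for all $\ell\in\mathcal L,h\in\mathcal H$; it is $(\mathcal L,\epsilon)$-DOI if $|R_p(\ell,f_\ell^p)-R_{p^*}(\ell,f^p_\ell)|\le\epsilon$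 for all $\ell\in\mathcal L$; it is an $(\mathcal L,\mathcal H,\epsilon)$-performative omnipredictor if $R_{p^*}(\ell,f_\ell^p)\le\min_{h\in\mathcal H}R_{p^*}(\ell,h)+\epsilon$ for all $\ell\in\mathcal L$. An RCT sample is $(x,\hat y,y^*)$ with $x\sim\mathcal D$, $\hat y$ uniform on $\hat{\mathcal Y}$, $y^*\sim\mathrm{Ber}(p^*(x,\hat y))$. A cost-sensitive weak learner $\mathcal A$ for $\mathcal H$ takes $\rho\in(0,1]$, $\delta'\in(0,1)$ and i.i.d. examples from a distribution $\mu$ on $\mathcal X\times[-1,1]^{\hat{\mathcal Y}}$; whenever some $h\in\mathcal H$ has $\mathbb E_{(x,c)\sim\mu}\,c(h(x))\le-\rho$, with probability at least $1-\delta'$ it returns $h'\in\mathcal H$ with $\mathbb E_{(x,c)\sim\mu}\,c(h'(x))\le-\rho/2$. **POI-Boost** (tolerance $\epsilon>0$, audits with slack $\kappa=1/8$). Start with $p^{(1)}\equiv 1/2$. At step $t$ look for a pair $(h,\ell)\in\mathcal H\times\mathcal L$, or $(h,\ell)=(f_\ell^{p^{(t)}},\ell)$ with $\ell\in\mathcal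 L$, whose error $\mathrm{err}_t=R_{p^{(t)}}(\ell,h)-R_{p^*}(\ell,h)$ is large. An update may be made only on a pair with $|\mathrm{err}_t|\ge\kappa\epsilon$; it replaces $p^{(t)}(x,\hat y)$ by $p^{(t)}(x,\hat y)-\eta_t\,(\ell(x,\hat y,1)-\ell(x,\hat y,0))\,\mathbf 1\{h(x)=\hat y\}$, clipped to $[0,1]$, where $\eta_t=\kappa\epsilon\,\mathrm{sign}(\mathrm{err}_t)/\ell_{\max}^2$. The run stops only when no such pair has $|\mathrm{err}_t|\ge\epsilon$, and outputs the final predictor $\tilde p$, represented by the list of updates. **Model of computation.** A real random access machine (unit cost for addition, subtraction and comparison of natural numbers, and for arithmetic, comparison and logarithm of reals; rounding a real up to $m\in\mathbb N$ costs $m$ extra steps) with access to $\mathcal H$, $\mathcal L$ (by index), RCT samples and $\mathcal A$. One RCT sample costs one step, an evaluation of $h$ or $\ell$ costs its evaluation time, and a call of $\mathcal A$ costs its running time. The sample size required by $\mathcal A$ for given parameters can be looked up in one step. **Corollary.** There is a single program implementing POI-Boost on this machine, with inputs $|\hat{\mathcal Y}|,|\mathcal H|,|\mathcal L|,\epsilon,\ell_{\max},\delta$,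 such that the following holds, where all polynomials in the conclusion depend only on the polynomials in the hypotheses. Suppose that each $h\in\mathcal H$ and each $\ell\in\mathcal L$ can be evaluated in time $\mathrm{poly}(\log|\mathcal H|)$ and $\mathrm{poly}(\log|\mathcal L|)$ respectively, and that $\mathcal A$ is a cost-sensitive weak learner for $\mathcal H$ whose running time and number of examples are at most $\mathrm{poly}(\log|\mathcal H|,1/\rho,\log(1/\delta'))$. Then for all $\epsilon>0$ and $\delta\in(0,1)$, every execution of the program * runs in time at most $|\mathcal L|\cdot\mathrm{poly}(1/\epsilon,\ell_{\max},|\hat{\mathcal Y}|,\log|\mathcal L|,\log|\mathcal H|,\log(1/\delta))$, * uses at most $\mathrm{poly}(1/\epsilon,\ell_{\max},|\hat{\mathcal Y}|,\log|\mathcal L|,\log|\mathcal H|,\log(1/\delta))$ RCT samples, * makes at most $|\mathcal L|\cdot\mathrm{poly}(1/\epsilon,\ell_{\max},|\hat{\mathcal Y}|)$ calls to $\mathcal A$ (this last polynomial being absolute), and with probability at least $1-\delta$ its output is the list of updates of a complete run of POI-Boost, whose final predictor $\tilde p$ is $(\mathcal L,\mathcal H,\epsilon)$-POI and $(\mathcal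 L,\epsilon)$-DOI, and hence an $(\mathcal L,\mathcal H,2\epsilon)$-performative omnipredictor. -/

import Mathlib

open scoped unitInterval

namespace PerfOmni

noncomputable section

universe u

/-! ## Discrete probability -/

/-- Expectation of a (bounded) real function under a discrete distribution. -/
def expect {α : Type u} (μ : PMF α) (f : α → ℝ) : ℝ := ∑' a, (μ a).toReal * f a

/-- The Bernoulli distribution with parameter `p`; `true` is the outcome `1`. -/
def coin (p : I) : PMF Bool :=
  PMF.ofFintype (fun b => ENNReal.ofReal (if b then (p : ℝ) else 1 - (p : ℝ))) (by
    have h0 : (0 : ℝ) ≤ p := p.2.1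
    have h1 : (0 : ℝ) ≤ 1 - (p : ℝ) := sub_nonneg.2 p.2.2
    simp [← ENNReal.ofReal_add h0 h1])

/-- `n` independent draws from `μ`, as a list. -/
def iid {α : Type u} (μ : PMF α) : ℕ → PMF (List α)
  | 0 => PMF.pure []
  | n + 1 => (iid μ n).bind fun l => μ.map fun a => l ++ [a]

/-- Rounds `0, …, n - 1` of a random process started at `s`. -/
def rounds {α : Type u} (f : ℕ → α → PMF α) (s : α) : ℕ → PMF α
  | 0 => PMF.pure s
  | n + 1 => (rounds f s n).bind (f n)

/-- The probability of an event. -/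
def prob {α : Type u} (μ : PMF α) (E : Set α) : ENNReal := μ.toOuterMeasure E

/-! ## Outcome performativity

Individuals are the elements of `X`, decisions those of `Fin k`, outcomes are Booleans. -/

/-- A predictor `p(x, ŷ) ∈ [0,1]`, i.e. a vector-valued map `x ↦ (p(x, ŷ))_ŷ`. -/
abbrev Predictor (X : Type u) (k : ℕ) := X → Fin k → I

/-- A loss `ℓ(x, ŷ, y)`. -/
abbrev Loss (X : Type u) (k : ℕ) := X → Fin k → Bool → ℝ

/-- `E_{y ∼ p(x,ŷ)} [ℓ(x, ŷ, y)]`. -/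
def condLoss {X : Type u} {k : ℕ} (p : Predictor X k) (l : Loss X k) (x : X) (a : Fin k) : ℝ :=
  expect (coin (p x a)) (fun y => l x a y)

/-- The performative risk `E_{x ∼ D, y ∼ p(x,h(x))} [ℓ(x, h(x), y)]`. -/
def risk {X : Type u} {k : ℕ} (D : PMF X) (p : Predictor X k) (l : Loss X k)
    (h : X → Fin k) : ℝ :=
  expect D (fun x => condLoss p l x (h x))

/-- The first minimiser of a real function on `Fin k`. -/
def firstMin {k : ℕ} [NeZero k] (g : Fin k → ℝ) : Fin k :=
  (Finset.univ.filter fun a => ∀ b, g a ≤ g b).min' (by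
    obtain ⟨a, ha⟩ := Finite.exists_min g
    exact ⟨a, by simpa using ha⟩)

/-- The optimal post-processing `f_ℓ(x) = argmin_ŷ E_{y ∼ p(x,ŷ)} [ℓ(x, ŷ, y)]` of a predictor;
ties are broken towards the smallest index. -/
def postProcess {X : Type u} {k : ℕ} [NeZero k] (p : Predictor X k) (l : Loss X k) :
    X → Fin k :=
  fun x => firstMin (condLoss p l x)

/-- The data of a learning problem: the input distribution `D`, Nature's `p*`, the hypothesis class
`H` and the loss class `L` (as enumerated finite classes), the bound `ℓ_max` on the losses and the
tolerance `ε`. -/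
structure Problem (X : Type u) (k nH nL : ℕ) where
  D : PMF X
  nature : Predictor X k
  H : Fin nH → X → Fin k
  L : Fin nL → Loss X k
  lmax : ℝ
  eps : ℝ

section

variable {X : Type u} {k nH nL : ℕ}

/-- The losses take values in `[0, ℓ_max]`. -/
def Problem.Bounded (P : Problem X k nH nL) : Prop :=
  ∀ l x a y, 0 ≤ P.L l x a y ∧ P.L l x a y ≤ P.lmax

/-- `f` is `(ℓ, H, ε)`-performatively optimal. -/
def Problem.PerformativelyOptimal (P : Problem X k nH nL) (l : Loss X k) (f : X → Fin k)
    (e : ℝ) : Prop :=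
  ∀ i, risk P.D P.nature l f ≤ risk P.D P.nature l (P.H i) + e

/-- `p` is an `(L, H, e)`-performative omnipredictor. -/
def Problem.IsOmnipredictor [NeZero k] (P : Problem X k nH nL) (p : Predictor X k)
    (e : ℝ) : Prop :=
  ∀ l, P.PerformativelyOptimal (P.L l) (postProcess p (P.L l)) e

/-- `p` is `(L, H, e)`-performative outcome indistinguishable. -/
def Problem.IsPOI (P : Problem X k nH nL) (p : Predictor X k) (e : ℝ) : Prop :=
  ∀ l i, |risk P.D P.nature (P.L l) (P.H i) - risk P.D p (P.L l) (P.H i)| ≤ e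

/-- `p` is `(L, e)`-performative decision outcome indistinguishable. -/
def Problem.IsDOI [NeZero k] (P : Problem X k nH nL) (p : Predictor X k) (e : ℝ) : Prop :=
  ∀ l, |risk P.D P.nature (P.L l) (postProcess p (P.L l)) -
    risk P.D p (P.L l) (postProcess p (P.L l))| ≤ e

/-- The distribution `D_rct` of RCT samples `(x, ŷ, y*)`: `x ∼ D`, `ŷ` uniform, `y* ∼ p*(x, ŷ)`. -/
def Problem.rct [NeZero k] (P : Problem X k nH nL) : PMF (X × Fin k × Bool) :=
  P.D.bind fun x => (PMF.uniformOfFintype (Fin k)).bind fun a =>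
    (coin (P.nature x a)).map fun y => (x, a, y)

/-! ## POI-Boost -/

/-- One update of POI-Boost: the violating pair `(h, ℓ)`, where `rule = some i` stands for the
`i`-th hypothesis and `rule = none` for the current `f_{ℓ,t}`, and the sign of the error
(`pos = true` for `+`). -/
structure Update (nH nL : ℕ) where
  loss : Fin nL
  rule : Option (Fin nH)
  pos : Bool

/-- The sign recorded by an update. -/
def Update.sign (u : Update nH nL) : ℝ := if u.pos then 1 else -1

/-- The decision rule audited, for the current predictor `q`. -/
def Problem.ruleOf [NeZero k] (P : Problem X k nH nL) (q : Predictor X k)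
    (r : Option (Fin nH)) (l : Fin nL) : X → Fin k :=
  match r with
  | some i => P.H i
  | none => postProcess q (P.L l)

/-- `err`: the modelled minus the true performative risk of the audited pair. -/
def Problem.err [NeZero k] (P : Problem X k nH nL) (q : Predictor X k)
    (r : Option (Fin nH)) (l : Fin nL) : ℝ :=
  risk P.D q (P.L l) (P.ruleOf q r l) - risk P.D P.nature (P.L l) (P.ruleOf q r l)

/-- The initial predictor, constantly `1/2`. -/
def halfPredictor (X : Type u) (k : ℕ) : Predictor X k :=
  fun _ _ => ⟨1 / 2, by constructor <;> norm_num⟩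

/-- The update `q ← Π (q - η v_{ℓ,h})`, `v_{ℓ,h}(x)[ŷ] = (ℓ(x,ŷ,1) - ℓ(x,ŷ,0)) 1{h(x) = ŷ}`, with
`η = κ ε sign(err) / ℓ_max²`; `Π` clips to `[0,1]`. -/
def Problem.boostStep [NeZero k] (P : Problem X k nH nL) (κ : ℝ) (q : Predictor X k)
    (u : Update nH nL) : Predictor X k :=
  fun x a => Set.projIcc (0 : ℝ) 1 zero_le_one
    ((q x a : ℝ) - u.sign * (κ * P.eps / P.lmax ^ 2) *
      ((P.L u.loss x a true - P.L u.loss x a false) *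
        if P.ruleOf q u.rule u.loss x = a then 1 else 0))

/-- The predictor obtained from the constant `1/2` by a sequence of updates. -/
def Problem.boost [NeZero k] (P : Problem X k nH nL) (κ : ℝ) (us : List (Update nH nL)) :
    Predictor X k :=
  us.foldl (P.boostStep κ) (halfPredictor X k)

/-- `us` is the sequence of updates of a complete run of POI-Boost with audits of slack `κ`: every
update is made on a pair (from `H × L` or of the form `(f_{ℓ,t}, ℓ)`) whose current error has
absolute value at least `κ ε`, with the sign of that error, and the run stops at a predictor for
which no pair has error of absolute value at least `ε`. -/
def Problem.IsPOIBoostRun [NeZero k] (P : Problem X k nH nL) (κ : ℝ)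
    (us : List (Update nH nL)) : Prop :=
  (∀ (t : ℕ) (ht : t < us.length),
    κ * P.eps ≤ us[t].sign * P.err (P.boost κ (us.take t)) us[t].rule us[t].loss) ∧
  ¬ ∃ (r : Option (Fin nH)) (l : Fin nL), P.eps ≤ |P.err (P.boost κ us) r l|

end

/-! ## Cost-sensitive learners -/

/-- A labelled example `(x, c)` with a cost vector `c`. -/
abbrev CostExample (X : Type u) (k : ℕ) := X × (Fin k → ℝ)

/-- A (possibly randomised, proper) learner for a class of `nH` hypotheses. With parameters `ρ` and
failure probability `δ` it asks for `size ρ δ` examples, runs for at most `time ρ δ` steps, and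
returns the index of a hypothesis, distributed as `hyp ρ δ S` on the sample `S`. -/
structure Learner (X : Type u) (k nH : ℕ) where
  size : ℝ → ℝ → ℕ
  time : ℝ → ℝ → ℕ
  hyp : ℝ → ℝ → List (CostExample X k) → PMF (Fin nH)

/-- The cost-sensitive weak learning guarantee, for all `ρ ∈ (0,1]` and `δ ∈ (0,1)`: for every
distribution on examples with costs in `[-1,1]` for which some `h ∈ H` has expected cost at most
`-ρ`, the learner returns with probability at least `1 - δ` (over its sample of i.i.d. examples and
its own coins) some `h' ∈ H` of expected cost at most `-ρ/2`. -/
def Learner.IsCostSensitiveWeakLearner {X : Type u} {k nH : ℕ} (A : Learner X k nH)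
    (H : Fin nH → X → Fin k) : Prop :=
  ∀ ρ δ : ℝ, 0 < ρ → ρ ≤ 1 → 0 < δ → δ < 1 →
  ∀ μ : PMF (CostExample X k), (∀ z ∈ μ.support, ∀ a, -1 ≤ z.2 a ∧ z.2 a ≤ 1) →
    (∃ i, expect μ (fun z => z.2 (H i z.1)) ≤ -ρ) →
    ENNReal.ofReal (1 - δ) ≤
      prob ((iid μ (A.size ρ δ)).bind (A.hyp ρ δ))
        {i | expect μ (fun z => z.2 (H i z.1)) ≤ -ρ / 2}

/-! ## The machine

A structured program for a real random access machine with oracles. Memory consists of arrays of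
naturals (two indices), of reals (two indices) and of individuals (one index); array names are fixed
in the program text, indices are computed. Naturals can be added, subtracted and compared, reals can
be added, subtracted, multiplied, divided and compared, and have a logarithm. Each operation costs
one step. Rounding a real up to a natural `m` costs `m` additional steps. Individuals can only be
copied and passed to the oracles. -/

/-- Natural number expressions; `get a i j` is the entry `(i, j)` of array `a`. -/
inductive NExp where
  | lit (n : ℕ)
  | get (a : ℕ) (i j : NExp)
  | add (e f : NExp)
  | sub (e f : NExp)

/-- Real expressions. -/
inductive RExp where
  | ofNat (e : NExp)
  | get (a : ℕ) (i j : NExp)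
  | add (e f : RExp)
  | sub (e f : RExp)
  | mul (e f : RExp)
  | div (e f : RExp)
  | log (e : RExp)

/-- Tests. -/
inductive BExp where
  | natLE (e f : NExp)
  | realLE (e f : RExp)
  | not (b : BExp)
  | and (b c : BExp)

/-- Programs. Destinations are written `a i j` (entry `(i, j)` of array `a`). -/
inductive Cmd where
  | skip
  | seq (c d : Cmd)
  | ite (b : BExp) (c d : Cmd)
  /-- repeat `c` as often as the value of `n` on entry says, with the round number in `(v, 0, 0)` -/
  | loop (v : ℕ) (n : NExp) (c : Cmd)
  | setN (a : ℕ) (i j : NExp) (e : NExp)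
  | setR (a : ℕ) (i j : NExp) (e : RExp)
  | copyX (a : ℕ) (i : NExp) (b : ℕ) (j : NExp)
  /-- round up to a natural number -/
  | ceil (a : ℕ) (i j : NExp) (e : RExp)
  /-- draw an RCT sample: the individual goes to `(p, i)`, the decision to `(d, i, 0)`, the outcome
  to `(o, i, 0)` -/
  | draw (p d o : ℕ) (i : NExp)
  /-- evaluate hypothesis number `h` at the individual `(p, r)` -/
  | evalH (a : ℕ) (i j : NExp) (h : NExp) (p : ℕ) (r : NExp)
  /-- evaluate loss number `l` at the individual `(p, r)`, decision `dec` and outcome `out` -/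
  | evalL (a : ℕ) (i j : NExp) (l : NExp) (p : ℕ) (r : NExp) (dec out : NExp)
  /-- the number of examples the learner wants for the parameters `ρ`, `δ` -/
  | learnerSize (a : ℕ) (i j : NExp) (ρ δ : RExp)
  /-- call the learner on the examples with individuals in array `p` and costs in the rows of the
  array `c`; it returns the number of a hypothesis -/
  | learnerCall (a : ℕ) (i j : NExp) (p c : ℕ) (ρ δ : RExp)

/-- Memory, together with the numbers of steps, of RCT samples and of calls to the learner. -/
structure State (X : Type u) where
  N : ℕ → ℕ → ℕ → ℕ
  R : ℕ → ℕ → ℕ → ℝ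
  P : ℕ → ℕ → X
  time : ℕ
  samples : ℕ
  calls : ℕ

section

variable {X : Type u} {k nH nL : ℕ}

def State.tick (s : State X) (n : ℕ) : State X := { s with time := s.time + n }

def State.setN (s : State X) (a i j v : ℕ) : State X :=
  { s with N := fun a' i' j' => if a' = a ∧ i' = i ∧ j' = j then v else s.N a' i' j' }

def State.setR (s : State X) (a i j : ℕ) (v : ℝ) : State X :=
  { s with R := fun a' i' j' => if a' = a ∧ i' = i ∧ j' = j then v else s.R a' i' j' }

def State.setP (s : State X) (a i : ℕ) (v : X) : State X :=
  { s with P := fun a' i' => if a' = a ∧ i' = i then v else s.P a' i' }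

def NExp.eval (s : State X) : NExp → ℕ
  | .lit n => n
  | .get a i j => s.N a (i.eval s) (j.eval s)
  | .add e f => e.eval s + f.eval s
  | .sub e f => e.eval s - f.eval s

def NExp.cost : NExp → ℕ
  | .lit _ => 1
  | .get _ i j => 1 + i.cost + j.cost
  | .add e f => 1 + e.cost + f.cost
  | .sub e f => 1 + e.cost + f.cost

def RExp.eval (s : State X) : RExp → ℝ
  | .ofNat e => (e.eval s : ℝ)
  | .get a i j => s.R a (i.eval s) (j.eval s)
  | .add e f => e.eval s + f.eval s
  | .sub e f => e.eval s - f.eval s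
  | .mul e f => e.eval s * f.eval s
  | .div e f => e.eval s / f.eval s
  | .log e => Real.log (e.eval s)

def RExp.cost : RExp → ℕ
  | .ofNat e => 1 + e.cost
  | .get _ i j => 1 + i.cost + j.cost
  | .add e f => 1 + e.cost + f.cost
  | .sub e f => 1 + e.cost + f.cost
  | .mul e f => 1 + e.cost + f.cost
  | .div e f => 1 + e.cost + f.cost
  | .log e => 1 + e.cost

def BExp.holds (s : State X) : BExp → Prop
  | .natLE e f => e.eval s ≤ f.eval s
  | .realLE e f => e.eval s ≤ f.eval s
  | .not b => ¬ b.holds s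
  | .and b c => b.holds s ∧ c.holds s

def BExp.cost : BExp → ℕ
  | .natLE e f => 1 + e.cost + f.cost
  | .realLE e f => 1 + e.cost + f.cost
  | .not b => 1 + b.cost
  | .and b c => 1 + b.cost + c.cost

/-- What the program runs against: the learning problem, the learner, and the times needed to
evaluate one hypothesis and one loss. -/
structure World (X : Type u) (k nH nL : ℕ) where
  problem : Problem X k nH nL
  learner : Learner X k nH
  tauH : ℕ
  tauL : ℕ

/-- The value returned by the hypothesis oracle (`0` if there is no such hypothesis). -/
def Problem.evalH (P : Problem X k nH nL) (h : ℕ) (x : X) : ℕ :=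
  if hh : h < nH then P.H ⟨h, hh⟩ x else 0

/-- The value returned by the loss oracle (`0` if there is no such loss or decision). -/
def Problem.evalL (P : Problem X k nH nL) (l : ℕ) (x : X) (a y : ℕ) : ℝ :=
  if hl : l < nL then if ha : a < k then P.L ⟨l, hl⟩ x ⟨a, ha⟩ (decide (y ≠ 0)) else 0 else 0

/-- The first `m` examples stored in the arrays `p` (individuals) and `c` (costs). -/
def State.dataset (k : ℕ) (s : State X) (p c m : ℕ) : List (CostExample X k) :=
  (List.range m).map fun j => (s.P p j, fun a => s.R c j a)

open Classical in
/-- The random final state of a program; the counters are advanced along the way. -/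
def run [NeZero k] (W : World X k nH nL) : Cmd → State X → PMF (State X)
  | .skip, s => PMF.pure (s.tick 1)
  | .seq c d, s => (run W c s).bind (run W d)
  | .ite b c d, s =>
      if b.holds s then run W c (s.tick (1 + b.cost)) else run W d (s.tick (1 + b.cost))
  | .loop v n c, s =>
      rounds (fun i s' => run W c ((s'.setN v 0 0 i).tick 1)) (s.tick (1 + n.cost)) (n.eval s)
  | .setN a i j e, s =>
      PMF.pure ((s.setN a (i.eval s) (j.eval s) (e.eval s)).tick
        (1 + i.cost + j.cost + e.cost))
  | .setR a i j e, s =>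
      PMF.pure ((s.setR a (i.eval s) (j.eval s) (e.eval s)).tick
        (1 + i.cost + j.cost + e.cost))
  | .copyX a i b j, s =>
      PMF.pure ((s.setP a (i.eval s) (s.P b (j.eval s))).tick (1 + i.cost + j.cost))
  | .ceil a i j e, s =>
      PMF.pure ((s.setN a (i.eval s) (j.eval s) ⌈e.eval s⌉₊).tick
        (1 + i.cost + j.cost + e.cost + ⌈e.eval s⌉₊))
  | .draw p d o i, s =>
      W.problem.rct.map fun z =>
        { (((s.setP p (i.eval s) z.1).setN d (i.eval s) 0 z.2.1).setN o (i.eval s) 0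
            (if z.2.2 then 1 else 0)).tick (1 + i.cost) with samples := s.samples + 1 }
  | .evalH a i j h p r, s =>
      PMF.pure ((s.setN a (i.eval s) (j.eval s)
        (W.problem.evalH (h.eval s) (s.P p (r.eval s)))).tick
        (1 + i.cost + j.cost + h.cost + r.cost + W.tauH))
  | .evalL a i j l p r dec out, s =>
      PMF.pure ((s.setR a (i.eval s) (j.eval s)
        (W.problem.evalL (l.eval s) (s.P p (r.eval s)) (dec.eval s) (out.eval s))).tick
        (1 + i.cost + j.cost + l.cost + r.cost + dec.cost + out.cost + W.tauL))
  | .learnerSize a i j ρ δ, s =>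
      PMF.pure ((s.setN a (i.eval s) (j.eval s) (W.learner.size (ρ.eval s) (δ.eval s))).tick
        (1 + i.cost + j.cost + ρ.cost + δ.cost))
  | .learnerCall a i j p c ρ δ, s =>
      (W.learner.hyp (ρ.eval s) (δ.eval s)
        (s.dataset k p c (W.learner.size (ρ.eval s) (δ.eval s)))).map fun h =>
        { (s.setN a (i.eval s) (j.eval s) h).tick
            (1 + i.cost + j.cost + ρ.cost + δ.cost + W.learner.time (ρ.eval s) (δ.eval s)) with
          calls := s.calls + 1 }

/-- The initial state. The inputs `|Ŷ|`, `|H|`, `|L|` are in the natural arrays `2`, `3`, `4`, the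
inputs `ε`, `ℓ_max`, `δ` in the real arrays `0`, `1`, `2` (at indices `0, 0`); all other numbers are
`0`, and the individuals in memory are some arbitrary `x₀`. -/
def initial (P : Problem X k nH nL) (δ : ℝ) (x₀ : X) : State X where
  N := fun a i j => if i = 0 ∧ j = 0 then
    (if a = 2 then k else if a = 3 then nH else if a = 4 then nL else 0) else 0
  R := fun a i j => if i = 0 ∧ j = 0 then
    (if a = 0 then P.eps else if a = 1 then P.lmax else if a = 2 then δ else 0) else 0
  P := fun _ _ => x₀
  time := 0
  samples := 0
  calls := 0

/-- The output of a program is a sequence of updates of POI-Boost (an implicit representation of the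
resulting predictor): its length is the natural number `(0, 0, 0)`, and row `t` of the natural array
`1` holds the loss, the decision rule (`0` for `f_{ℓ,t}`, `i + 1` for hypothesis `i`) and the sign
(`1` for `+`, `0` for `-`) of update `t`. -/
def State.Outputs (s : State X) (us : List (Update nH nL)) : Prop :=
  s.N 0 0 0 = us.length ∧
  ∀ (t : ℕ) (ht : t < us.length),
    s.N 1 t 0 = us[t].loss ∧
    s.N 1 t 1 = (match us[t].rule with | none => 0 | some i => (i : ℕ) + 1) ∧
    s.N 1 t 2 = if us[t].pos then 1 else 0

end

end

end PerfOmni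

/-! Termination is a potential argument. The potential of a predictor `q` is the expectation over
`D` of the squared distance between the vectors `q x` and `p* x`. It is at most `k`. An update on a
pair with signed error at least `κε` is a projected gradient step and lowers it by at least
`(κε/ℓ_max)²` (`potential_boostStep_le`). With `κ = 1/8` there are at most `64 k ℓ_max²/ε²` updates
(`length_mul_le`), so a number `T` of rounds exceeding this suffices if each round either makes a
legitimate update or certifies that no pair has error `ε` or more. In the latter case POI and DOI
hold by definition, and with the optimality of `f_ℓ` for the modelled risk they give the
omniprediction bound.

Errors are estimated from RCT samples. The residual of a sample, counted only when the random
decision agrees with the audited rule, has mean `err/(k ℓ_max)` (`expect_rct_stat`). Each round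
draws fresh samples, so the current predictor is fixed beforehand, and a Chernoff bound with a union
bound over `(|H|+1)|L|` pairs makes all estimates accurate to `ρ/8`, `ρ = min(ε/(k ℓ_max), 1)`
(`wsum_not_accurate_le`). The threshold `3/8` then accepts only errors of at least `ε/4` and misses
only errors below `ε/2`.

Enumerating `H` would be too slow, so hypotheses are proposed by the weak learner. For each loss and
sign the samples become cost vectors for which the cost of `h` is minus its signed error divided by
`k ℓ_max` (`expect_costExample`). If some hypothesis has signed error at least `ε`, the learner
returns, unless it fails, one of error at least `ε/2`, which the audit accepts (`wsum_missed_le`,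
`fail_tryLearner`). Accuracy holds for all hypotheses at once, so the learner may reuse the audit
sample. The post-processing rules `f_ℓ` are audited directly.

For the machine program, `Post` and the frame lemma `post_agree` show that deterministic fragments
compute what is claimed, and `fail` accumulates failure probabilities through sequences and loops.
Inaccurate estimates and learner failures cost at most `δ/2` each over all rounds (`total_fail_le`).
Resources are bounded on every execution by polynomials read off the program text (`used_le`). The
loop over losses is kept apart: it yields the explicit factor `|L|`, which no polynomial in `log
|L|` could absorb, and it draws no samples. -/

namespace PerfOmni

/-! ## Expectations of extended nonnegative functions -/

/-- The expectation of a function with values in `[0, ∞]`. -/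
noncomputable def wsum {α : Type*} (μ : PMF α) (g : α → ENNReal) : ENNReal := ∑' a, μ a * g a

section wsum

variable {α β : Type*}

theorem wsum_pure (a : α) (g : α → ENNReal) : wsum (PMF.pure a) g = g a := by
  classical
  unfold wsum
  rw [tsum_eq_single a]
  · simp
  · intro b hb; simp [PMF.pure_apply, hb]

theorem wsum_bind (μ : PMF α) (f : α → PMF β) (g : β → ENNReal) :
    wsum (μ.bind f) g = wsum μ fun a => wsum (f a) g := by
  unfold wsum
  simp only [PMF.bind_apply, ← ENNReal.tsum_mul_right, ← ENNReal.tsum_mul_left]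
  rw [ENNReal.tsum_comm]
  simp only [mul_assoc]

theorem wsum_map (μ : PMF α) (f : α → β) (g : β → ENNReal) :
    wsum (μ.map f) g = wsum μ fun a => g (f a) := by
  rw [PMF.map, wsum_bind]
  simp [wsum_pure]

theorem wsum_mono_support {μ : PMF α} {g h : α → ENNReal} (H : ∀ a ∈ μ.support, g a ≤ h a) :
    wsum μ g ≤ wsum μ h := by
  refine ENNReal.tsum_le_tsum fun a => ?_
  by_cases ha : a ∈ μ.support
  · gcongr; exact H a ha
  · rw [PMF.mem_support_iff, not_not] at ha
    simp [ha]

theorem wsum_mono {μ : PMF α} {g h : α → ENNReal} (H : ∀ a, g a ≤ h a) :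
    wsum μ g ≤ wsum μ h :=
  wsum_mono_support fun a _ => H a

theorem wsum_const (μ : PMF α) (c : ENNReal) : wsum μ (fun _ => c) = c := by
  unfold wsum
  rw [ENNReal.tsum_mul_right, μ.tsum_coe, one_mul]

theorem wsum_le_of_support {μ : PMF α} {g : α → ENNReal} {c : ENNReal}
    (H : ∀ a ∈ μ.support, g a ≤ c) : wsum μ g ≤ c :=
  (wsum_mono_support H).trans_eq (wsum_const μ c)

theorem wsum_add (μ : PMF α) (g h : α → ENNReal) :
    wsum μ (fun a => g a + h a) = wsum μ g + wsum μ h := by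
  unfold wsum
  simp only [mul_add, ENNReal.tsum_add]

theorem wsum_finset_sum {ι : Type*} (μ : PMF α) (t : Finset ι) (g : ι → α → ENNReal) :
    wsum μ (fun a => ∑ i ∈ t, g i a) = ∑ i ∈ t, wsum μ (g i) := by
  classical
  induction t using Finset.induction_on with
  | empty => simp [wsum_const]
  | insert i t hi ih => simp only [Finset.sum_insert hi, wsum_add, ih]

theorem wsum_mul_right (μ : PMF α) (g : α → ENNReal) (c : ENNReal) :
    wsum μ (fun a => g a * c) = wsum μ g * c := by
  unfold wsum
  simp only [← mul_assoc, ENNReal.tsum_mul_right]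

open Classical in
theorem prob_eq_wsum (μ : PMF α) (E : Set α) :
    prob μ E = wsum μ fun a => if a ∈ E then 1 else 0 := by
  unfold prob wsum
  rw [PMF.toOuterMeasure_apply]
  refine tsum_congr fun a => ?_
  by_cases h : a ∈ E <;> simp [h]

theorem prob_add_compl (μ : PMF α) (E : Set α) : prob μ E + prob μ Eᶜ = 1 := by
  classical
  rw [prob_eq_wsum, prob_eq_wsum, ← wsum_add]
  refine Eq.trans ?_ (wsum_const μ 1)
  congr 1
  funext a
  by_cases h : a ∈ E <;> simp [h]

theorem prob_le_one (μ : PMF α) (E : Set α) : prob μ E ≤ 1 := by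
  rw [← prob_add_compl μ E]; exact le_self_add

theorem le_prob_of_compl_le {μ : PMF α} {E : Set α} {d : ℝ} (hd : 0 ≤ d)
    (h : prob μ Eᶜ ≤ ENNReal.ofReal d) : ENNReal.ofReal (1 - d) ≤ prob μ E := by
  rw [ENNReal.ofReal_sub _ hd, ENNReal.ofReal_one, tsub_le_iff_right, ← prob_add_compl μ E]
  gcongr

theorem prob_compl_le {μ : PMF α} {E : Set α} {d : ℝ} (hd : 0 ≤ d) (hd1 : d ≤ 1)
    (h : ENNReal.ofReal (1 - d) ≤ prob μ E) : prob μ Eᶜ ≤ ENNReal.ofReal d := by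
  have h1 := prob_add_compl μ E
  have h2 : prob μ E ≠ ⊤ := (prob_le_one μ E).trans_lt ENNReal.one_lt_top |>.ne
  have h3 : prob μ Eᶜ = 1 - prob μ E := by rw [← h1, ENNReal.add_sub_cancel_left h2]
  rw [h3, tsub_le_iff_right]
  calc (1 : ENNReal) = ENNReal.ofReal (d + (1 - d)) := by simp
    _ = ENNReal.ofReal d + ENNReal.ofReal (1 - d) := ENNReal.ofReal_add hd (by linarith)
    _ ≤ _ := by gcongr

end wsum

/-! ## Expectations of bounded real functions -/

/-- A bounded real function. -/
def IsBdd {α : Type*} (f : α → ℝ) : Prop := ∃ C, ∀ a, |f a| ≤ C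

section expect

universe u v
variable {α : Type u} {β : Type u} {μ : PMF α} {f g : α → ℝ}

theorem IsBdd.const (c : ℝ) : IsBdd (fun _ : α => c) := ⟨|c|, fun _ => le_rfl⟩

theorem IsBdd.add (hf : IsBdd f) (hg : IsBdd g) : IsBdd (fun a => f a + g a) := by
  obtain ⟨C, hC⟩ := hf
  obtain ⟨D, hD⟩ := hg
  exact ⟨C + D, fun a => (abs_add_le _ _).trans (add_le_add (hC a) (hD a))⟩

theorem IsBdd.mul (hf : IsBdd f) (hg : IsBdd g) : IsBdd (fun a => f a * g a) := by
  obtain ⟨C, hC⟩ := hf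
  obtain ⟨D, hD⟩ := hg
  refine ⟨C * D, fun a => ?_⟩
  rw [abs_mul]
  exact mul_le_mul (hC a) (hD a) (abs_nonneg _) ((abs_nonneg _).trans (hC a))

theorem IsBdd.sum {ι : Type*} (t : Finset ι) {F : ι → α → ℝ} (h : ∀ i, IsBdd (F i)) :
    IsBdd (fun a => ∑ i ∈ t, F i a) := by
  classical
  induction t using Finset.induction_on with
  | empty => simpa using IsBdd.const 0
  | insert i t hi ih => simpa only [Finset.sum_insert hi] using (h i).add ih

theorem summable_toReal (μ : PMF α) : Summable fun a => (μ a).toReal :=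
  ENNReal.summable_toReal μ.tsum_coe_ne_top

theorem tsum_toReal_eq_one (μ : PMF α) : ∑' a, (μ a).toReal = 1 := by
  rw [← ENNReal.tsum_toReal_eq (fun a => μ.apply_ne_top a), μ.tsum_coe, ENNReal.toReal_one]

theorem IsBdd.summable (hf : IsBdd f) (μ : PMF α) : Summable fun a => (μ a).toReal * f a := by
  obtain ⟨C, hC⟩ := hf
  refine Summable.of_norm_bounded ((summable_toReal μ).mul_right C) fun a => ?_
  rw [norm_mul, Real.norm_eq_abs, Real.norm_eq_abs, abs_of_nonneg ENNReal.toReal_nonneg]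
  exact mul_le_mul_of_nonneg_left (hC a) ENNReal.toReal_nonneg

theorem expect_congr_support (h : ∀ a ∈ μ.support, f a = g a) : expect μ f = expect μ g := by
  refine tsum_congr fun a => ?_
  by_cases ha : a ∈ μ.support
  · rw [h a ha]
  · rw [PMF.mem_support_iff, not_not] at ha
    simp [ha]

theorem expect_const (μ : PMF α) (c : ℝ) : expect μ (fun _ => c) = c := by
  unfold expect
  rw [tsum_mul_right, tsum_toReal_eq_one, one_mul]

theorem expect_add (hf : IsBdd f) (hg : IsBdd g) :
    expect μ (fun a => f a + g a) = expect μ f + expect μ g := by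
  unfold expect
  simp only [mul_add]
  exact (hf.summable μ).tsum_add (hg.summable μ)

theorem expect_sub (hf : IsBdd f) (hg : IsBdd g) :
    expect μ (fun a => f a - g a) = expect μ f - expect μ g := by
  unfold expect
  simp only [mul_sub]
  exact (hf.summable μ).tsum_sub (hg.summable μ)

theorem expect_const_mul (c : ℝ) (f : α → ℝ) :
    expect μ (fun a => c * f a) = c * expect μ f := by
  unfold expect
  rw [← tsum_mul_left]
  refine tsum_congr fun a => by ring

theorem expect_mono (hf : IsBdd f) (hg : IsBdd g) (h : ∀ a, f a ≤ g a) :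
    expect μ f ≤ expect μ g :=
  (hf.summable μ).tsum_le_tsum
    (fun a => mul_le_mul_of_nonneg_left (h a) ENNReal.toReal_nonneg) (hg.summable μ)

theorem abs_expect_le {C : ℝ} (h : ∀ a, |f a| ≤ C) : |expect μ f| ≤ C := by
  have hf : IsBdd f := ⟨C, h⟩
  rw [abs_le]
  constructor
  · rw [← expect_const μ (-C)]
    exact expect_mono (IsBdd.const _) hf fun a => (abs_le.1 (h a)).1
  · rw [← expect_const μ C]
    exact expect_mono hf (IsBdd.const _) fun a => (abs_le.1 (h a)).2

theorem ofReal_expect (hf : IsBdd f) (h0 : ∀ a, 0 ≤ f a) :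
    ENNReal.ofReal (expect μ f) = wsum μ fun a => ENNReal.ofReal (f a) := by
  unfold expect wsum
  rw [ENNReal.ofReal_tsum_of_nonneg (fun a => mul_nonneg ENNReal.toReal_nonneg (h0 a))
    (hf.summable μ)]
  refine tsum_congr fun a => ?_
  rw [ENNReal.ofReal_mul ENNReal.toReal_nonneg, ENNReal.ofReal_toReal (μ.apply_ne_top a)]

theorem expect_nonneg (h0 : ∀ a, 0 ≤ f a) : 0 ≤ expect μ f :=
  tsum_nonneg fun a => mul_nonneg ENNReal.toReal_nonneg (h0 a)

theorem expect_bind {γ : Type v} (ν : PMF γ) (F : γ → PMF α) (hf : IsBdd f) :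
    expect (ν.bind F) f = expect ν fun c => expect (F c) f := by
  obtain ⟨C, hC⟩ := hf
  have hbE : ∀ {h : α → ℝ} {D : ℝ}, (∀ a, |h a| ≤ D) → IsBdd fun c => expect (F c) h :=
    fun h => ⟨_, fun c => abs_expect_le h⟩
  -- For nonnegative functions the sums may be interchanged freely in `[0, ∞]`; a bounded `f` is
  -- reduced to this case by adding its bound `C`.
  have key : ∀ h : α → ℝ, (∀ a, 0 ≤ h a) → IsBdd h →
      expect (ν.bind F) h = expect ν fun c => expect (F c) h := by
    intro h h0 hb
    have hb' := hb
    obtain ⟨D, hD⟩ := hb'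
    rw [← ENNReal.toReal_ofReal (expect_nonneg (μ := ν.bind F) h0),
      ← ENNReal.toReal_ofReal (expect_nonneg (μ := ν) fun c => expect_nonneg (μ := F c) h0),
      ofReal_expect hb h0, ofReal_expect (hbE hD) (fun c => expect_nonneg h0), wsum_bind]
    simp only [ofReal_expect hb h0]
  have h1 := key (fun a => f a + C) (fun a => by linarith [(abs_le.1 (hC a)).1])
    (IsBdd.add ⟨C, hC⟩ (IsBdd.const C))
  have hf : IsBdd f := ⟨C, hC⟩
  simp only [expect_add hf (IsBdd.const C), expect_const] at h1
  rw [expect_add (hbE hC) (IsBdd.const C), expect_const] at h1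
  linarith

theorem expect_pure (a : α) (f : α → ℝ) : expect (PMF.pure a) f = f a := by
  classical
  unfold expect
  rw [tsum_eq_single a]
  · simp
  · intro b hb; simp [PMF.pure_apply, hb]

theorem expect_map {γ : Type v} (ν : PMF γ) (F : γ → α) (hf : IsBdd f) :
    expect (ν.map F) f = expect ν fun c => f (F c) := by
  rw [PMF.map, expect_bind _ _ hf]
  simp [expect_pure]

theorem expect_coin (p : I) (f : Bool → ℝ) :
    expect (coin p) f = p * f true + (1 - p) * f false := by
  have h1 : (0 : ℝ) ≤ 1 - (p : ℝ) := sub_nonneg.2 p.2.2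
  simp [expect, coin, ENNReal.toReal_ofReal h1, ENNReal.toReal_ofReal p.2.1]

theorem expect_uniform {k : ℕ} [NeZero k] (f : Fin k → ℝ) :
    expect (PMF.uniformOfFintype (Fin k)) f = (∑ a, f a) / k := by
  simp [expect, tsum_fintype, ← Finset.mul_sum]
  ring

end expect

/-! ## Independent samples -/

section iid

universe u
variable {α β : Type u}

theorem iid_map (μ : PMF α) (f : α → β) (n : ℕ) :
    iid (μ.map f) n = (iid μ n).map (List.map f) := by
  induction n with
  | zero => simp [iid, PMF.pure_map]
  | succ n ih =>
    simp only [iid, ih, PMF.map_bind, PMF.bind_map, PMF.map_comp]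
    congr 1
    funext l
    simp only [Function.comp]
    congr 1
    funext a
    simp

theorem length_of_mem_support_iid {μ : PMF α} {n : ℕ} {S : List α}
    (h : S ∈ (iid μ n).support) : S.length = n := by
  induction n generalizing S with
  | zero => simp [iid] at h; simp [h]
  | succ n ih =>
    simp only [iid, PMF.mem_support_bind_iff, PMF.mem_support_map_iff] at h
    obtain ⟨l, hl, a, -, rfl⟩ := h
    simp [ih hl]

theorem wsum_iid_succ (μ : PMF α) (n : ℕ) (G : List α → ENNReal) :
    wsum (iid μ (n + 1)) G = wsum (iid μ n) fun S => wsum μ fun z => G (S ++ [z]) := by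
  simp [iid, wsum_bind, wsum_map]

/-- The learner reads only a prefix of the sample drawn in a round; this makes that prefix a genuine
i.i.d. sample of the size it asked for. -/
theorem wsum_iid_take (μ : PMF α) (m n : ℕ) (G : List α → ENNReal) :
    wsum (iid μ (m + n)) (fun S => G (S.take m)) = wsum (iid μ m) G := by
  induction n with
  | zero =>
    rw [add_zero]
    refine le_antisymm (wsum_mono_support fun S hS => ?_) (wsum_mono_support fun S hS => ?_) <;>
    · rw [List.take_of_length_le (length_of_mem_support_iid hS).le]
  | succ n ih =>
    rw [← ih, ← add_assoc, wsum_iid_succ]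
    refine le_antisymm (wsum_mono_support fun S hS => ?_) (wsum_mono_support fun S hS => ?_) <;>
    · have := length_of_mem_support_iid hS
      simp [List.take_append_of_le_length (show m ≤ S.length by omega), wsum_const]

theorem wsum_iid_prod (μ : PMF α) (n : ℕ) (f : α → ENNReal) :
    wsum (iid μ n) (fun S => (S.map f).prod) = wsum μ f ^ n := by
  induction n with
  | zero => simp [iid, wsum_pure]
  | succ n ih =>
    rw [wsum_iid_succ, pow_succ, ← ih, ← wsum_mul_right]
    congr 1
    funext S
    simp only [List.map_append, List.prod_append, List.map_cons, List.map_nil, List.prod_cons,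
      List.prod_nil, mul_one]
    rw [← mul_comm (wsum μ f), ← wsum_mul_right]
    simp only [mul_comm]

theorem sum_map_sub_const (S : List α) (f : α → ℝ) (c : ℝ) :
    (S.map fun z => f z - c).sum = (S.map f).sum - S.length * c := by
  induction S with
  | nil => simp
  | cons a S ih => simp [ih]; ring

open Classical in
/-- One-sided Chernoff bound. -/
theorem chernoff {μ : PMF α} {g : α → ℝ} (hg : ∀ z, |g z| ≤ 1) {τ : ℝ} (h0 : 0 ≤ τ) (h1 : τ ≤ 1)
    (n : ℕ) :
    wsum (iid μ n) (fun S => if (S.map g).sum - n * expect μ g > n * τ then 1 else 0) ≤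
      ENNReal.ofReal (Real.exp (-(n * τ ^ 2 / 16))) := by
  set m := expect μ g with hm
  have hgb : IsBdd g := ⟨1, hg⟩
  have hmb : |m| ≤ 1 := abs_expect_le hg
  have hd : ∀ z, |g z - m| ≤ 2 := fun z => (abs_sub _ _).trans (by linarith [hg z])
  -- The minimiser of the final exponent `4c² - cτ` per sample, with minimum `-τ²/16`.
  set c : ℝ := τ / 8 with hc
  have hx : ∀ z, |c * (g z - m)| ≤ 1 := fun z => by
    rw [abs_mul, abs_of_nonneg (by positivity : 0 ≤ c)]
    nlinarith [hd z, abs_nonneg (g z - m)]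
  -- `exp u ≤ 1 + u + u²` for `|u| ≤ 1`, with `(g z - m)² ≤ 4`; the linear term vanishes in
  -- expectation.
  have hexp : ∀ z, Real.exp (c * (g z - m)) ≤ (1 + 4 * c ^ 2 - c * m) + c * g z := fun z => by
    have h := Real.abs_exp_sub_one_sub_id_le (hx z)
    have h2 := (abs_le.1 h).2
    have h3 : (g z - m) ^ 2 ≤ 4 := by
      have := sq_abs (g z - m)
      nlinarith [hd z, abs_nonneg (g z - m)]
    nlinarith [sq_nonneg c]
  have hbexp : IsBdd fun z => Real.exp (c * (g z - m)) := ⟨Real.exp 1, fun z => by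
    rw [abs_of_pos (Real.exp_pos _)]
    exact Real.exp_le_exp.2 (le_of_abs_le (hx z))⟩
  have hone : wsum μ (fun z => ENNReal.ofReal (Real.exp (c * (g z - m)))) ≤
      ENNReal.ofReal (Real.exp (4 * c ^ 2)) := by
    rw [← ofReal_expect hbexp fun z => (Real.exp_pos _).le]
    refine ENNReal.ofReal_le_ofReal ?_
    calc expect μ (fun z => Real.exp (c * (g z - m)))
        ≤ expect μ (fun z => (1 + 4 * c ^ 2 - c * m) + c * g z) :=
          expect_mono hbexp ((IsBdd.const _).add ((IsBdd.const _).mul hgb)) hexp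
      _ = 1 + 4 * c ^ 2 := by
          rw [expect_add (IsBdd.const _) ((IsBdd.const _).mul hgb), expect_const,
            expect_const_mul]
          ring
      _ ≤ _ := by linarith [Real.add_one_le_exp (4 * c ^ 2)]
  have hprod : ∀ S : List α, (S.map fun z => ENNReal.ofReal (Real.exp (c * (g z - m)))).prod =
      ENNReal.ofReal (Real.exp (c * ((S.map g).sum - S.length * m))) := by
    intro S
    rw [← sum_map_sub_const]
    induction S with
    | nil => simp
    | cons a S ih =>
      simp only [List.map_cons, List.prod_cons, List.sum_cons, ih]
      rw [← ENNReal.ofReal_mul (Real.exp_pos _).le, ← Real.exp_add, mul_add]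
  calc wsum (iid μ n) (fun S => if (S.map g).sum - n * m > n * τ then 1 else 0)
      ≤ wsum (iid μ n) (fun S => (S.map fun z => ENNReal.ofReal (Real.exp (c * (g z - m)))).prod *
          ENNReal.ofReal (Real.exp (-(c * (n * τ))))) := by
        -- Markov's inequality, pointwise: the indicator is at most `exp (c (∑ (g - m) - nτ))`.
        refine wsum_mono_support fun S hS => ?_
        rw [hprod, length_of_mem_support_iid hS, ← ENNReal.ofReal_mul (Real.exp_pos _).le,
          ← Real.exp_add]
        split_ifs with h
        · rw [← ENNReal.ofReal_one]
          refine ENNReal.ofReal_le_ofReal ?_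
          rw [Real.one_le_exp_iff]
          have : c * (n * τ) ≤ c * ((S.map g).sum - n * m) :=
            mul_le_mul_of_nonneg_left h.le (by positivity)
          linarith
        · exact bot_le
    _ = wsum μ (fun z => ENNReal.ofReal (Real.exp (c * (g z - m)))) ^ n *
          ENNReal.ofReal (Real.exp (-(c * (n * τ)))) := by
        rw [wsum_mul_right, wsum_iid_prod]
    _ ≤ ENNReal.ofReal (Real.exp (4 * c ^ 2)) ^ n *
          ENNReal.ofReal (Real.exp (-(c * (n * τ)))) := by gcongr
    _ = ENNReal.ofReal (Real.exp (-(n * τ ^ 2 / 16))) := by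
        rw [← ENNReal.ofReal_pow (Real.exp_pos _).le, ← Real.exp_nat_mul,
          ← ENNReal.ofReal_mul (Real.exp_pos _).le, ← Real.exp_add]
        congr 2
        rw [hc]; ring

open Classical in
/-- Two-sided Chernoff bound. -/
theorem chernoff_abs {μ : PMF α} {g : α → ℝ} (hg : ∀ z, |g z| ≤ 1) {τ : ℝ} (h0 : 0 ≤ τ)
    (h1 : τ ≤ 1) (n : ℕ) :
    wsum (iid μ n) (fun S => if |(S.map g).sum - n * expect μ g| > n * τ then 1 else 0) ≤
      2 * ENNReal.ofReal (Real.exp (-(n * τ ^ 2 / 16))) := by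
  have hneg : expect μ (fun z => -g z) = -expect μ g := by
    simpa using expect_const_mul (μ := μ) (-1) g
  have hsum : ∀ S : List α, (S.map fun z => -g z).sum = -(S.map g).sum := fun S => by
    induction S with
    | nil => simp
    | cons a S ih => simp [ih]; ring
  rw [two_mul]
  refine le_trans ?_ (add_le_add (chernoff (μ := μ) hg h0 h1 n)
    (chernoff (μ := μ) (g := fun z => -g z) (by simpa using hg) h0 h1 n))
  rw [← wsum_add]
  refine wsum_mono fun S => ?_
  rw [hneg, hsum]
  by_cases h : |(S.map g).sum - n * expect μ g| > n * τ
  · rcases lt_abs.1 h with h' | h'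
    · rw [if_pos h, if_pos h']; exact le_self_add
    · rw [if_pos h, if_pos (show _ > _ by linarith : -(S.map g).sum - n * -expect μ g > n * τ)]
      exact le_add_self
  · rw [if_neg h]; exact bot_le

end iid

/-! ## Analysis of POI-Boost -/

section boosting

universe u
variable {X : Type u} {k nH nL : ℕ}

/-- `1` or `-1`. -/
def sgn (b : Bool) : ℝ := if b then 1 else -1

theorem abs_sgn (b : Bool) : |sgn b| = 1 := by
  cases b <;> simp [sgn]

theorem condLoss_eq (p : Predictor X k) (l : Loss X k) (x : X) (a : Fin k) :
    condLoss p l x a = p x a * l x a true + (1 - p x a) * l x a false :=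
  expect_coin _ _

/-- `ℓ(x, a, 1) - ℓ(x, a, 0)`. -/
def Problem.gap (P : Problem X k nH nL) (l : Fin nL) (x : X) (a : Fin k) : ℝ :=
  P.L l x a true - P.L l x a false

theorem Problem.Bounded.abs_gap_le {P : Problem X k nH nL} (hB : P.Bounded) (l : Fin nL) (x : X)
    (a : Fin k) : |P.gap l x a| ≤ P.lmax := by
  have h1 := hB l x a true
  have h2 := hB l x a false
  rw [Problem.gap, abs_le]
  constructor <;> linarith

theorem abs_coe_sub_coe_le (p q : I) : |(p : ℝ) - q| ≤ 1 := by
  rw [abs_le]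
  constructor <;> linarith [p.2.1, p.2.2, q.2.1, q.2.2]

theorem Problem.Bounded.isBdd_condLoss {P : Problem X k nH nL} (hB : P.Bounded)
    (q : Predictor X k) (l : Fin nL) (f : X → Fin k) :
    IsBdd fun x => condLoss q (P.L l) x (f x) :=
  ⟨P.lmax, fun x => by
    beta_reduce
    rw [condLoss_eq, abs_le]
    have h1 := hB l x (f x) true
    have h2 := hB l x (f x) false
    have h3 := (q x (f x)).2
    constructor <;> nlinarith [h3.1, h3.2, sub_nonneg.2 h3.2]⟩

/-- The difference of two performative risks. -/
theorem risk_sub_risk {P : Problem X k nH nL} (hB : P.Bounded) (q q' : Predictor X k)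
    (l : Fin nL) (f : X → Fin k) :
    risk P.D q (P.L l) f - risk P.D q' (P.L l) f =
      expect P.D fun x => ((q x (f x) : ℝ) - q' x (f x)) * P.gap l x (f x) := by
  rw [risk, risk, ← expect_sub (hB.isBdd_condLoss q l f) (hB.isBdd_condLoss q' l f)]
  congr 1
  funext x
  rw [condLoss_eq, condLoss_eq, Problem.gap]
  ring

theorem abs_sub_mul_gap_le {P : Problem X k nH nL} (hB : P.Bounded) (p q : I)
    (l : Fin nL) (x : X) (a : Fin k) : |((p : ℝ) - q) * P.gap l x a| ≤ P.lmax := by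
  rw [abs_mul]
  calc _ ≤ 1 * P.lmax := by
        gcongr
        · exact abs_coe_sub_coe_le _ _
        · exact hB.abs_gap_le _ _ _
    _ = _ := one_mul _

theorem Problem.Bounded.err_eq [NeZero k] {P : Problem X k nH nL} (hB : P.Bounded) (q
    : Predictor X k)
    (r : Option (Fin nH)) (l : Fin nL) :
    P.err q r l = expect P.D fun x => ((q x (P.ruleOf q r l x) : ℝ) -
      P.nature x (P.ruleOf q r l x)) * P.gap l x (P.ruleOf q r l x) :=
  risk_sub_risk hB _ _ _ _

theorem Problem.Bounded.abs_err_le [NeZero k] {P : Problem X k nH nL} (hB : P.Bounded) (q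
    : Predictor X k)
    (r : Option (Fin nH)) (l : Fin nL) : |P.err q r l| ≤ P.lmax := by
  rw [hB.err_eq]
  exact abs_expect_le fun x => abs_sub_mul_gap_le hB _ _ _ _ _

/-! ### The potential -/

/-- The expected squared distance of a predictor from Nature. -/
noncomputable def Problem.potential (P : Problem X k nH nL) (q : Predictor X k) : ℝ :=
  expect P.D fun x => ∑ a, ((q x a : ℝ) - P.nature x a) ^ 2

theorem sq_sub_le_one (p q : I) : ((p : ℝ) - q) ^ 2 ≤ 1 := by
  rw [← sq_abs]
  exact pow_le_one₀ (abs_nonneg _) (abs_coe_sub_coe_le p q)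

theorem isBdd_sq_dist (P : Problem X k nH nL) (q : Predictor X k) :
    IsBdd fun x => ∑ a, ((q x a : ℝ) - P.nature x a) ^ 2 :=
  IsBdd.sum _ fun a => ⟨1, fun x => by
    rw [abs_of_nonneg (sq_nonneg _)]; exact sq_sub_le_one _ _⟩

theorem potential_nonneg (P : Problem X k nH nL) (q : Predictor X k) : 0 ≤ P.potential q :=
  expect_nonneg fun _ => Finset.sum_nonneg fun _ _ => sq_nonneg _

theorem potential_le (P : Problem X k nH nL) (q : Predictor X k) : P.potential q ≤ k := by
  rw [← expect_const P.D (k : ℝ)]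
  refine expect_mono (isBdd_sq_dist P q) (IsBdd.const _) fun x => ?_
  calc ∑ a, ((q x a : ℝ) - P.nature x a) ^ 2 ≤ ∑ _a : Fin k, (1 : ℝ) :=
        Finset.sum_le_sum fun a _ => sq_sub_le_one _ _
    _ = k := by simp

theorem coe_projIcc (z : ℝ) : (Set.projIcc (0 : ℝ) 1 zero_le_one z : ℝ) = max 0 (min 1 z) := rfl

/-- Clipping never hurts the potential: projection onto an interval containing Nature's value does
not move away from that value. -/
theorem sq_projIcc_sub_le (z : ℝ) (p : I) :
    ((Set.projIcc (0 : ℝ) 1 zero_le_one z : ℝ) - p) ^ 2 ≤ (z - p) ^ 2 := by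
  rw [coe_projIcc, sq_le_sq]
  have h0 := p.2.1
  have h1 := p.2.2
  rcases le_total z 0 with h | h
  · rw [min_eq_right (by linarith), max_eq_left h, abs_of_nonpos (by linarith),
      abs_of_nonpos (by linarith)]
    linarith
  · rcases le_total z 1 with h' | h'
    · rw [min_eq_right h', max_eq_right h]
    · rw [min_eq_left h', max_eq_right (by norm_num), abs_of_nonneg (by linarith),
        abs_of_nonneg (by linarith)]
      linarith

/-- An update with error at least `κ ε` decreases the potential by `κ² ε² / ℓ_max²`. -/
theorem potential_boostStep_le [NeZero k] {P : Problem X k nH nL} (hB : P.Bounded) (hl : 0 < P.lmax)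
    (he : 0 ≤ P.eps) {κ : ℝ} (hκ : 0 ≤ κ) (q : Predictor X k) (u : Update nH nL)
    (hu : κ * P.eps ≤ u.sign * P.err q u.rule u.loss) :
    P.potential (P.boostStep κ q u) ≤ P.potential q - (κ * P.eps / P.lmax) ^ 2 := by
  set η : ℝ := κ * P.eps / P.lmax ^ 2 with hη
  have hη0 : 0 ≤ η := by positivity
  set f := P.ruleOf q u.rule u.loss with hf
  have hs : u.sign ^ 2 = 1 := by
    unfold Update.sign; split_ifs <;> norm_num
  have hpt : ∀ x, ∑ a, ((P.boostStep κ q u x a : ℝ) - P.nature x a) ^ 2 ≤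
      (∑ a, ((q x a : ℝ) - P.nature x a) ^ 2 + (-(2 * u.sign * η)) *
        (((q x (f x) : ℝ) - P.nature x (f x)) * P.gap u.loss x (f x))) + η ^ 2 * P.lmax ^ 2 := by
    intro x
    -- Only the decision chosen by the rule is moved. There the cross term of the square produces
    -- the error, and the quadratic term is at most `η² ℓ_max²`.
    have h1 : ∀ a, ((P.boostStep κ q u x a : ℝ) - P.nature x a) ^ 2 ≤
        ((q x a : ℝ) - P.nature x a) ^ 2 + if f x = a then (-(2 * u.sign * η)) *
        (((q x a : ℝ) - P.nature x a) * P.gap u.loss x a) + η ^ 2 * P.lmax ^ 2 else 0 := by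
      intro a
      refine (sq_projIcc_sub_le _ _).trans ?_
      have hg : P.gap u.loss x a ^ 2 ≤ P.lmax ^ 2 := by
        rw [sq_le_sq, abs_of_pos hl]; exact hB.abs_gap_le _ _ _
      rw [← hf, ← hη]
      change ((q x a : ℝ) - u.sign * η * (P.gap u.loss x a * _) - _) ^ 2 ≤ _
      split_ifs with h
      · have : ((q x a : ℝ) - u.sign * η * (P.gap u.loss x a * 1) - P.nature x a) ^ 2 =
            ((q x a : ℝ) - P.nature x a) ^ 2 + (-(2 * u.sign * η)) *
            (((q x a : ℝ) - P.nature x a) * P.gap u.loss x a) +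
            u.sign ^ 2 * (η ^ 2 * P.gap u.loss x a ^ 2) := by ring
        rw [this, hs, one_mul]
        nlinarith [mul_le_mul_of_nonneg_left hg (sq_nonneg η)]
      · simp
    refine (Finset.sum_le_sum fun a _ => h1 a).trans ?_
    rw [Finset.sum_add_distrib, Finset.sum_ite_eq Finset.univ (f x)]
    simp [add_assoc]
  have hb2 : IsBdd fun x => ((q x (f x) : ℝ) - P.nature x (f x)) * P.gap u.loss x (f x) :=
    ⟨P.lmax, fun x => abs_sub_mul_gap_le hB _ _ _ _ _⟩
  have hb3 := (isBdd_sq_dist P q).add ((IsBdd.const (-(2 * u.sign * η))).mul hb2)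
  have h2 := expect_mono (μ := P.D) (isBdd_sq_dist P (P.boostStep κ q u))
    (hb3.add (IsBdd.const (η ^ 2 * P.lmax ^ 2))) hpt
  rw [expect_add hb3 (IsBdd.const _), expect_add (isBdd_sq_dist P q) ((IsBdd.const _).mul hb2),
    expect_const_mul, expect_const, ← hB.err_eq q u.rule u.loss] at h2
  refine h2.trans ?_
  -- The chosen `η` minimises `-2ηκε + η² ℓ_max²`; the minimum is the claimed decrease.
  have h3 : η * (κ * P.eps) ≤ η * (u.sign * P.err q u.rule u.loss) :=
    mul_le_mul_of_nonneg_left hu hη0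
  have h4 : η * (κ * P.eps) = (κ * P.eps / P.lmax) ^ 2 := by rw [hη]; field_simp
  have h5 : η ^ 2 * P.lmax ^ 2 = (κ * P.eps / P.lmax) ^ 2 := by rw [hη]; field_simp
  change P.potential q + _ + _ ≤ _
  nlinarith

/-- Every update is made on a pair with error at least `κ ε`. -/
def Problem.IsPartialRun [NeZero k] (P : Problem X k nH nL) (κ : ℝ) (us : List (Update nH nL))
    : Prop :=
  ∀ (t : ℕ) (ht : t < us.length),
    κ * P.eps ≤ us[t].sign * P.err (P.boost κ (us.take t)) us[t].rule us[t].loss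

theorem boost_append [NeZero k] (P : Problem X k nH nL) (κ : ℝ) (us : List (Update nH nL))
    (u : Update nH nL) : P.boost κ (us ++ [u]) = P.boostStep κ (P.boost κ us) u := by
  simp [Problem.boost]

theorem isPartialRun_append [NeZero k] {P : Problem X k nH nL} {κ : ℝ} {us : List (Update nH nL)}
    {u : Update nH nL} : P.IsPartialRun κ (us ++ [u]) ↔ P.IsPartialRun κ us ∧
      κ * P.eps ≤ u.sign * P.err (P.boost κ us) u.rule u.loss := by
  constructor
  · intro h
    refine ⟨fun t ht => ?_, ?_⟩
    · have := h t (by simp; omega)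
      simpa [List.getElem_append_left ht, List.take_append_of_le_length ht.le] using this
    · simpa using h us.length (by simp)
  · rintro ⟨h1, h2⟩ t ht
    rcases Nat.lt_or_ge t us.length with h | h
    · simpa [List.getElem_append_left h, List.take_append_of_le_length h.le] using h1 t h
    · obtain rfl : t = us.length := by simp at ht; omega
      simpa using h2

theorem potential_boost_le [NeZero k] {P : Problem X k nH nL} (hB : P.Bounded) (hl : 0 < P.lmax)
    (he : 0 ≤ P.eps) {κ : ℝ} (hκ : 0 ≤ κ) (us : List (Update nH nL)) (h : P.IsPartialRun κ us) :
    P.potential (P.boost κ us) ≤ k - us.length * (κ * P.eps / P.lmax) ^ 2 := by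
  induction us using List.reverseRecOn with
  | nil => simpa using potential_le P _
  | append_singleton us u ih =>
    rw [isPartialRun_append] at h
    rw [boost_append]
    refine (potential_boostStep_le hB hl he hκ _ u h.2).trans ?_
    have := ih h.1
    push_cast [List.length_append, List.length_singleton]
    linarith

/-- The number of updates of POI-Boost is bounded. -/
theorem length_mul_le [NeZero k] {P : Problem X k nH nL} (hB : P.Bounded) (hl : 0 < P.lmax)
    (he : 0 < P.eps) {us : List (Update nH nL)} (h : P.IsPartialRun (1 / 8) us) :
    (us.length : ℝ) ≤ 64 * k * (P.lmax * P.lmax) / (P.eps * P.eps) := by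
  have h1 := potential_boost_le hB hl he.le (by norm_num) us h
  have h2 := potential_nonneg P (P.boost (1 / 8) us)
  -- The potential starts at most at `k` and stays nonnegative. The constant `64` below is `1/κ²`.
  have h3 : (us.length : ℝ) * (1 / 8 * P.eps / P.lmax) ^ 2 ≤ k := by linarith
  rw [le_div_iff₀ (by positivity)]
  have h4 : (us.length : ℝ) * (1 / 8 * P.eps / P.lmax) ^ 2 * (64 * (P.lmax * P.lmax)) =
      us.length * (P.eps * P.eps) := by field_simp; norm_num
  have h5 := mul_le_mul_of_nonneg_right h3 (by positivity : 0 ≤ 64 * (P.lmax * P.lmax))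
  nlinarith

/-! ### What a complete run achieves -/

theorem firstMin_le [NeZero k] (g : Fin k → ℝ) (b : Fin k) : g (firstMin g) ≤ g b := by
  have h := Finset.min'_mem (Finset.univ.filter fun a => ∀ b, g a ≤ g b)
    (by obtain ⟨a, ha⟩ := Finite.exists_min g; exact ⟨a, by simpa using ha⟩)
  exact (Finset.mem_filter.1 h).2 b

theorem eq_firstMin [NeZero k] {g : Fin k → ℝ} {a : Fin k} (h1 : ∀ b, g a ≤ g b)
    (h2 : ∀ b < a, g a < g b) : a = firstMin g := by
  refine le_antisymm ?_ ?_
  · by_contra h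
    exact absurd (h2 _ (not_le.1 h)) (not_lt.2 (firstMin_le g a))
  · exact Finset.min'_le _ _ (by simpa using h1)

theorem isPOI_of_err_lt [NeZero k] {P : Problem X k nH nL} {q : Predictor X k}
    (h : ∀ r l, |P.err q r l| < P.eps) : P.IsPOI q P.eps := fun l i => by
  have := h (some i) l
  rw [abs_sub_comm]
  exact this.le

theorem isDOI_of_err_lt [NeZero k] {P : Problem X k nH nL} {q : Predictor X k}
    (h : ∀ r l, |P.err q r l| < P.eps) : P.IsDOI q P.eps := fun l => by
  have := h none l
  rw [abs_sub_comm]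
  exact this.le

/-- DOI passes from the true to the modelled risk of `f_ℓ`, pointwise optimality of `f_ℓ` compares
it with `h` under the model, and POI passes back to the true risk of `h`. The two passages cost `e`
each. -/
theorem isOmnipredictor_of_isPOI_of_isDOI [NeZero k] {P : Problem X k nH nL} (hB : P.Bounded)
    {q : Predictor X k} {e : ℝ} (h1 : P.IsPOI q e) (h2 : P.IsDOI q e) :
    P.IsOmnipredictor q (2 * e) := fun l i => by
  have h3 := (abs_le.1 (h1 l i)).1
  have h4 := (abs_le.1 (h2 l)).2
  have h5 : risk P.D q (P.L l) (postProcess q (P.L l)) ≤ risk P.D q (P.L l) (P.H i) :=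
    expect_mono (hB.isBdd_condLoss q l _) (hB.isBdd_condLoss q l _) fun x =>
      firstMin_le (condLoss q (P.L l) x) _
  linarith

/-! ### Auditing from RCT samples -/

/-- The contribution of one RCT sample to the normalised error of a decision rule. -/
noncomputable def Problem.stat (P : Problem X k nH nL) (q : Predictor X k) (f : X → Fin k)
    (l : Fin nL) (z : X × Fin k × Bool) : ℝ :=
  if f z.1 = z.2.1 then
    ((q z.1 z.2.1 : ℝ) - if z.2.2 then 1 else 0) * P.gap l z.1 z.2.1 / P.lmax else 0

/-- The cost-sensitive example made from one RCT sample. -/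
noncomputable def Problem.costExample (P : Problem X k nH nL) (q : Predictor X k) (l : Fin nL)
    (b : Bool) (z : X × Fin k × Bool) : CostExample X k :=
  (z.1, fun a => if a = z.2.1 then
    -(sgn b * (((q z.1 z.2.1 : ℝ) - if z.2.2 then 1 else 0) * P.gap l z.1 z.2.1 / P.lmax)) else 0)

theorem abs_normalised_le {P : Problem X k nH nL} (hB : P.Bounded) (hl : 0 < P.lmax) (p : I)
    (y : Bool) (l : Fin nL) (x : X) (a : Fin k) :
    |((p : ℝ) - if y then 1 else 0) * P.gap l x a / P.lmax| ≤ 1 := by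
  rw [abs_div, abs_of_pos hl, div_le_one hl]
  cases y
  · simpa using abs_sub_mul_gap_le hB p 0 l x a
  · simpa using abs_sub_mul_gap_le hB p 1 l x a

theorem abs_stat_le {P : Problem X k nH nL} (hB : P.Bounded) (hl : 0 < P.lmax)
    (q : Predictor X k) (f : X → Fin k) (l : Fin nL) (z : X × Fin k × Bool) :
    |P.stat q f l z| ≤ 1 := by
  rw [Problem.stat]
  by_cases h : f z.1 = z.2.1
  · rw [if_pos h]
    exact abs_normalised_le hB hl _ _ _ _ _
  · simp [h]

/-- Given `x`, the uniform decision equals `f x` with probability `1/k`, and the outcome then has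
mean `p*(x, f x)`. Hence an RCT sample serves every rule `f` at once, at the price of a factor `k`.
-/
theorem expect_rct_stat [NeZero k] {P : Problem X k nH nL} (hB : P.Bounded) (hl : 0 < P.lmax)
    (q : Predictor X k) (f : X → Fin k) (l : Fin nL) :
    expect P.rct (P.stat q f l) =
      (risk P.D q (P.L l) f - risk P.D P.nature (P.L l) f) / (k * P.lmax) := by
  have hk : (k : ℝ) ≠ 0 := Nat.cast_ne_zero.2 (NeZero.ne k)
  have hb : IsBdd (P.stat q f l) := ⟨1, abs_stat_le hB hl q f l⟩
  rw [risk_sub_risk hB, Problem.rct, expect_bind _ _ hb, div_eq_inv_mul, ← expect_const_mul]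
  congr 1
  funext x
  rw [expect_bind _ _ hb, expect_uniform]
  have : ∀ a, expect ((coin (P.nature x a)).map fun y => (x, a, y)) (P.stat q f l) =
      if f x = a then ((q x a : ℝ) - P.nature x a) * P.gap l x a / P.lmax else 0 := by
    intro a
    rw [expect_map _ _ hb, expect_coin]
    by_cases h : f x = a
    · simp [Problem.stat, h]; ring
    · simp [Problem.stat, h]
  rw [Finset.sum_congr rfl fun a _ => this a, Finset.sum_ite_eq]
  simp
  field_simp

/-- The cost vector of a sample is supported on the sampled decision, so the cost of `h` is minus
the signed statistic of `h`: low cost means large signed error. -/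
theorem expect_costExample [NeZero k] {P : Problem X k nH nL} (hB : P.Bounded) (hl : 0 < P.lmax)
    (q : Predictor X k) (l : Fin nL) (b : Bool) (i : Fin nH) :
    expect (P.rct.map (P.costExample q l b)) (fun z => z.2 (P.H i z.1)) =
      -(sgn b * P.err q (some i) l / (k * P.lmax)) := by
  have h1 : ∀ z, (P.costExample q l b z).2 (P.H i (P.costExample q l b z).1) =
      -sgn b * P.stat q (P.H i) l z := by
    intro z
    simp only [Problem.costExample, Problem.stat]
    split_ifs <;> ring
  have h2 : expect (P.rct.map (P.costExample q l b)) (fun z => z.2 (P.H i z.1)) =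
      expect P.rct fun z => (P.costExample q l b z).2 (P.H i (P.costExample q l b z).1) := by
    have hc : ∀ z, |-sgn b * P.stat q (P.H i) l z| ≤ 1 := fun z => by
      rw [abs_mul, abs_neg, abs_sgn, one_mul]
      exact abs_stat_le hB hl _ _ _ _
    -- `expect_map` wants a function bounded on all cost vectors, not only on those that occur.
    -- Clamping to `[-1,1]` changes nothing on the image of `costExample`.
    have hclamp : ∀ z, max (-1) (min 1
        ((P.costExample q l b z).2 (P.H i (P.costExample q l b z).1))) =
        (P.costExample q l b z).2 (P.H i (P.costExample q l b z).1) := fun z => by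
      rw [h1, min_eq_right (abs_le.1 (hc z)).2, max_eq_right (abs_le.1 (hc z)).1]
    have hb : IsBdd fun z : CostExample X k => max (-1) (min 1 (z.2 (P.H i z.1))) :=
      ⟨1, fun z => abs_le.2 ⟨le_max_left _ _, max_le (by norm_num) (min_le_left _ _)⟩⟩
    have h3 := expect_map P.rct (P.costExample q l b) hb
    simp only [hclamp] at h3
    rw [← h3]
    refine expect_congr_support fun z hz => ?_
    obtain ⟨w, -, rfl⟩ := (PMF.mem_support_map_iff _ _ _).1 hz
    exact (hclamp w).symm
  rw [h2]
  simp only [h1]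
  rw [expect_const_mul, expect_rct_stat hB hl]
  simp only [Problem.err, Problem.ruleOf]
  ring

theorem costExample_mem {P : Problem X k nH nL} (hB : P.Bounded) (hl : 0 < P.lmax)
    (q : Predictor X k) (l : Fin nL) (b : Bool) (z : X × Fin k × Bool) (a : Fin k) :
    -1 ≤ (P.costExample q l b z).2 a ∧ (P.costExample q l b z).2 a ≤ 1 := by
  rw [← abs_le]
  simp only [Problem.costExample]
  split_ifs with h
  all_goals first
    | simp; done
    | rw [abs_neg, abs_mul, abs_sgn, one_mul]
  · exact (by simpa using abs_normalised_le hB hl (q z.1 z.2.1) true l z.1 z.2.1)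
  · exact (by simpa using abs_normalised_le hB hl (q z.1 z.2.1) false l z.1 z.2.1)

/-- The weak learning parameter. -/
noncomputable def Problem.rho (P : Problem X k nH nL) : ℝ := min (P.eps / (k * P.lmax)) 1

theorem rho_pos [NeZero k] {P : Problem X k nH nL} (hl : 0 < P.lmax) (he : 0 < P.eps) : 0 < P.rho
    := by
  have : (0 : ℝ) < k := Nat.cast_pos.2 (NeZero.pos k)
  exact lt_min (by positivity) one_pos

/-- The estimates of all errors made from a sample are accurate. -/
def Problem.Accurate [NeZero k] (P : Problem X k nH nL) (q : Predictor X k)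
    (S : List (X × Fin k × Bool)) : Prop :=
  ∀ r l, |(S.map (P.stat q (P.ruleOf q r l) l)).sum - S.length * (P.err q r l / (k * P.lmax))| ≤
    S.length * (P.rho / 8)

-- The predictor `q` is fixed before the sample is drawn, and so is the rule coded by `none`, which
-- depends only on `q` and the loss. Thus a union bound over `(|H|+1)|L|` fixed statistics applies,
-- each with deviation `ρ/8`, and `1024 = 8² · 16`.
open Classical in
theorem wsum_not_accurate_le [NeZero k] {P : Problem X k nH nL} (hB : P.Bounded) (hl : 0 < P.lmax)
    (he : 0 < P.eps) (q : Predictor X k) (n : ℕ) :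
    wsum (iid P.rct n) (fun S => if P.Accurate q S then 0 else 1) ≤
      ENNReal.ofReal ((nH + 1) * nL * (2 * Real.exp (-(n * P.rho ^ 2 / 1024)))) := by
  have hr := rho_pos hl he
  have hr1 : P.rho ≤ 1 := min_le_right _ _
  calc wsum (iid P.rct n) (fun S => if P.Accurate q S then 0 else 1)
      ≤ wsum (iid P.rct n) (fun S => ∑ r : Option (Fin nH), ∑ l : Fin nL,
          if |(S.map (P.stat q (P.ruleOf q r l) l)).sum -
            n * expect P.rct (P.stat q (P.ruleOf q r l) l)| > n * (P.rho / 8) then 1 else 0) := by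
        refine wsum_mono_support fun S hS => ?_
        split_ifs with h
        · exact bot_le
        · simp only [Problem.Accurate, not_forall, not_le, length_of_mem_support_iid hS] at h
          obtain ⟨r, l, h⟩ := h
          refine le_trans ?_ (Finset.single_le_sum (fun _ _ => bot_le) (Finset.mem_univ r))
          refine le_trans ?_ (Finset.single_le_sum (fun _ _ => bot_le) (Finset.mem_univ l))
          rw [expect_rct_stat hB hl, if_pos (by exact h)]
    _ ≤ ∑ r : Option (Fin nH), ∑ l : Fin nL,
          2 * ENNReal.ofReal (Real.exp (-(n * (P.rho / 8) ^ 2 / 16))) := by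
        simp only [wsum_finset_sum]
        exact Finset.sum_le_sum fun r _ => Finset.sum_le_sum fun l _ =>
          chernoff_abs (abs_stat_le hB hl _ _ _) (by positivity) (by linarith) n
    _ = _ := by
        simp only [Finset.sum_const, Finset.card_univ, Fintype.card_option, Fintype.card_fin,
          nsmul_eq_mul]
        rw [ENNReal.ofReal_mul (by positivity), ENNReal.ofReal_mul (by positivity),
          ENNReal.ofReal_mul (by positivity), ENNReal.ofReal_natCast,
          ENNReal.ofReal_ofNat, mul_assoc]
        congr 2
        · rw [← Nat.cast_succ, ENNReal.ofReal_natCast]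
        · rw [show (n : ℝ) * (P.rho / 8) ^ 2 / 16 = n * P.rho ^ 2 / 1024 by ring]

/-- The learner misses a hypothesis of large error. -/
def Problem.missed [NeZero k] (P : Problem X k nH nL) (q : Predictor X k) (l : Fin nL) (b : Bool) :
    Set (Fin nH) :=
  {i | (∃ j, P.eps ≤ sgn b * P.err q (some j) l) ∧ ¬ P.eps / 2 ≤ sgn b * P.err q (some i) l}

/-- The weak learning guarantee with cost levels `-ρ` and `-ρ/2` translates into signed errors `ε`
and `ε/2`. When no hypothesis has signed error `ε` there is nothing to miss. -/
theorem wsum_missed_le [NeZero k] {P : Problem X k nH nL} (hB : P.Bounded) (hl : 0 < P.lmax)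
    (he : 0 < P.eps) {A : Learner X k nH} (hA : A.IsCostSensitiveWeakLearner P.H) {η : ℝ}
    (hη : 0 < η) (hη1 : η < 1) (q : Predictor X k) (l : Fin nL) (b : Bool) {m : ℕ}
    (hm : A.size P.rho η ≤ m) :
    wsum (iid P.rct m) (fun S => prob (A.hyp P.rho η
      ((S.take (A.size P.rho η)).map (P.costExample q l b))) (P.missed q l b)) ≤
      ENNReal.ofReal η := by
  have hk : (0 : ℝ) < k := Nat.cast_pos.2 (NeZero.pos k)
  have hr := rho_pos hl he
  obtain ⟨m', rfl⟩ := Nat.exists_eq_add_of_le hm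
  rw [wsum_iid_take P.rct (A.size P.rho η) m'
    (fun S => prob (A.hyp P.rho η (S.map (P.costExample q l b))) (P.missed q l b))]
  by_cases hex : ∃ j, P.eps ≤ sgn b * P.err q (some j) l
  · obtain ⟨j, hj⟩ := hex
    -- An error of size `ε` forces `ε ≤ ℓ_max`, so the cap at `1` in `ρ` is inactive in the only
    -- case that matters.
    have hle : P.eps ≤ P.lmax := by
      refine hj.trans ((le_abs_self _).trans ?_)
      rw [abs_mul, abs_sgn, one_mul]
      exact hB.abs_err_le _ _ _
    have hk1 : (1 : ℝ) ≤ k := by exact_mod_cast NeZero.one_le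
    have hrho : P.rho = P.eps / (k * P.lmax) := by
      refine min_eq_left ?_
      rw [div_le_one (by positivity)]
      nlinarith
    have h1 := hA P.rho η hr (min_le_right _ _) hη hη1 (P.rct.map (P.costExample q l b))
      (fun z hz a => by
        obtain ⟨w, -, rfl⟩ := (PMF.mem_support_map_iff _ _ _).1 hz
        exact costExample_mem hB hl q l b w a)
      ⟨j, by
        rw [expect_costExample hB hl, hrho]
        gcongr⟩
    have h2 := prob_compl_le hη.le hη1.le h1
    rw [iid_map, PMF.bind_map, prob_eq_wsum, wsum_bind] at h2
    refine le_trans (wsum_mono fun S => ?_) h2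
    rw [prob_eq_wsum]
    refine wsum_mono fun i => ?_
    by_cases hi : i ∈ P.missed q l b
    · rw [if_pos hi, if_pos]
      intro hc
      rw [Set.mem_ofPred_eq, expect_costExample hB hl, hrho, neg_div, neg_le_neg_iff] at hc
      refine hi.2 ?_
      rw [div_right_comm] at hc
      exact (div_le_div_iff_of_pos_right (by positivity)).1 hc
    · rw [if_neg hi]; exact bot_le
  · refine le_trans (wsum_le_of_support (c := 0) fun S _ => ?_) bot_le
    rw [prob_eq_wsum]
    refine wsum_le_of_support fun i _ => ?_
    rw [if_neg]
    exact fun h => hex h.1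

end boosting

/-! ## Reasoning about programs -/

section machine

universe u
variable {X : Type u} {k nH nL : ℕ}

theorem rounds_induction {α : Type u} {f : ℕ → α → PMF α} {s : α} {n : ℕ} (J : ℕ → α → Prop)
    (h0 : J 0 s) (hs : ∀ i < n, ∀ a, J i a → ∀ b ∈ (f i a).support, J (i + 1) b) :
    ∀ b ∈ (rounds f s n).support, J n b := by
  induction n with
  | zero => intro b hb; simp [rounds] at hb; rwa [hb]
  | succ n ih =>
    intro b hb
    simp only [rounds, PMF.mem_support_bind_iff] at hb
    obtain ⟨a, ha, hb⟩ := hb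
    exact hs n n.lt_succ_self a (ih (fun i hi => hs i (by omega)) a ha) b hb

section state

variable (s : State X)

@[simp] theorem State.tick_N (n : ℕ) : (s.tick n).N = s.N := rfl
@[simp] theorem State.tick_R (n : ℕ) : (s.tick n).R = s.R := rfl
@[simp] theorem State.tick_P (n : ℕ) : (s.tick n).P = s.P := rfl
@[simp] theorem State.setN_R (a i j v : ℕ) : (s.setN a i j v).R = s.R := rfl
@[simp] theorem State.setN_P (a i j v : ℕ) : (s.setN a i j v).P = s.P := rfl
@[simp] theorem State.setR_N (a i j : ℕ) (v : ℝ) : (s.setR a i j v).N = s.N := rfl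
@[simp] theorem State.setR_P (a i j : ℕ) (v : ℝ) : (s.setR a i j v).P = s.P := rfl
@[simp] theorem State.setP_N (a i : ℕ) (v : X) : (s.setP a i v).N = s.N := rfl
@[simp] theorem State.setP_R (a i : ℕ) (v : X) : (s.setP a i v).R = s.R := rfl

theorem State.tick_tick (m n : ℕ) : (s.tick m).tick n = s.tick (m + n) := by
  simp [State.tick, add_assoc]

theorem State.setN_N (a i j v a' i' j' : ℕ) : (s.setN a i j v).N a' i' j' =
    if a' = a ∧ i' = i ∧ j' = j then v else s.N a' i' j' := rfl

theorem State.setR_R (a i j : ℕ) (v : ℝ) (a' i' j' : ℕ) : (s.setR a i j v).R a' i' j' =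
    if a' = a ∧ i' = i ∧ j' = j then v else s.R a' i' j' := rfl

theorem State.setP_P (a i : ℕ) (v : X) (a' i' : ℕ) : (s.setP a i v).P a' i' =
    if a' = a ∧ i' = i then v else s.P a' i' := rfl

theorem State.setN_N_of_ne {a a' : ℕ} (h : a' ≠ a) (i j v : ℕ) : (s.setN a i j v).N a' = s.N a' := by
  funext i' j'; simp [State.setN_N, h]

theorem State.setR_R_of_ne {a a' : ℕ} (h : a' ≠ a) (i j : ℕ) (v : ℝ) :
    (s.setR a i j v).R a' = s.R a' := by
  funext i' j'; simp [State.setR_R, h]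

theorem State.setP_P_of_ne {a a' : ℕ} (h : a' ≠ a) (i : ℕ) (v : X) :
    (s.setP a i v).P a' = s.P a' := by
  funext i'; simp [State.setP_P, h]

end state

/-- `Q` holds in every possible final state. -/
def Post [NeZero k] (W : World X k nH nL) (c : Cmd) (s : State X) (Q : State X → Prop) : Prop :=
  ∀ s' ∈ (run W c s).support, Q s'

section post

variable {W : World X k nH nL} {s : State X} {Q Q' : State X → Prop} {c d : Cmd}

theorem Post.mono [NeZero k] (h : Post W c s Q) (hQ : ∀ s', Q s' → Q' s') : Post W c s Q' :=
  fun s' hs' => hQ s' (h s' hs')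

theorem Post.and [NeZero k] (h : Post W c s Q) (h' : Post W c s Q')
    : Post W c s fun s' => Q s' ∧ Q' s' :=
  fun s' hs' => ⟨h s' hs', h' s' hs'⟩

theorem post_skip [NeZero k] : Post W .skip s Q ↔ Q (s.tick 1) := by simp [Post, run]

theorem post_seq [NeZero k] : Post W (.seq c d) s Q ↔ Post W c s fun s' => Post W d s' Q := by
  simp only [Post, run, PMF.mem_support_bind_iff]
  exact ⟨fun h s' hs' t ht => h t ⟨s', hs', ht⟩, fun h t ⟨s', hs', ht⟩ => h s' hs' t ht⟩

theorem post_ite [NeZero k] {b : BExp} : Post W (.ite b c d) s Q ↔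
    (b.holds s → Post W c (s.tick (1 + b.cost)) Q) ∧
    (¬ b.holds s → Post W d (s.tick (1 + b.cost)) Q) := by
  simp only [Post, run]
  by_cases h : b.holds s <;> simp [h]

theorem post_setN [NeZero k] {a : ℕ} {i j e : NExp} : Post W (.setN a i j e) s Q ↔
    Q ((s.setN a (i.eval s) (j.eval s) (e.eval s)).tick
      (1 + i.cost + j.cost + e.cost)) := by simp [Post, run]

theorem post_setR [NeZero k] {a : ℕ} {i j : NExp} {e : RExp} : Post W (.setR a i j e) s Q ↔
    Q ((s.setR a (i.eval s) (j.eval s) (e.eval s)).tick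
      (1 + i.cost + j.cost + e.cost)) := by simp [Post, run]

theorem post_ceil [NeZero k] {a : ℕ} {i j : NExp} {e : RExp} : Post W (.ceil a i j e) s Q ↔
    Q ((s.setN a (i.eval s) (j.eval s) ⌈e.eval s⌉₊).tick
      (1 + i.cost + j.cost + e.cost + ⌈e.eval s⌉₊)) := by simp [Post, run]

theorem post_evalH [NeZero k] {a p : ℕ} {i j h r : NExp} : Post W (.evalH a i j h p r) s Q ↔
    Q ((s.setN a (i.eval s) (j.eval s) (W.problem.evalH (h.eval s) (s.P p (r.eval s)))).tick
      (1 + i.cost + j.cost + h.cost + r.cost + W.tauH)) := by simp [Post, run]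

theorem post_evalL [NeZero k] {a p : ℕ} {i j l r x y : NExp} : Post W (.evalL a i j l p r x y) s Q ↔
    Q ((s.setR a (i.eval s) (j.eval s)
      (W.problem.evalL (l.eval s) (s.P p (r.eval s)) (x.eval s) (y.eval s))).tick
      (1 + i.cost + j.cost + l.cost + r.cost + x.cost + y.cost + W.tauL)) := by
  simp [Post, run]

theorem post_learnerSize [NeZero k] {a : ℕ} {i j : NExp} {ρ δ : RExp} : Post W
    (.learnerSize a i j ρ δ) s Q ↔
    Q ((s.setN a (i.eval s) (j.eval s) (W.learner.size (ρ.eval s) (δ.eval s))).tick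
      (1 + i.cost + j.cost + ρ.cost + δ.cost)) := by simp [Post, run]

theorem post_loop [NeZero k] {v : ℕ} {n : NExp} (J : ℕ → State X → Prop) (h0 : J 0 (s.tick
    (1 + n.cost)))
    (hs : ∀ i < n.eval s, ∀ s', J i s' → Post W c ((s'.setN v 0 0 i).tick 1) (J (i + 1)))
    (hQ : ∀ s', J (n.eval s) s' → Q s') : Post W (.loop v n c) s Q :=
  fun s' hs' => hQ s' (rounds_induction J h0 hs s' hs')

end post

/-! ### Frames -/

/-- The arrays of naturals written by a program. -/
def Cmd.wN : Cmd → List ℕ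
  | .skip => []
  | .seq c d => c.wN ++ d.wN
  | .ite _ c d => c.wN ++ d.wN
  | .loop v _ c => v :: c.wN
  | .setN a _ _ _ => [a]
  | .setR _ _ _ _ => []
  | .copyX _ _ _ _ => []
  | .ceil a _ _ _ => [a]
  | .draw _ d o _ => [d, o]
  | .evalH a _ _ _ _ _ => [a]
  | .evalL _ _ _ _ _ _ _ _ => []
  | .learnerSize a _ _ _ _ => [a]
  | .learnerCall a _ _ _ _ _ _ => [a]

/-- The arrays of reals written by a program. -/
def Cmd.wR : Cmd → List ℕ
  | .seq c d => c.wR ++ d.wR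
  | .ite _ c d => c.wR ++ d.wR
  | .loop _ _ c => c.wR
  | .setR a _ _ _ => [a]
  | .evalL a _ _ _ _ _ _ _ => [a]
  | _ => []

/-- The arrays of individuals written by a program. -/
def Cmd.wP : Cmd → List ℕ
  | .seq c d => c.wP ++ d.wP
  | .ite _ c d => c.wP ++ d.wP
  | .loop _ _ c => c.wP
  | .copyX a _ _ _ => [a]
  | .draw p _ _ _ => [p]
  | _ => []

/-- `s'` agrees with `s` outside the given arrays. -/
structure Agree (wN wR wP : List ℕ) (s s' : State X) : Prop where
  N : ∀ a ∉ wN, s'.N a = s.N a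
  R : ∀ a ∉ wR, s'.R a = s.R a
  P : ∀ a ∉ wP, s'.P a = s.P a

theorem Agree.trans {w₁ w₂ w₃ w₁' w₂' w₃' : List ℕ} {s s' s'' : State X}
    (h : Agree w₁ w₂ w₃ s s') (h' : Agree w₁' w₂' w₃' s' s'') :
    Agree (w₁ ++ w₁') (w₂ ++ w₂') (w₃ ++ w₃') s s'' where
  N a ha := by
    rw [List.mem_append, not_or] at ha
    rw [h'.N a ha.2, h.N a ha.1]
  R a ha := by
    rw [List.mem_append, not_or] at ha
    rw [h'.R a ha.2, h.R a ha.1]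
  P a ha := by
    rw [List.mem_append, not_or] at ha
    rw [h'.P a ha.2, h.P a ha.1]

theorem Agree.mono {w₁ w₂ w₃ w₁' w₂' w₃' : List ℕ} {s s' : State X}
    (h : Agree w₁ w₂ w₃ s s') (h1 : w₁ ⊆ w₁') (h2 : w₂ ⊆ w₂') (h3 : w₃ ⊆ w₃') :
    Agree w₁' w₂' w₃' s s' :=
  ⟨fun a ha => h.N a fun h' => ha (h1 h'), fun a ha => h.R a fun h' => ha (h2 h'),
    fun a ha => h.P a fun h' => ha (h3 h')⟩

/-- A program changes only the arrays that it writes. -/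
theorem post_agree [NeZero k] (W : World X k nH nL) (c : Cmd) (s : State X) :
    Post W c s (Agree c.wN c.wR c.wP s) := by
  induction c generalizing s with
  | skip => exact post_skip.2 ⟨fun _ _ => rfl, fun _ _ => rfl, fun _ _ => rfl⟩
  | seq c d hc hd => exact post_seq.2 fun s' hs' s'' hs'' => (hc s s' hs').trans (hd s' s'' hs'')
  | ite b c d hc hd =>
    refine post_ite.2 ⟨fun _ => (hc _).mono fun s' h => ?_, fun _ => (hd _).mono fun s' h => ?_⟩
    · have h' : Agree c.wN c.wR c.wP s s' := ⟨h.N, h.R, h.P⟩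
      exact h'.mono (List.subset_append_left _ _) (List.subset_append_left _ _)
        (List.subset_append_left _ _)
    · have h' : Agree d.wN d.wR d.wP s s' := ⟨h.N, h.R, h.P⟩
      exact h'.mono (List.subset_append_right _ _) (List.subset_append_right _ _)
        (List.subset_append_right _ _)
  | loop v n c hc =>
    refine post_loop (fun _ => Agree (v :: c.wN) c.wR c.wP s)
      ⟨fun _ _ => rfl, fun _ _ => rfl, fun _ _ => rfl⟩ (fun i _ s' hs' => ?_) fun _ h => h
    refine (hc _).mono fun s'' h => ⟨fun a ha => ?_, fun a ha => ?_, fun a ha => ?_⟩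
    · rw [← hs'.N a ha]
      rw [List.mem_cons, not_or] at ha
      rw [h.N a ha.2, State.tick_N, State.setN_N_of_ne _ ha.1]
    · rw [h.R a ha, ← hs'.R a ha]; rfl
    · rw [h.P a ha, ← hs'.P a ha]; rfl
  | setN a i j e =>
    refine post_setN.2 ⟨fun b hb => ?_, fun _ _ => rfl, fun _ _ => rfl⟩
    exact State.setN_N_of_ne _ (by simpa [Cmd.wN] using hb) _ _ _
  | setR a i j e =>
    refine post_setR.2 ⟨fun _ _ => rfl, fun b hb => ?_, fun _ _ => rfl⟩
    exact State.setR_R_of_ne _ (by simpa [Cmd.wR] using hb) _ _ _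
  | copyX a i b j =>
    intro s' hs'
    simp only [run, PMF.support_pure, Set.mem_singleton_iff] at hs'
    subst hs'
    refine ⟨fun _ _ => rfl, fun _ _ => rfl, fun b hb => ?_⟩
    exact State.setP_P_of_ne _ (by simpa [Cmd.wP] using hb) _ _
  | ceil a i j e =>
    refine post_ceil.2 ⟨fun b hb => ?_, fun _ _ => rfl, fun _ _ => rfl⟩
    exact State.setN_N_of_ne _ (by simpa [Cmd.wN] using hb) _ _ _
  | draw p d o i =>
    intro s' hs'
    simp only [run, PMF.mem_support_map_iff] at hs'
    obtain ⟨z, -, rfl⟩ := hs'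
    refine ⟨fun b hb => ?_, fun _ _ => rfl, fun b hb => ?_⟩
    · simp only [Cmd.wN, List.mem_cons, List.not_mem_nil, or_false, not_or] at hb
      exact (State.setN_N_of_ne _ hb.2 _ _ _).trans (State.setN_N_of_ne _ hb.1 _ _ _)
    · exact State.setP_P_of_ne _ (by simpa [Cmd.wP] using hb) _ _
  | evalH a i j h p r =>
    refine post_evalH.2 ⟨fun b hb => ?_, fun _ _ => rfl, fun _ _ => rfl⟩
    exact State.setN_N_of_ne _ (by simpa [Cmd.wN] using hb) _ _ _
  | evalL a i j l p r x y =>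
    refine post_evalL.2 ⟨fun _ _ => rfl, fun b hb => ?_, fun _ _ => rfl⟩
    exact State.setR_R_of_ne _ (by simpa [Cmd.wR] using hb) _ _ _
  | learnerSize a i j ρ δ =>
    refine post_learnerSize.2 ⟨fun b hb => ?_, fun _ _ => rfl, fun _ _ => rfl⟩
    exact State.setN_N_of_ne _ (by simpa [Cmd.wN] using hb) _ _ _
  | learnerCall a i j p c ρ δ =>
    intro s' hs'
    simp only [run, PMF.mem_support_map_iff] at hs'
    obtain ⟨z, -, rfl⟩ := hs'
    refine ⟨fun b hb => ?_, fun _ _ => rfl, fun _ _ => rfl⟩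
    exact State.setN_N_of_ne _ (by simpa [Cmd.wN] using hb) _ _ _

theorem Post.with_agree [NeZero k] {W : World X k nH nL} {c : Cmd} {s : State X} {Q
    : State X → Prop}
    (h : Post W c s Q) : Post W c s fun s' => Q s' ∧ Agree c.wN c.wR c.wP s s' :=
  h.and (post_agree W c s)

/-! ### Resources -/

/-- Steps, samples and calls of the learner used so far. -/
def State.used (s : State X) : Fin 3 → ℕ := ![s.time, s.samples, s.calls]

/-- The bound on the number of rounds of a loop. -/
noncomputable def NExp.bound : NExp → MvPolynomial ℕ ℕ
  | .get a _ _ => .X (a + 3)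
  | _ => 0

/-- A bound for the resources used by a program without `ceil`, as a polynomial in the evaluation
times (variables `0`, `1`), the running time of the learner (variable `2`) and the values stored in
the arrays `a` that control the loops (variables `a + 3`). -/
noncomputable def Cmd.cost : Cmd → Fin 3 → MvPolynomial ℕ ℕ
  | .skip => ![1, 0, 0]
  | .seq c d => c.cost + d.cost
  | .ite b c d => ![1 + (b.cost : MvPolynomial ℕ ℕ), 0, 0] + (c.cost + d.cost)
  | .loop _ n c => ![1 + (n.cost : MvPolynomial ℕ ℕ), 0, 0] + n.bound • (![1, 0, 0] + c.cost)
  | .setN _ i j e => ![((1 + i.cost + j.cost + e.cost : ℕ) : MvPolynomial ℕ ℕ), 0, 0]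
  | .setR _ i j e => ![((1 + i.cost + j.cost + e.cost : ℕ) : MvPolynomial ℕ ℕ), 0, 0]
  | .copyX _ i _ j => ![((1 + i.cost + j.cost : ℕ) : MvPolynomial ℕ ℕ), 0, 0]
  | .ceil _ _ _ _ => 0
  | .draw _ _ _ i => ![((1 + i.cost : ℕ) : MvPolynomial ℕ ℕ), 1, 0]
  | .evalH _ i j h _ r =>
      ![((1 + i.cost + j.cost + h.cost + r.cost : ℕ) : MvPolynomial ℕ ℕ) + .X 0, 0, 0]
  | .evalL _ i j l _ r x y =>
      ![((1 + i.cost + j.cost + l.cost + r.cost + x.cost + y.cost : ℕ) :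
        MvPolynomial ℕ ℕ) + .X 1, 0, 0]
  | .learnerSize _ i j ρ δ =>
      ![((1 + i.cost + j.cost + ρ.cost + δ.cost : ℕ) : MvPolynomial ℕ ℕ), 0, 0]
  | .learnerCall _ i j _ _ ρ δ =>
      ![((1 + i.cost + j.cost + ρ.cost + δ.cost : ℕ) : MvPolynomial ℕ ℕ) + .X 2, 0, 1]

/-- The entry `(0, 0)` of an array of naturals. -/
abbrev nv (a : ℕ) : NExp := .get a (.lit 0) (.lit 0)

/-- The entry `(0, 0)` of an array of reals. -/
abbrev rv (a : ℕ) : RExp := .get a (.lit 0) (.lit 0)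

/-- All loops are controlled by entries `(0, 0)` of arrays in `A`, and the learner is called with
the parameters in the real arrays `4`, `5`. -/
def Cmd.Simple (A : List ℕ) : Cmd → Prop
  | .seq c d => c.Simple A ∧ d.Simple A
  | .ite _ c d => c.Simple A ∧ d.Simple A
  | .loop _ n c => (∃ a ∈ A, n = nv a) ∧ c.Simple A
  | .ceil _ _ _ _ => False
  | .learnerCall _ _ _ _ _ ρ δ => ρ = rv 4 ∧ δ = rv 5
  | _ => True

/-- The bound for one round is only asked at states agreeing with `s` outside the arrays written by
the loop; this keeps the values that control inner loops. Applied separately to the loop over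
losses, it leaves the number of losses as an explicit factor. -/
theorem used_loop [NeZero k] {W : World X k nH nL} {s : State X} {v : ℕ} {n : NExp} {c : Cmd}
    {B : Fin 3 → ℕ}
    (h : ∀ t, Agree (v :: c.wN) c.wR c.wP s t → Post W c t fun s' => ∀ i, s'.used i ≤ t.used i + B i) :
    Post W (.loop v n c) s fun s' => ∀ i, s'.used i ≤ s.used i + (![1 + n.cost, 0, 0] : Fin 3 → ℕ) i +
      n.eval s * ((![1, 0, 0] : Fin 3 → ℕ) i + B i) := by
  refine post_loop (fun m s' => Agree (v :: c.wN) c.wR c.wP s s' ∧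
    ∀ i, s'.used i ≤ s.used i + (![1 + n.cost, 0, 0] : Fin 3 → ℕ) i +
      m * ((![1, 0, 0] : Fin 3 → ℕ) i + B i))
    ⟨⟨fun _ _ => rfl, fun _ _ => rfl, fun _ _ => rfl⟩, fun i => ?_⟩
    (fun m _ s' ⟨h1, h2⟩ => ?_) (fun s' h => h.2)
  · fin_cases i <;> simp [State.used, State.tick]
  have h3 : Agree (v :: c.wN) c.wR c.wP s ((s'.setN v 0 0 m).tick 1) := by
    refine ⟨fun a ha => ?_, h1.R, h1.P⟩
    rw [← h1.N a ha]
    rw [List.mem_cons, not_or] at ha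
    exact State.setN_N_of_ne _ ha.1 _ _ _
  refine (h _ h3).with_agree.mono fun s'' ⟨h4, h5⟩ => ⟨⟨fun a ha => ?_, fun a ha => ?_,
    fun a ha => ?_⟩, fun i => (h4 i).trans ?_⟩
  · rw [← h3.N a ha]
    rw [List.mem_cons, not_or] at ha
    rw [h5.N a ha.2]
  · rw [h5.R a ha, h3.R a ha]
  · rw [h5.P a ha, h3.P a ha]
  · have h2i := h2 i
    have : ((s'.setN v 0 0 m).tick 1).used i = s'.used i + (![1, 0, 0] : Fin 3 → ℕ) i := by
      fin_cases i <;> simp [State.used, State.tick, State.setN]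
    rw [this, add_mul, one_mul]
    omega

/-- The arrays controlling loops and the real arrays holding the learner's parameters are never
written by `c`. Hence one valuation `β` remains valid at every intermediate state, and the syntactic
polynomial can be evaluated there. `ceil` is excluded because its cost depends on the rounded value.
-/
theorem used_le [NeZero k] (W : World X k nH nL) (β : ℕ → ℕ) (hH : W.tauH ≤ β 0) (hL : W.tauL ≤ β 1)
    (A : List ℕ) (c : Cmd) (hc : c.Simple A) (hA : ∀ a ∈ A, a ∉ c.wN) (h4 : 4 ∉ c.wR)
    (h5 : 5 ∉ c.wR) (s : State X) (hs : ∀ a ∈ A, s.N a 0 0 ≤ β (a + 3))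
    (ht : W.learner.time (s.R 4 0 0) (s.R 5 0 0) ≤ β 2) :
    Post W c s fun s' => ∀ i, s'.used i ≤ s.used i + MvPolynomial.eval β (c.cost i) := by
  induction c generalizing s with
  | skip =>
    refine post_skip.2 fun i => ?_
    fin_cases i <;> simp [Cmd.cost, State.used, State.tick]
  | seq c d ihc ihd =>
    simp only [Cmd.wN, Cmd.wR, List.mem_append, not_or] at hA h4 h5
    refine post_seq.2 ((ihc hc.1 (fun a ha => (hA a ha).1) h4.1 h5.1 s hs ht).with_agree.mono
      fun s' ⟨h1, h2⟩ => ?_)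
    refine (ihd hc.2 (fun a ha => (hA a ha).2) h4.2 h5.2 s' (fun a ha => ?_) ?_).mono
      fun s'' h3 i => ?_
    · rw [h2.N a (hA a ha).1]; exact hs a ha
    · rw [h2.R 4 h4.1, h2.R 5 h5.1]; exact ht
    · simp only [Cmd.cost, Pi.add_apply, map_add]
      have := h1 i
      have := h3 i
      omega
  | ite b c d ihc ihd =>
    simp only [Cmd.wN, Cmd.wR, List.mem_append, not_or] at hA h4 h5
    refine post_ite.2 ⟨fun _ => ?_, fun _ => ?_⟩
    · refine (ihc hc.1 (fun a ha => (hA a ha).1) h4.1 h5.1 (s.tick (1 + b.cost)) hs ht).mono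
        fun s' h i => (h i).trans ?_
      fin_cases i <;> simp [Cmd.cost, State.used, State.tick] <;> omega
    · refine (ihd hc.2 (fun a ha => (hA a ha).2) h4.2 h5.2 (s.tick (1 + b.cost)) hs ht).mono
        fun s' h i => (h i).trans ?_
      fin_cases i <;> simp [Cmd.cost, State.used, State.tick] <;> omega
  | loop v n c ih =>
    obtain ⟨⟨a, haA, rfl⟩, hc⟩ := hc
    simp only [Cmd.wN, Cmd.wR, List.mem_cons, not_or] at hA h4 h5
    refine (used_loop (B := fun i => MvPolynomial.eval β (c.cost i)) fun t h1 =>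
      ih hc (fun a ha => (hA a ha).2) h4 h5 t (fun a ha => ?_) ?_).mono fun s' h i => ?_
    · rw [h1.N a (by simpa using hA a ha)]; exact hs a ha
    · rw [h1.R 4 h4, h1.R 5 h5]; exact ht
    · refine (h i).trans ?_
      have h6 := Nat.mul_le_mul_right ((![1, 0, 0] : Fin 3 → ℕ) i + MvPolynomial.eval β (c.cost i))
        (hs a haA)
      refine (Nat.add_le_add_left h6 _).trans (le_of_eq ?_)
      fin_cases i <;>
        simp [Cmd.cost, NExp.bound, add_assoc] <;> exact Or.inl rfl
  | setN a i j e =>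
    refine post_setN.2 fun i => ?_
    fin_cases i <;> simp [Cmd.cost, State.used, State.tick, State.setN]
  | setR a i j e =>
    refine post_setR.2 fun i => ?_
    fin_cases i <;> simp [Cmd.cost, State.used, State.tick, State.setR]
  | copyX a i b j =>
    intro s' hs' i
    simp only [run, PMF.support_pure, Set.mem_singleton_iff] at hs'
    subst hs'
    fin_cases i <;> simp [Cmd.cost, State.used, State.tick, State.setP]
  | ceil a i j e => exact hc.elim
  | draw p d o i =>
    intro s' hs' i
    simp only [run, PMF.mem_support_map_iff] at hs'
    obtain ⟨z, -, rfl⟩ := hs'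
    fin_cases i <;> simp [Cmd.cost, State.used, State.tick, State.setP, State.setN]
  | evalH a i j h p r =>
    refine post_evalH.2 fun i => ?_
    fin_cases i <;> simp [Cmd.cost, State.used, State.tick, State.setN] <;> omega
  | evalL a i j l p r x y =>
    refine post_evalL.2 fun i => ?_
    fin_cases i <;> simp [Cmd.cost, State.used, State.tick, State.setR] <;> omega
  | learnerSize a i j ρ δ =>
    refine post_learnerSize.2 fun i => ?_
    fin_cases i <;> simp [Cmd.cost, State.used, State.tick, State.setN]
  | learnerCall a i j p c ρ δ =>
    obtain ⟨rfl, rfl⟩ := hc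
    intro s' hs' i
    simp only [run, PMF.mem_support_map_iff] at hs'
    obtain ⟨z, -, rfl⟩ := hs'
    have ht' : W.learner.time (RExp.eval s (rv 4)) (RExp.eval s (rv 5)) ≤ β 2 := ht
    fin_cases i <;> simp [Cmd.cost, State.used, State.tick, State.setN] <;> omega

end machine

/-! ## The program -/

section program

/-- Load `ℓ(x, dec, 1)` and `ℓ(x, dec, 0)` for the current loss and individual. -/
def loadLoss (dec : NExp) : Cmd :=
  -- Memory layout. Naturals: 0 number of updates, 1 updates, 5 number of rounds, 6 size of the
  -- learner's sample, 7 samples per round, 8 stop flag, 10 and 11 sampled decisions and outcomes,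
  -- 12 current sample, 16 flag for a found update, 17 decision of the rule, 20 coded rule, 21
  -- current loss. Reals: 3 is `ε/(k ℓ_max)`, 4 is `ρ`, 5 the failure probability of a call, 6
  -- predictions, 7 cost vectors, 9 and 10 losses for the outcomes 1 and 0, 11 scratch, 12 the audit
  -- sum. Individuals are in array 0.
  .seq (.evalL 9 (.lit 0) (.lit 0) (nv 21) 0 (nv 12) dec (.lit 1))
    (.evalL 10 (.lit 0) (.lit 0) (nv 21) 0 (nv 12) dec (.lit 0))

/-- Store the modelled expected loss of a decision in the real array `v`. -/
def loadVal (v : ℕ) (dec : NExp) : Cmd :=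
  .seq (loadLoss dec) (.setR v (.lit 0) (.lit 0)
    (.add (.mul (.get 6 (nv 12) dec) (rv 9))
      (.mul (.sub (.ofNat (.lit 1)) (.get 6 (nv 12) dec)) (rv 10))))

/-- Evaluate the current decision rule at the current individual. -/
def ruleDec : Cmd :=
  .ite (.natLE (.lit 1) (nv 20))
    (.evalH 17 (.lit 0) (.lit 0) (.sub (nv 20) (.lit 1)) 0 (nv 12))
    (.seq (.setN 17 (.lit 0) (.lit 0) (.lit 0))
      (.seq (loadVal 11 (.lit 0))
        (.loop 13 (nv 2)
          (.seq (loadVal 8 (nv 13))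
            -- Replacement only on strict improvement: ties stay with the smaller index, as in
            -- `firstMin`.
            (.ite (.realLE (rv 11) (rv 8)) .skip
              (.seq (.setR 11 (.lit 0) (.lit 0) (rv 8))
                (.setN 17 (.lit 0) (.lit 0) (nv 13))))))))

/-- Perform one recorded update on the predictions for the current individual. -/
def applyUpdate : Cmd :=
  .seq (.setN 20 (.lit 0) (.lit 0) (.get 1 (nv 14) (.lit 1)))
    (.seq (.setN 21 (.lit 0) (.lit 0) (.get 1 (nv 14) (.lit 0)))
      (.seq ruleDec
        (.seq (loadLoss (nv 17))
          (.seq (.setR 11 (.lit 0) (.lit 0) (.sub (.get 6 (nv 12) (nv 17))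
              (.mul (.mul (.sub (.mul (.ofNat (.lit 2)) (.ofNat (.get 1 (nv 14) (.lit 2))))
                (.ofNat (.lit 1)))
                (.div (.mul (.div (.ofNat (.lit 1)) (.ofNat (.lit 8))) (rv 0))
                  (.mul (rv 1) (rv 1))))
                (.sub (rv 9) (rv 10)))))
            (.seq (.ite (.realLE (rv 11) (.ofNat (.lit 0)))
                (.setR 11 (.lit 0) (.lit 0) (.ofNat (.lit 0)))
                (.ite (.realLE (.ofNat (.lit 1)) (rv 11))
                  (.setR 11 (.lit 0) (.lit 0) (.ofNat (.lit 1))) .skip))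
              (.setR 6 (nv 12) (nv 17) (rv 11)))))))

/-- Compute the predictions for the current individual. -/
def predict : Cmd :=
  .seq (.loop 13 (nv 2)
      (.setR 6 (nv 12) (nv 13) (.div (.ofNat (.lit 1)) (.ofNat (.lit 2)))))
    (.loop 14 (nv 0) applyUpdate)

/-- The normalised residual of the current sample at decision `dec`. -/
def residual (dec : NExp) : RExp :=
  .div (.mul (.sub (.get 6 (nv 12) dec) (.ofNat (.get 11 (nv 12) (.lit 0))))
    (.sub (rv 9) (rv 10))) (rv 1)

/-- Sum the normalised residuals of the current decision rule over all samples. -/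
def sumRule : Cmd :=
  .seq (.setR 12 (.lit 0) (.lit 0) (.ofNat (.lit 0)))
    (.loop 12 (nv 7)
      (.seq ruleDec
        (.ite (.and (.natLE (nv 17) (.get 10 (nv 12) (.lit 0)))
            (.natLE (.get 10 (nv 12) (.lit 0)) (nv 17)))
          (.seq (loadLoss (nv 17))
            (.setR 12 (.lit 0) (.lit 0) (.add (rv 12) (residual (nv 17)))))
          .skip)))

/-- Record an update with the given sign. -/
def record (b : Bool) : Cmd :=
  -- The row just past the end of the list. The count is raised only in `roundEnd`, so later audits
  -- of the same round may overwrite the pending update; all of them concern the same predictor.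
  .seq (.setN 1 (nv 0) (.lit 0) (nv 21))
    (.seq (.setN 1 (nv 0) (.lit 1) (nv 20))
      (.seq (.setN 1 (nv 0) (.lit 2) (.lit (if b then 1 else 0)))
        (.setN 16 (.lit 0) (.lit 0) (.lit 1))))

/-- The threshold of the audit. -/
def threshold : RExp :=
  -- In units of `ε` the estimates are accurate to `1/8`, so `3/8` accepts every error from `1/2` on
  -- and nothing below `1/4`.
  .mul (.mul (.div (.ofNat (.lit 3)) (.ofNat (.lit 8))) (rv 3)) (.ofNat (nv 7))

/-- Audit the current pair. -/
def audit : Cmd :=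
  .seq sumRule
    (.ite (.realLE threshold (rv 12)) (record true)
      (.ite (.realLE threshold (.sub (.ofNat (.lit 0)) (rv 12))) (record false) .skip))

/-- `-1` for `true`, `1` for `false`. -/
def negSign (b : Bool) : RExp :=
  if b then .sub (.ofNat (.lit 0)) (.ofNat (.lit 1)) else .ofNat (.lit 1)

/-- Prepare the cost-sensitive examples. -/
def prepare (b : Bool) : Cmd :=
  .loop 12 (nv 6)
    (.seq (.loop 13 (nv 2) (.setR 7 (nv 12) (nv 13) (.ofNat (.lit 0))))
      (.seq (loadLoss (.get 10 (nv 12) (.lit 0)))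
        (.setR 7 (nv 12) (.get 10 (nv 12) (.lit 0))
          (.mul (negSign b) (residual (.get 10 (nv 12) (.lit 0)))))))

/-- Audit the hypothesis proposed by the learner. -/
def tryLearner (b : Bool) : Cmd :=
  .seq (prepare b)
    (.seq (.learnerCall 18 (.lit 0) (.lit 0) 0 7 (rv 4) (rv 5))
      (.seq (.setN 20 (.lit 0) (.lit 0) (.add (nv 18) (.lit 1))) audit))

/-- All audits for the current loss. -/
def auditLoss : Cmd :=
  .seq (.setN 21 (.lit 0) (.lit 0) (nv 15))
    (.seq (.setN 20 (.lit 0) (.lit 0) (.lit 0))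
      (.seq audit (.seq (tryLearner true) (tryLearner false))))

/-- Draw the samples of one round. -/
def drawAll : Cmd := .loop 12 (nv 7) (.draw 0 10 11 (nv 12))

/-- Compute the predictions for all samples. -/
def predictAll : Cmd := .loop 12 (nv 7) predict

/-- All audits of a round. -/
def auditAll : Cmd := .loop 15 (nv 4) auditLoss

/-- The end of a round. -/
def roundEnd : Cmd :=
  .ite (.natLE (.lit 1) (nv 16))
    (.setN 0 (.lit 0) (.lit 0) (.add (nv 0) (.lit 1)))
    (.setN 8 (.lit 0) (.lit 0) (.lit 1))

/-- One round of POI-Boost. -/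
def boostRound : Cmd :=
  -- The number of rounds is fixed in advance; once the stop flag is set, the remaining rounds idle.
  .ite (.natLE (.lit 1) (nv 8)) .skip
    (.seq (.setN 16 (.lit 0) (.lit 0) (.lit 0))
      (.seq drawAll (.seq predictAll (.seq auditAll roundEnd))))

/-- Compute the parameters. -/
def setup : Cmd :=
  .seq (.setR 3 (.lit 0) (.lit 0) (.div (rv 0) (.mul (.ofNat (nv 2)) (rv 1))))
    (.seq (.ite (.realLE (rv 3) (.ofNat (.lit 1)))
        (.setR 4 (.lit 0) (.lit 0) (rv 3))
        (.setR 4 (.lit 0) (.lit 0) (.ofNat (.lit 1))))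
      (.seq (.ceil 5 (.lit 0) (.lit 0)
          (.div (.mul (.mul (.ofNat (.lit 64)) (.ofNat (nv 2))) (.mul (rv 1) (rv 1)))
            (.mul (rv 0) (rv 0))))
        (.seq (.setN 5 (.lit 0) (.lit 0) (.add (nv 5) (.lit 1)))
          (.seq (.setR 5 (.lit 0) (.lit 0) (.div (rv 2)
              (.mul (.mul (.ofNat (.lit 4)) (.ofNat (nv 4))) (.ofNat (nv 5)))))
            (.seq (.learnerSize 6 (.lit 0) (.lit 0) (rv 4) (rv 5))
              (.seq (.ceil 7 (.lit 0) (.lit 0)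
                  (.mul (.div (.ofNat (.lit 1024)) (.mul (rv 4) (rv 4)))
                    (.log (.div (.mul (.mul (.mul (.ofNat (.lit 8)) (.ofNat (nv 3)))
                      (.ofNat (nv 4))) (.ofNat (nv 5))) (rv 2)))))
                -- Enough samples for the learner and for the estimates; the extra one makes the
                -- sample nonempty.
                (.setN 7 (.lit 0) (.lit 0) (.add (nv 6) (.add (nv 7) (.lit 1))))))))))

/-- The whole program. -/
def poiBoost : Cmd := .seq setup (.loop 9 (nv 5) boostRound)

end program

/-! ## Specifications of the deterministic parts -/

section specs

universe u
variable {X : Type u} {k nH nL : ℕ}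

/-- The number representing a decision rule. -/
def ruleCode : Option (Fin nH) → ℕ
  | none => 0
  | some i => i + 1

theorem agree_of_eq {w₁ w₂ w₃ : List ℕ} {s s' : State X} (hN : s'.N = s.N) (hR : s'.R = s.R)
    (hP : s'.P = s.P) : Agree w₁ w₂ w₃ s s' :=
  ⟨fun _ _ => by rw [hN], fun _ _ => by rw [hR], fun _ _ => by rw [hP]⟩

variable {W : World X k nH nL} {s : State X}

/-- The invariant `J` need not mention unchanged arrays: the frame of the whole loop is carried
along and is available in each round. -/
theorem post_loop_agree [NeZero k] {v : ℕ} {n : NExp} {c : Cmd} {Q : State X → Prop}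
    (J : ℕ → State X → Prop) (h0 : J 0 (s.tick (1 + n.cost)))
    (hs : ∀ i < n.eval s, ∀ s', J i s' → ∀ t, t = (s'.setN v 0 0 i).tick 1 →
      Agree (v :: c.wN) c.wR c.wP s t → t.N v 0 0 = i → Post W c t (J (i + 1)))
    (hQ : ∀ s', J (n.eval s) s' → Q s') : Post W (.loop v n c) s Q := by
  refine post_loop (fun i s' => J i s' ∧ Agree (v :: c.wN) c.wR c.wP s s')
    ⟨h0, agree_of_eq rfl rfl rfl⟩ (fun i hi s' ⟨h1, h2⟩ => ?_) fun s' h => hQ s' h.1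
  have h3 : Agree (v :: c.wN) c.wR c.wP s ((s'.setN v 0 0 i).tick 1) := by
    refine ⟨fun a ha => ?_, h2.R, h2.P⟩
    rw [← h2.N a ha]
    rw [List.mem_cons, not_or] at ha
    exact State.setN_N_of_ne _ ha.1 _ _ _
  refine (hs i hi s' h1 _ rfl h3 (by simp [State.setN_N])).with_agree.mono
    fun s'' ⟨h4, h5⟩ => ⟨h4, ?_⟩
  refine ⟨fun a ha => ?_, fun a ha => ?_, fun a ha => ?_⟩
  · rw [← h3.N a ha]
    rw [List.mem_cons, not_or] at ha
    rw [h5.N a ha.2]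
  · rw [h5.R a ha, h3.R a ha]
  · rw [h5.P a ha, h3.P a ha]

theorem evalL_fin (P : Problem X k nH nL) (l : Fin nL) (x : X) (a : Fin k) (y : ℕ) :
    P.evalL l x a y = P.L l x a (decide (y ≠ 0)) := by
  simp [Problem.evalL]

theorem evalH_fin (P : Problem X k nH nL) (i : Fin nH) (x : X) : P.evalH i x = P.H i x := by
  simp [Problem.evalH]

theorem post_loadLoss [NeZero k] {dec : NExp} {a : Fin k} {l : Fin nL}
    (hd : ∀ s' : State X, s'.N = s.N → dec.eval s' = a) (hl : s.N 21 0 0 = l) :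
    Post W (loadLoss dec) s fun s' => s'.N = s.N ∧ s'.P = s.P ∧
      s'.R 9 0 0 = W.problem.L l (s.P 0 (s.N 12 0 0)) a true ∧
      s'.R 10 0 0 = W.problem.L l (s.P 0 (s.N 12 0 0)) a false ∧
      ∀ b, b ≠ 9 → b ≠ 10 → s'.R b = s.R b := by
  rw [loadLoss, post_seq, post_evalL, post_evalL]
  refine ⟨rfl, rfl, ?_, ?_, fun b h9 h10 => ?_⟩
  · simp [State.setR_R, NExp.eval, hl, hd, evalL_fin]
  · have h2 : ∀ v n, dec.eval ((s.setR 9 0 0 v).tick n) = a := fun _ _ => hd _ rfl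
    simp [State.setR_R, NExp.eval, hl, h2, evalL_fin]
  · simp [State.setR_R_of_ne, h9, h10]

theorem post_loadVal [NeZero k] {v : ℕ} {dec : NExp} {a : Fin k} {l : Fin nL}
    {q : Predictor X k}
    (hd : ∀ s' : State X, s'.N = s.N → dec.eval s' = a) (hl : s.N 21 0 0 = l)
    (hq : s.R 6 (s.N 12 0 0) a = q (s.P 0 (s.N 12 0 0)) a) :
    Post W (loadVal v dec) s fun s' => s'.N = s.N ∧ s'.P = s.P ∧
      s'.R v 0 0 = condLoss q (W.problem.L l) (s.P 0 (s.N 12 0 0)) a ∧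
      ∀ b, b ≠ 9 → b ≠ 10 → b ≠ v → s'.R b = s.R b := by
  rw [loadVal, post_seq]
  refine (post_loadLoss hd hl).mono fun s' ⟨h1, h2, h3, h4, h5⟩ => ?_
  rw [post_setR]
  refine ⟨h1, h2, ?_, fun b h9 h10 hb => ?_⟩
  · simp [State.setR_R, NExp.eval, RExp.eval, h3, h4, h1, hd s' h1, h5 6, hq, condLoss_eq]
  · rw [State.tick_R, State.setR_R_of_ne _ hb, h5 b h9 h10]

theorem post_ruleDec [NeZero k] {q : Predictor X k} {r : Option (Fin nH)} {l : Fin nL}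
    (hk : s.N 2 0 0 = k) (hr : s.N 20 0 0 = ruleCode r) (hl : s.N 21 0 0 = l)
    (hq : ∀ a : Fin k, s.R 6 (s.N 12 0 0) a = q (s.P 0 (s.N 12 0 0)) a) :
    Post W ruleDec s fun s' =>
      s'.N 17 0 0 = W.problem.ruleOf q r l (s.P 0 (s.N 12 0 0)) := by
  have hk0 : 0 < k := NeZero.pos k
  set x := s.P 0 (s.N 12 0 0) with hx
  rw [ruleDec, post_ite]
  refine ⟨fun hb => ?_, fun hb => ?_⟩
  · rw [post_evalH]
    cases r with
    | none => simp [BExp.holds, NExp.eval, hr, ruleCode] at hb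
    | some i =>
      simp [State.setN_N, NExp.eval, hr, ruleCode, evalH_fin, Problem.ruleOf, ← hx]
  cases r with
  | some i => simp [BExp.holds, NExp.eval, hr, ruleCode] at hb
  | none =>
  simp only [Problem.ruleOf, postProcess]
  set g := condLoss q (W.problem.L l) x with hg
  rw [post_seq, post_setN, post_seq]
  refine (post_loadVal (a := ⟨0, hk0⟩) (l := l) (q := q) (fun _ _ => rfl) ?_
    ?_).mono fun s₁ ⟨h1, h2, h3, h4⟩ => ?_
  · simp [State.setN_N, hl]
  · simpa [State.setN_N] using hq ⟨0, hk0⟩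
  have h1' : ∀ a, a ≠ 17 → s₁.N a = s.N a := fun a ha => by
    rw [h1]; exact State.setN_N_of_ne _ ha _ _ _
  have e12 : s₁.N 12 0 0 = s.N 12 0 0 := by rw [h1' 12 (by norm_num)]
  -- The candidate `d` is minimal among the decisions seen so far and strictly better than all
  -- smaller ones, which characterises the first minimiser at the end. Decision `0` is loaded before
  -- the loop, so the first round compares it with itself.
  refine post_loop_agree (fun i s' => ∃ d : Fin k, s'.N 17 0 0 = d ∧ s'.R 11 0 0 = g d ∧
    (∀ b : Fin k, (b : ℕ) < i → g d ≤ g b) ∧ ∀ b < d, g d < g b) ?_ (fun i hi s' hJ t ht hA hv => ?_)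
    fun s' ⟨d, hd1, _, hd3, hd4⟩ => ?_
  · refine ⟨⟨0, hk0⟩, ?_, ?_, by simp, by simp⟩
    · simp [h1, State.setN_N, NExp.eval]
    · simpa [State.setN_N] using h3
  · have e2 : s₁.N 2 0 0 = k := by rw [h1' 2 (by norm_num), hk]
    have hik : i < k := by simpa [NExp.eval, e2] using hi
    have t12 : t.N 12 0 0 = s.N 12 0 0 := by rw [hA.N 12 (by decide), e12]
    have t6 : t.R 6 = s.R 6 := by
      rw [hA.R 6 (by decide), h4 6 (by norm_num) (by norm_num) (by norm_num)]; rfl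
    have tP : t.P 0 = s.P 0 := by rw [hA.P 0 (by decide), h2]; rfl
    obtain ⟨d, hd1, hd2, hd3, hd4⟩ := hJ
    have td1 : t.N 17 0 0 = d := by rw [ht, ← hd1]; rfl
    have td2 : t.R 11 0 0 = g d := by rw [ht, ← hd2]; rfl
    rw [post_seq]
    refine (post_loadVal (a := ⟨i, hik⟩) (l := l) (q := q) (fun s'' hs'' => ?_) ?_
      ?_).mono fun s₂ ⟨k1, k2, k3, k4⟩ => ?_
    · simp [NExp.eval, hs'', hv]
    · rw [hA.N 21 (by decide), h1' 21 (by norm_num), hl]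
    · rw [t12, t6, tP]; exact hq _
    rw [t12, tP, ← hx, ← hg] at k3
    have k11 : s₂.R 11 0 0 = g d := by
      rw [k4 11 (by norm_num) (by norm_num) (by norm_num), td2]
    rw [post_ite]
    refine ⟨fun hle => ?_, fun hle => ?_⟩
    · rw [post_skip]
      simp only [BExp.holds, RExp.eval, NExp.eval, k11, k3] at hle
      refine ⟨d, ?_, ?_, fun b hb => ?_, hd4⟩
      · simp [k1, td1]
      · simp [k11]
      · rcases Nat.lt_succ_iff_lt_or_eq.1 hb with hb | hb
        · exact hd3 b hb
        · rwa [show b = ⟨i, hik⟩ from Fin.ext hb]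
    · rw [post_seq, post_setR, post_setN]
      simp only [BExp.holds, RExp.eval, NExp.eval, k11, k3, not_le] at hle
      refine ⟨⟨i, hik⟩, ?_, ?_, fun b hb => ?_, fun b hb => ?_⟩
      · simp [State.setN_N, NExp.eval, k1, hv]
      · simp [State.setR_R, NExp.eval, RExp.eval, k3]
      · rcases Nat.lt_succ_iff_lt_or_eq.1 hb with hb | hb
        · exact hle.le.trans (hd3 b hb)
        · rw [show b = ⟨i, hik⟩ from Fin.ext hb]
      · exact hle.trans_le (hd3 b hb)
  · rw [hd1, eq_firstMin (fun b => hd3 b ?_) hd4]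
    have : s₁.N 2 0 0 = k := by rw [h1' 2 (by norm_num), hk]
    simp [NExp.eval, this]

end specs

section specs

universe u
variable {X : Type u} {k nH nL : ℕ} {W : World X k nH nL} {s : State X}

theorem Update.sign_eq (u : Update nH nL) : u.sign = 2 * ((if u.pos then 1 else 0 : ℕ) : ℝ) - 1 := by
  unfold Update.sign
  split_ifs <;> norm_num

theorem outputs_iff {us : List (Update nH nL)} : s.Outputs us ↔ s.N 0 0 0 = us.length ∧
    ∀ (t : ℕ) (ht : t < us.length), s.N 1 t 0 = us[t].loss ∧
      s.N 1 t 1 = ruleCode us[t].rule ∧ s.N 1 t 2 = if us[t].pos then 1 else 0 := Iff.rfl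

/-- Away from the chosen decision nothing is subtracted and clipping fixes a value of `[0,1]`. So
the program has only one entry to rewrite per individual. -/
theorem boostStep_apply [NeZero k] (P : Problem X k nH nL) (q : Predictor X k) (u : Update nH nL)
    (x : X)
    (a : Fin k) : (P.boostStep (1 / 8) q u x a : ℝ) =
      if P.ruleOf q u.rule u.loss x = a then
        max 0 (min 1 ((q x a : ℝ) - u.sign * (1 / 8 * P.eps / (P.lmax * P.lmax)) *
          (P.L u.loss x a true - P.L u.loss x a false)))
      else (q x a : ℝ) := by
  rw [Problem.boostStep, coe_projIcc]
  split_ifs with h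
  · rw [mul_one, sq]
  · rw [mul_zero, mul_zero, sub_zero, min_eq_right (q x a).2.2, max_eq_right (q x a).2.1]

theorem post_applyUpdate [NeZero k] {q : Predictor X k} {u : Update nH nL}
    (hk : s.N 2 0 0 = k) (he : s.R 0 0 0 = W.problem.eps) (hm : s.R 1 0 0 = W.problem.lmax)
    (h0 : s.N 1 (s.N 14 0 0) 0 = u.loss) (h1 : s.N 1 (s.N 14 0 0) 1 = ruleCode u.rule)
    (h2 : s.N 1 (s.N 14 0 0) 2 = if u.pos then 1 else 0)
    (hq : ∀ a : Fin k, s.R 6 (s.N 12 0 0) a = q (s.P 0 (s.N 12 0 0)) a) :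
    Post W applyUpdate s fun s' =>
      (∀ a : Fin k, s'.R 6 (s.N 12 0 0) a =
        W.problem.boostStep (1 / 8) q u (s.P 0 (s.N 12 0 0)) a) ∧
      ∀ j, j ≠ s.N 12 0 0 → s'.R 6 j = s.R 6 j := by
  set x := s.P 0 (s.N 12 0 0) with hx
  set d := W.problem.ruleOf q u.rule u.loss x with hd
  rw [applyUpdate, post_seq, post_setN, post_seq, post_setN, post_seq]
  refine ((post_ruleDec (q := q) (r := u.rule) (l := u.loss) ?_ ?_ ?_ ?_).with_agree).mono
    fun s₁ ⟨d1, A1⟩ => ?_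
  · simp [State.setN_N, hk]
  · simp [State.setN_N, NExp.eval, h1]
  · simp [State.setN_N, NExp.eval, h0]
  · simpa [State.setN_N] using hq
  simp only [State.tick_P, State.setN_P, State.tick_N, State.setN_N, false_and, if_false,
    Nat.reduceEqDiff] at d1
  rw [← hx, ← hd] at d1
  have n1 : ∀ a, a ≠ 13 → a ≠ 17 → a ≠ 20 → a ≠ 21 → s₁.N a = s.N a := fun a h13 h17 h20 h21 => by
    rw [A1.N a (by simp [ruleDec, loadVal, loadLoss, Cmd.wN]; omega), State.tick_N,
      State.setN_N_of_ne _ h21, State.tick_N, State.setN_N_of_ne _ h20]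
  have r1 : ∀ a, a ≠ 8 → a ≠ 9 → a ≠ 10 → a ≠ 11 → s₁.R a = s.R a := fun a h8 h9 h10 h11 => by
    rw [A1.R a (by simp [ruleDec, loadVal, loadLoss, Cmd.wR]; omega)]; rfl
  have p1 : s₁.P = s.P := by
    funext a; rw [A1.P a (by simp [ruleDec, loadVal, loadLoss, Cmd.wP])]; rfl
  have l1 : s₁.N 21 0 0 = u.loss := by
    rw [A1.N 21 (by decide)]; simp [State.setN_N, NExp.eval, h0]
  rw [post_seq]
  refine (post_loadLoss (a := d) (l := u.loss) (fun s' hs' => by simp [NExp.eval, hs', d1])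
    l1).mono fun s₂ ⟨n2, p2, e9, e10, r2⟩ => ?_
  have e12 : s₁.N 12 = s.N 12 := n1 12 (by simp) (by simp) (by simp) (by simp)
  have e14 : s₁.N 14 = s.N 14 := n1 14 (by simp) (by simp) (by simp) (by simp)
  have e1 : s₁.N 1 = s.N 1 := n1 1 (by simp) (by simp) (by simp) (by simp)
  rw [p1, e12, ← hx] at e9 e10
  have r6 : s₂.R 6 = s.R 6 := by rw [r2 6 (by simp) (by simp), r1 6] <;> simp
  have r0 : s₂.R 0 0 0 = W.problem.eps := by rw [r2 0 (by simp) (by simp), r1 0, he] <;> simp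
  have r1' : s₂.R 1 0 0 = W.problem.lmax := by rw [r2 1 (by simp) (by simp), r1 1, hm] <;> simp
  rw [post_seq, post_setR]
  set z : ℝ := (q x d : ℝ) - u.sign * (1 / 8 * W.problem.eps / (W.problem.lmax * W.problem.lmax)) *
          (W.problem.L u.loss x d true - W.problem.L u.loss x d false) with hz
  set s₃ : State X := (s₂.setR _ _ _ _).tick _ with hs₃
  have z3 : s₃.R 11 0 0 = z := by
    rw [hs₃]
    simp [State.setR_R, RExp.eval, NExp.eval, n2, d1, e12, e14, e1, e9, e10, r6, r0, r1', hq,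
      h2, hz, Update.sign_eq]
  have n3 : s₃.N = s₁.N := n2
  have r63 : s₃.R 6 = s.R 6 := by
    rw [← r6, hs₃, State.tick_R]
    exact State.setR_R_of_ne _ (by norm_num) _ _ _
  clear_value s₃
  have key : Post W (.ite (.realLE (rv 11) (.ofNat (.lit 0)))
                (.setR 11 (.lit 0) (.lit 0) (.ofNat (.lit 0)))
                (.ite (.realLE (.ofNat (.lit 1)) (rv 11))
                  (.setR 11 (.lit 0) (.lit 0) (.ofNat (.lit 1))) .skip)) s₃ fun s' =>
      s'.R 11 0 0 = max 0 (min 1 z) ∧ s'.N = s₃.N ∧ s'.R 6 = s₃.R 6 := by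
    simp only [post_ite, post_setR, post_skip, BExp.holds, RExp.eval, NExp.eval, z3,
      State.tick_R, State.tick_N, State.setR_N, Nat.cast_zero, Nat.cast_one]
    refine ⟨fun h => ⟨?_, trivial, State.setR_R_of_ne _ (by norm_num) _ _ _⟩, fun h => ⟨fun h' =>
      ⟨?_, trivial, State.setR_R_of_ne _ (by norm_num) _ _ _⟩, fun h' => ⟨?_, trivial, trivial⟩⟩⟩
    · rw [min_eq_right (by linarith), max_eq_left h]; simp [State.setR_R]
    · rw [min_eq_left h']; simp [State.setR_R]
    · rw [min_eq_right (by linarith), max_eq_right (by linarith)]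
  rw [post_seq]
  refine key.mono fun s₄ ⟨z4, n4, r4⟩ => ?_
  rw [post_setR]
  have e412 : s₄.N 12 = s.N 12 := by rw [n4, n3, e12]
  have e417 : s₄.N 17 0 0 = d := by rw [n4, n3, d1]
  refine ⟨fun a => ?_, fun j hj => ?_⟩
  · rw [boostStep_apply, ← hd]
    by_cases h : d = a
    · simp [State.setR_R, NExp.eval, RExp.eval, e412, e417, z4, h, hz]
    · have h' : ¬ (a : ℕ) = d := fun h' => h (Fin.ext h'.symm)
      simp [State.setR_R, NExp.eval, RExp.eval, e412, e417, h, h', r4, r63, hq]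
  · funext a
    simp [State.setR_R, NExp.eval, RExp.eval, e412, hj, r4, r63]

/-- The predictor is never stored as a function: its row at an individual is rebuilt by replaying
the updates. A recorded rule `none` means the post-processing of the predictor before that update,
and the row rebuilt so far is all that is needed to evaluate it. -/
theorem post_predict [NeZero k] {us : List (Update nH nL)} (hk : s.N 2 0 0 = k)
    (he : s.R 0 0 0 = W.problem.eps) (hm : s.R 1 0 0 = W.problem.lmax) (ho : s.Outputs us) :
    Post W predict s fun s' =>
      (∀ a : Fin k, s'.R 6 (s.N 12 0 0) a =
        W.problem.boost (1 / 8) us (s.P 0 (s.N 12 0 0)) a) ∧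
      ∀ j, j ≠ s.N 12 0 0 → s'.R 6 j = s.R 6 j := by
  rw [outputs_iff] at ho
  rw [predict, post_seq]
  have h_loop_start : Post W (.loop 13 (nv 2)
      (.setR 6 (nv 12) (nv 13) (.div (.ofNat (.lit 1)) (.ofNat (.lit 2))))) s fun s' =>
      (∀ a < k, s'.R 6 (s.N 12 0 0) a = 1 / 2) ∧ ∀ j, j ≠ s.N 12 0 0 → s'.R 6 j = s.R 6 j := by
    refine post_loop_agree (fun i s' => (∀ a < i, s'.R 6 (s.N 12 0 0) a = 1 / 2) ∧
      ∀ j, j ≠ s.N 12 0 0 → s'.R 6 j = s.R 6 j) ⟨by simp, fun _ _ => rfl⟩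
      (fun i hi s' ⟨h1, h2⟩ t ht hA hv => ?_) (fun s' h => by simpa [NExp.eval, hk] using h)
    rw [post_setR]
    have e12 : t.N 12 = s.N 12 := hA.N 12 (by decide)
    have e6 : t.R 6 = s'.R 6 := by rw [ht]; rfl
    refine ⟨fun a ha => ?_, fun j hj => ?_⟩
    · rcases Nat.lt_succ_iff_lt_or_eq.1 ha with ha | ha
      · simp [State.setR_R, NExp.eval, RExp.eval, e12, hv, ha.ne, e6]
        simpa using h1 a ha
      · simp [State.setR_R, NExp.eval, RExp.eval, e12, hv, ha]
    · funext a
      simp [State.setR_R, NExp.eval, e12, hj, e6, h2 j hj]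
  refine h_loop_start.with_agree.mono fun s₁ ⟨⟨h1, h2⟩, A1⟩ => ?_
  have e12 : s₁.N 12 = s.N 12 := A1.N 12 (by decide)
  refine post_loop_agree (fun i s' => (∀ a : Fin k, s'.R 6 (s.N 12 0 0) a =
      W.problem.boost (1 / 8) (us.take i) (s.P 0 (s.N 12 0 0)) a) ∧
      ∀ j, j ≠ s.N 12 0 0 → s'.R 6 j = s.R 6 j) ⟨fun a => ?_, h2⟩
      (fun i hi s' ⟨h3, h4⟩ t ht hA hv => ?_) (fun s' h => ?_)
  · simpa [Problem.boost, halfPredictor] using h1 a a.2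
  · have e0 : s₁.N 0 = s.N 0 := A1.N 0 (by decide)
    have hi' : i < us.length := by simpa [NExp.eval, e0, ho.1] using hi
    have t12 : t.N 12 = s.N 12 := by rw [hA.N 12 (by decide), e12]
    have t1 : t.N 1 = s.N 1 := by rw [hA.N 1 (by decide), A1.N 1 (by decide)]
    have tP : t.P 0 = s.P 0 := by rw [hA.P 0 (by decide), A1.P 0 (by decide)]
    have t6 : t.R 6 = s'.R 6 := by rw [ht]; rfl
    obtain ⟨o1, o2, o3⟩ := ho.2 i hi'
    refine (post_applyUpdate (q := W.problem.boost (1 / 8) (us.take i)) (u := us[i])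
      ?_ ?_ ?_ ?_ ?_ ?_ ?_).mono fun s₂ ⟨h5, h6⟩ => ⟨fun a => ?_, fun j hj => ?_⟩
    · rw [hA.N 2 (by decide), A1.N 2 (by decide), hk]
    · rw [hA.R 0 (by decide), A1.R 0 (by decide), he]
    · rw [hA.R 1 (by decide), A1.R 1 (by decide), hm]
    · rw [hv, t1, o1]
    · rw [hv, t1, o2]
    · rw [hv, t1, o3]
    · rw [t12, tP, t6]; exact h3
    · rw [t12, tP] at h5
      rw [h5, ← boost_append, List.take_append_getElem]
    · rw [h6 j (by rwa [t12]), t6, h4 j hj]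
  · have e0 : s₁.N 0 = s.N 0 := A1.N 0 (by decide)
    simpa [NExp.eval, e0, ho.1] using h

/-! ### The data of a round -/

/-- The samples are stored in memory. -/
def Stored (s : State X) (S : List (X × Fin k × Bool)) : Prop :=
  ∀ (j : ℕ) (hj : j < S.length), s.P 0 j = S[j].1 ∧ s.N 10 j 0 = S[j].2.1 ∧
    s.N 11 j 0 = if S[j].2.2 then 1 else 0

/-- The parameters stored in memory. -/
structure Params (W : World X k nH nL) (η : ℝ) (T M : ℕ) (s : State X) : Prop where
  hk : s.N 2 0 0 = k
  hnL : s.N 4 0 0 = nL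
  hT : s.N 5 0 0 = T
  hm : s.N 6 0 0 = W.learner.size W.problem.rho η
  hM : s.N 7 0 0 = M
  heps : s.R 0 0 0 = W.problem.eps
  hlmax : s.R 1 0 0 = W.problem.lmax
  hrho0 : s.R 3 0 0 = W.problem.eps / (k * W.problem.lmax)
  hrho : s.R 4 0 0 = W.problem.rho
  heta : s.R 5 0 0 = η

/-- The side conditions are phrased by membership in explicit lists so that `decide` settles them
for concrete programs. -/
theorem Params.of_agree {η : ℝ} {T M : ℕ} {s s' : State X} {wN wR wP : List ℕ}
    (h : Params W η T M s) (hA : Agree wN wR wP s s') (hN : ∀ a ∈ [2, 4, 5, 6, 7], a ∉ wN)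
    (hR : ∀ a ∈ [0, 1, 3, 4, 5], a ∉ wR) : Params W η T M s' where
  hk := by rw [hA.N 2 (hN 2 (by decide)), h.hk]
  hnL := by rw [hA.N 4 (hN 4 (by decide)), h.hnL]
  hT := by rw [hA.N 5 (hN 5 (by decide)), h.hT]
  hm := by rw [hA.N 6 (hN 6 (by decide)), h.hm]
  hM := by rw [hA.N 7 (hN 7 (by decide)), h.hM]
  heps := by rw [hA.R 0 (hR 0 (by decide)), h.heps]
  hlmax := by rw [hA.R 1 (hR 1 (by decide)), h.hlmax]
  hrho0 := by rw [hA.R 3 (hR 3 (by decide)), h.hrho0]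
  hrho := by rw [hA.R 4 (hR 4 (by decide)), h.hrho]
  heta := by rw [hA.R 5 (hR 5 (by decide)), h.heta]

/-- Parameters, samples and predictions are stored in memory. -/
structure Ready (W : World X k nH nL) (η : ℝ) (T : ℕ) (q : Predictor X k)
    (S : List (X × Fin k × Bool)) (s : State X) : Prop extends Params W η T S.length s where
  stored : Stored s S
  pred : ∀ j < S.length, ∀ a : Fin k, s.R 6 j a = q (s.P 0 j) a

theorem Ready.of_agree [NeZero k] {η : ℝ} {T : ℕ} {q : Predictor X k} {S : List (X × Fin k × Bool)}
    {s s' : State X} {wN wR wP : List ℕ} (h : Ready W η T q S s) (hA : Agree wN wR wP s s')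
    (hN : ∀ a ∈ [2, 4, 5, 6, 7, 10, 11], a ∉ wN) (hR : ∀ a ∈ [0, 1, 3, 4, 5, 6], a ∉ wR)
    (hP : 0 ∉ wP) : Ready W η T q S s' where
  toParams := h.toParams.of_agree hA (fun a ha => hN a (by simp at ha ⊢; omega))
    fun a ha => hR a (by simp at ha ⊢; omega)
  stored j hj := by
    rw [hA.P 0 hP, hA.N 10 (hN 10 (by decide)), hA.N 11 (hN 11 (by decide))]
    exact h.stored j hj
  pred j hj a := by
    rw [hA.P 0 hP, hA.R 6 (hR 6 (by decide))]
    exact h.pred j hj a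

/-- The value of the residual expression. -/
theorem eval_residual {η : ℝ} {T : ℕ} {q : Predictor X k} {S : List (X × Fin k × Bool)}
    {l : Fin nL} {j : ℕ} {dec : NExp} {d : Fin k} (hS : Ready W η T q S s) (hj : j < S.length)
    (h12 : s.N 12 0 0 = j) (hd : dec.eval s = d)
    (h9 : s.R 9 0 0 = W.problem.L l S[j].1 d true)
    (h10 : s.R 10 0 0 = W.problem.L l S[j].1 d false) :
    (residual dec).eval s = ((q S[j].1 d : ℝ) - if S[j].2.2 then 1 else 0) *
      W.problem.gap l S[j].1 d / W.problem.lmax := by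
  obtain ⟨s1, s2, s3⟩ := hS.stored j hj
  have := hS.pred j hj d
  simp only [residual, RExp.eval, NExp.eval, h12, hd, h9, h10, hS.hlmax, s3, this, s1,
    Problem.gap]
  push_cast
  rfl

theorem post_sumRule [NeZero k] {η : ℝ} {T : ℕ} {q : Predictor X k} {S : List (X × Fin k × Bool)}
    {r : Option (Fin nH)} {l : Fin nL} (hS : Ready W η T q S s) (hr : s.N 20 0 0 = ruleCode r)
    (hl : s.N 21 0 0 = l) :
    Post W sumRule s fun s' =>
      s'.R 12 0 0 = (S.map (W.problem.stat q (W.problem.ruleOf q r l) l)).sum := by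
  set f := W.problem.ruleOf q r l with hf
  rw [sumRule, post_seq, post_setR]
  set s₁ : State X := (s.setR _ _ _ _).tick _ with hs₁
  have A1 : Agree [] [12] [] s s₁ :=
    ⟨fun _ _ => rfl, fun a ha => State.setR_R_of_ne _ (by simpa using ha) _ _ _, fun _ _ => rfl⟩
  have z1 : s₁.R 12 0 0 = 0 := by simp [hs₁, State.setR_R, NExp.eval, RExp.eval]
  have R1 : Ready W η T q S s₁ := hS.of_agree A1 (by simp) (by decide) (by simp)
  clear_value s₁
  refine post_loop_agree (fun i s' => s'.R 12 0 0 =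
    ((S.take i).map (W.problem.stat q f l)).sum) (by simpa using z1)
    (fun i hi s' hJ t ht hA hv => ?_) (fun s' h => ?_)
  · have hi' : i < S.length := by simpa [NExp.eval, R1.hM] using hi
    have Rt : Ready W η T q S t := R1.of_agree hA (by decide) (by decide) (by decide)
    have t12 : t.R 12 0 0 = ((S.take i).map (W.problem.stat q f l)).sum := by rw [← hJ, ht]; rfl
    have t21 : t.N 21 0 0 = l := by rw [hA.N 21 (by decide), A1.N 21 (by simp), hl]
    rw [← List.take_append_getElem hi', List.map_append, List.sum_append, ← t12]
    simp only [List.map_cons, List.map_nil, List.sum_cons, List.sum_nil, add_zero]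
    rw [post_seq]
    refine (post_ruleDec (q := q) (r := r) (l := l) Rt.hk ?_ t21 ?_).with_agree.mono
      fun s₂ ⟨d2, A2⟩ => ?_
    · rw [hA.N 20 (by decide), A1.N 20 (by simp), hr]
    · rw [hv]; exact Rt.pred i hi'
    have R2 : Ready W η T q S s₂ := Rt.of_agree A2 (by decide) (by decide) (by decide)
    obtain ⟨p1, p2, p3⟩ := Rt.stored i hi'
    rw [hv, p1, ← hf] at d2
    have e10 : s₂.N 10 i 0 = S[i].2.1 := (R2.stored i hi').2.1
    have e12 : s₂.N 12 0 0 = i := by rw [A2.N 12 (by decide), hv]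
    have e12' : s₂.R 12 = t.R 12 := A2.R 12 (by decide)
    rw [post_ite]
    refine ⟨fun hb => ?_, fun hb => ?_⟩
    · simp only [BExp.holds, NExp.eval, d2, e12, e10] at hb
      have hd : f S[i].1 = S[i].2.1 := Fin.ext (le_antisymm hb.1 hb.2)
      rw [post_seq]
      refine (post_loadLoss (a := f S[i].1) (l := l) (fun s' hs' => ?_) ?_).mono
        fun s₃ ⟨n3, p3, e9, e10, r3⟩ => ?_
      · simp [NExp.eval, hs', d2]
      · rw [State.tick_N, A2.N 21 (by decide), t21]
      simp only [State.tick_N, State.tick_P, State.tick_R] at n3 p3 e9 e10 r3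
      rw [e12, (R2.stored i hi').1] at e9 e10
      have R3 : Ready W η T q S s₃ := R2.of_agree (wN := []) (wR := [9, 10]) (wP := [])
        ⟨fun a _ => by rw [n3], fun a ha => by simp at ha; exact r3 a ha.1 ha.2,
          fun a _ => by rw [p3]⟩ (by decide) (by decide) (by decide)
      rw [post_setR]
      simp only [State.tick_R, State.setR_R, NExp.eval, RExp.eval, and_self, if_true]
      rw [r3 12 (by norm_num) (by norm_num), e12',
        eval_residual (l := l) (d := f S[i].1) R3 hi' (by rw [n3, e12])
          (by simp [NExp.eval, n3, d2]) e9 e10, Problem.stat, if_pos hd, hd]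
    · simp only [BExp.holds, NExp.eval, d2, e12, e10] at hb
      have hd : f S[i].1 ≠ S[i].2.1 := fun h => hb ⟨by rw [h], by rw [h]⟩
      rw [post_skip, Problem.stat, if_neg hd, State.tick_R, State.tick_R, e12', add_zero]
  · simpa [NExp.eval, R1.hM] using h

end specs

section specs

universe u
variable {X : Type u} {k nH nL : ℕ} {W : World X k nH nL} {s : State X}

/-! ### The audits -/

/-- Row `t` of the output holds the update `u`. -/
def Holds (s : State X) (t : ℕ) (u : Update nH nL) : Prop :=
  s.N 1 t 0 = u.loss ∧ s.N 1 t 1 = ruleCode u.rule ∧ s.N 1 t 2 = if u.pos then 1 else 0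

theorem post_record [NeZero k] {b : Bool} {us : List (Update nH nL)}
    {r : Option (Fin nH)} {l : Fin nL}
    (ho : s.Outputs us) (hr : s.N 20 0 0 = ruleCode r) (hl : s.N 21 0 0 = l) :
    Post W (record b) s fun s' =>
      s'.Outputs us ∧ s'.N 16 0 0 = 1 ∧ Holds s' us.length (⟨l, r, b⟩ : Update nH nL) := by
  rw [outputs_iff] at ho
  simp only [record, post_seq, post_setN]
  refine ⟨outputs_iff.2 ⟨?_, fun t ht => ?_⟩, ?_, ?_, ?_, ?_⟩
  · simp [State.setN_N, NExp.eval, ho.1]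
  · obtain ⟨h1, h2, h3⟩ := ho.2 t ht
    simp [State.setN_N, NExp.eval, ho.1, ht.ne, h1, h2, h3]
  · simp [State.setN_N, NExp.eval]
  · simp [State.setN_N, NExp.eval, ho.1, hl]
  · simp [State.setN_N, NExp.eval, ho.1, hr]
  · simp [State.setN_N, NExp.eval, ho.1]

/-- The situation during the audits of a round. -/
structure Auditing [NeZero k] (W : World X k nH nL) (η : ℝ) (T : ℕ) (us : List (Update nH nL))
    (S : List (X × Fin k × Bool)) (s : State X) : Prop
    extends Ready W η T (W.problem.boost (1 / 8) us) S s where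
  out : s.Outputs us
  -- The pending update sits in row `us.length`, beyond the output `us`, so recording it leaves the
  -- output intact.
  found : s.N 16 0 0 = 0 ∨ s.N 16 0 0 = 1 ∧ ∃ u : Update nH nL, Holds s us.length u ∧
    1 / 8 * W.problem.eps ≤ u.sign * W.problem.err (W.problem.boost (1 / 8) us) u.rule u.loss

theorem Auditing.of_agree [NeZero k] {η : ℝ} {T : ℕ} {us : List (Update nH nL)}
    {S : List (X × Fin k × Bool)} {s s' : State X} {wN wR wP : List ℕ}
    (h : Auditing W η T us S s) (hA : Agree wN wR wP s s')
    (hN : ∀ a ∈ [0, 1, 2, 4, 5, 6, 7, 10, 11, 16], a ∉ wN)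
    (hR : ∀ a ∈ [0, 1, 3, 4, 5, 6], a ∉ wR) (hP : 0 ∉ wP) : Auditing W η T us S s' where
  toReady := h.toReady.of_agree hA (fun a ha => hN a (by simp at ha ⊢; omega)) hR hP
  out := by
    have := h.out
    rw [outputs_iff] at this ⊢
    rwa [hA.N 0 (hN 0 (by decide)), hA.N 1 (hN 1 (by decide))]
  found := by
    have := h.found
    unfold Holds at this ⊢
    rwa [hA.N 16 (hN 16 (by decide)), hA.N 1 (hN 1 (by decide))]

/-- The flag is only ever raised during the audits. If it is still down afterwards, this audit
rejected both signs, and accuracy bounds the error by `(3/8 + 1/8) ε`. -/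
theorem post_audit [NeZero k] {η : ℝ} {T : ℕ} {us : List (Update nH nL)} {S : List
    (X × Fin k × Bool)}
    {r : Option (Fin nH)} {l : Fin nL} (hl0 : 0 < W.problem.lmax) (he : 0 < W.problem.eps)
    (h : Auditing W η T us S s) (hS : 0 < S.length)
    (hacc : W.problem.Accurate (W.problem.boost (1 / 8) us) S)
    (hr : s.N 20 0 0 = ruleCode r) (hl : s.N 21 0 0 = l) :
    Post W audit s fun s' => Auditing W η T us S s' ∧ (s'.N 16 0 0 = 0 → s.N 16 0 0 = 0 ∧
      |W.problem.err (W.problem.boost (1 / 8) us) r l| < W.problem.eps / 2) := by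
  set q := W.problem.boost (1 / 8) us with hq
  set e := W.problem.err q r l with he'
  have hk : (0 : ℝ) < k := Nat.cast_pos.2 (NeZero.pos k)
  have hM : (0 : ℝ) < S.length := Nat.cast_pos.2 hS
  set v := (S.map (W.problem.stat q (W.problem.ruleOf q r l) l)).sum with hv
  set θ := 3 / 8 * (W.problem.eps / (k * W.problem.lmax)) * S.length with hθ
  -- The threshold uses the uncapped `ε/(k ℓ_max)`, which is at least `ρ`.
  have hacc' : |v - S.length * (e / (k * W.problem.lmax))| ≤
      S.length * (W.problem.eps / (k * W.problem.lmax) / 8) := by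
    refine (hacc r l).trans ?_
    gcongr
    exact min_le_left _ _
  -- Soundness: `3/8 - 1/8 = 1/4`, more than the required slack `1/8`.
  have hval : ∀ b : Bool, θ ≤ sgn b * v → 1 / 8 * W.problem.eps ≤ sgn b * e := by
    intro b hb
    have h1 : sgn b * v - S.length * (sgn b * e / (k * W.problem.lmax)) ≤
        S.length * (W.problem.eps / (k * W.problem.lmax) / 8) := by
      refine le_trans ?_ hacc'
      rw [← one_mul |_|, ← abs_sgn b, ← abs_mul]
      refine le_trans (le_of_eq ?_) (le_abs_self _)
      ring
    have h2 : S.length * (W.problem.eps / (k * W.problem.lmax) / 4) ≤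
        S.length * (sgn b * e / (k * W.problem.lmax)) := by
      rw [hθ] at hb; nlinarith
    have h3 := le_of_mul_le_mul_left h2 hM
    rw [div_right_comm, div_le_div_iff_of_pos_right (by positivity)] at h3
    linarith
  -- Completeness: `1/2 - 1/8 = 3/8`.
  have hlarge : ∀ b : Bool, W.problem.eps / 2 ≤ sgn b * e → θ ≤ sgn b * v := by
    intro b hb
    have h1 : -(sgn b * v - S.length * (sgn b * e / (k * W.problem.lmax))) ≤
        S.length * (W.problem.eps / (k * W.problem.lmax) / 8) := by
      refine le_trans ?_ hacc'
      rw [← one_mul |_|, ← abs_sgn b, ← abs_mul]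
      refine le_trans (le_of_eq ?_) (neg_le_abs _)
      ring
    have h2 : S.length * (W.problem.eps / 2 / (k * W.problem.lmax)) ≤
        S.length * (sgn b * e / (k * W.problem.lmax)) := by gcongr
    rw [div_right_comm] at h2
    rw [hθ]; nlinarith
  have main : Post W audit s fun s' => s'.Outputs us ∧
      ((s'.N 16 0 0 = 1 ∧ ∃ u : Update nH nL, Holds s' us.length u ∧
        1 / 8 * W.problem.eps ≤ u.sign * W.problem.err q u.rule u.loss) ∨
      (s'.N 16 = s.N 16 ∧ s'.N 1 = s.N 1 ∧ |e| < W.problem.eps / 2)) := by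
    rw [audit, post_seq]
    refine (post_sumRule h.toReady hr hl).with_agree.mono fun s₁ ⟨h1', A1⟩ => ?_
    have h1 : s₁.R 12 0 0 = v := h1'
    clear h1'
    clear_value v θ
    have a1 : Auditing W η T us S s₁ :=
      h.of_agree A1 (by decide) (by decide) (by decide)
    have hr1 : s₁.N 20 0 0 = ruleCode r := by rw [A1.N 20 (by decide), hr]
    have hl1 : s₁.N 21 0 0 = l := by rw [A1.N 21 (by decide), hl]
    have hrec : ∀ (b : Bool) (n : ℕ), θ ≤ sgn b * v → Post W (record b) (s₁.tick n) fun s' =>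
        s'.Outputs us ∧
        ((s'.N 16 0 0 = 1 ∧ ∃ u : Update nH nL, Holds s' us.length u ∧
          1 / 8 * W.problem.eps ≤ u.sign * W.problem.err q u.rule u.loss) ∨
        (s'.N 16 = s.N 16 ∧ s'.N 1 = s.N 1 ∧ |e| < W.problem.eps / 2)) := fun b n hb =>
      (post_record (s := s₁.tick n) (r := r) (l := l) a1.out hr1 hl1).mono
        fun s' ⟨o1, o2, o3⟩ => ⟨o1, .inl ⟨o2, _, o3, hval b hb⟩⟩
    have hthr : ∀ n, threshold.eval (s₁.tick n) = θ := fun n => by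
      simp [threshold, RExp.eval, NExp.eval, a1.hrho0, a1.hM, hθ]
    simp only [post_ite, BExp.holds, hthr, RExp.eval, NExp.eval, State.tick_R, h1,
      State.tick_tick]
    have hthr0 : threshold.eval s₁ = θ := by
      simp [threshold, RExp.eval, NExp.eval, a1.hrho0, a1.hM, hθ]
    rw [hthr0]
    refine ⟨fun hb => hrec true _ (by simpa [sgn] using hb), fun hb =>
      ⟨fun hb' => hrec false _ (by simpa [sgn] using hb'), fun hb' => ?_⟩⟩
    rw [post_skip]
    refine ⟨a1.out, .inr ⟨A1.N 16 (by decide), A1.N 1 (by decide), ?_⟩⟩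
    rw [abs_lt]
    constructor
    · by_contra hc
      exact hb' (by simpa [sgn] using hlarge false (by simp [sgn]; linarith))
    · by_contra hc
      exact hb (by simpa [sgn] using hlarge true (by simp [sgn]; linarith))
  refine main.with_agree.mono fun s' ⟨⟨h1, h2⟩, A⟩ => ?_
  have hR : Ready W η T q S s' := h.toReady.of_agree A (by decide) (by decide) (by decide)
  rcases h2 with h2 | ⟨h2, h3, h4⟩
  · exact ⟨⟨hR, h1, .inr h2⟩, fun h0 => by rw [h2.1] at h0; exact absurd h0 one_ne_zero⟩
  · refine ⟨⟨hR, h1, ?_⟩, fun h0 => ⟨by rwa [h2] at h0, h4⟩⟩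
    have := h.found
    unfold Holds at this ⊢
    rwa [h2, h3]

/-! ### The calls of the learner -/

theorem eval_negSign (b : Bool) (s : State X) : (negSign b).eval s = -sgn b := by
  cases b <;> simp [negSign, RExp.eval, NExp.eval, sgn]

theorem post_prepare [NeZero k] {η : ℝ} {T : ℕ} {q : Predictor X k} {S : List (X × Fin k × Bool)}
    {l : Fin nL} (b : Bool) (hS : Ready W η T q S s) (hl : s.N 21 0 0 = l)
    (hm : W.learner.size W.problem.rho η ≤ S.length) :
    Post W (prepare b) s fun s' => s'.dataset k 0 7 (W.learner.size W.problem.rho η) =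
      (S.take (W.learner.size W.problem.rho η)).map (W.problem.costExample q l b) := by
  have main : Post W (prepare b) s fun s' =>
      ∀ (j : ℕ) (hj : j < S.length), j < W.learner.size W.problem.rho η → ∀ a : Fin k,
        s'.R 7 j a = (W.problem.costExample q l b S[j]).2 a := by
    refine post_loop_agree (fun i s' => ∀ (j : ℕ) (hj : j < S.length), j < i → ∀ a : Fin k,
        s'.R 7 j a = (W.problem.costExample q l b S[j]).2 a) (by simp)
      (fun i hi s' hJ t ht hA hv => ?_) (fun s' h => by simpa [NExp.eval, hS.hm] using h)
    have hi' : i < S.length := by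
      have : i < W.learner.size W.problem.rho η := by simpa [NExp.eval, hS.hm] using hi
      omega
    have Rt : Ready W η T q S t := hS.of_agree hA (by cases b <;> decide) (by cases b <;> decide)
      (by cases b <;> decide)
    have t7 : t.R 7 = s'.R 7 := by rw [ht]; rfl
    have t21 : t.N 21 0 0 = l := by rw [hA.N 21 (by cases b <;> decide), hl]
    -- The row may hold costs from an earlier call, so it is cleared before its single nonzero entry
    -- is written.
    have zero : Post W (.loop 13 (nv 2) (.setR 7 (nv 12) (nv 13) (.ofNat (.lit 0)))) t fun s'' =>
        (∀ a < k, s''.R 7 i a = 0) ∧ ∀ j, j ≠ i → s''.R 7 j = t.R 7 j := by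
      refine post_loop_agree (fun m s'' => (∀ a < m, s''.R 7 i a = 0) ∧
        ∀ j, j ≠ i → s''.R 7 j = t.R 7 j) ⟨by simp, fun _ _ => rfl⟩
        (fun m hm s₁ ⟨h1, h2⟩ t' ht' hA' hv' => ?_)
        (fun s'' h => by simpa [NExp.eval, Rt.hk] using h)
      rw [post_setR]
      have e12 : t'.N 12 0 0 = i := by rw [hA'.N 12 (by decide), hv]
      have e7 : t'.R 7 = s₁.R 7 := by rw [ht']; rfl
      refine ⟨fun a ha => ?_, fun j hj => ?_⟩
      · rcases Nat.lt_succ_iff_lt_or_eq.1 ha with ha | ha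
        · simp [State.setR_R, NExp.eval, RExp.eval, e12, hv', ha.ne, e7, h1 a ha]
        · simp [State.setR_R, NExp.eval, RExp.eval, e12, hv', ha]
      · funext a
        simp [State.setR_R, NExp.eval, e12, hj, e7, h2 j hj]
    rw [post_seq]
    refine zero.with_agree.mono fun s₁ ⟨⟨h1, h2⟩, A1⟩ => ?_
    have R1 : Ready W η T q S s₁ := Rt.of_agree A1 (by decide) (by decide) (by decide)
    obtain ⟨p1, p2, p3⟩ := R1.stored i hi'
    have e12 : s₁.N 12 0 0 = i := by rw [A1.N 12 (by decide), hv]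
    rw [post_seq]
    refine (post_loadLoss (a := S[i].2.1) (l := l) (fun s' hs' => ?_) ?_).mono
      fun s₂ ⟨n2, q2, e9, e10, r2⟩ => ?_
    · simp [NExp.eval, hs', e12, p2]
    · rw [A1.N 21 (by decide), t21]
    rw [e12, p1] at e9 e10
    have R2 : Ready W η T q S s₂ := R1.of_agree (wN := []) (wR := [9, 10]) (wP := [])
      ⟨fun a _ => by rw [n2], fun a ha => by simp at ha; exact r2 a ha.1 ha.2,
        fun a _ => by rw [q2]⟩ (by decide) (by decide) (by decide)
    have e7 : s₂.R 7 = s₁.R 7 := r2 7 (by simp) (by simp)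
    rw [post_setR]
    intro j hj hji a
    have hres := eval_residual (l := l) (dec := .get 10 (nv 12) (.lit 0)) R2 hi' (by rw [n2, e12])
      (by simp [NExp.eval, n2, e12, p2]) e9 e10
    rcases Nat.lt_succ_iff_lt_or_eq.1 hji with hji | rfl
    · simp [State.setR_R, NExp.eval, n2, e12, hji.ne, e7, h2 j hji.ne, t7, hJ j hj hji a]
    · simp only [State.tick_R, State.setR_R, NExp.eval, RExp.eval, n2, e12, p2, e7,
        Problem.costExample, hres, eval_negSign, true_and, Fin.val_inj]
      by_cases hd : a = S[j].2.1
      · rw [if_pos hd, if_pos hd]; ring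
      · rw [if_neg hd, if_neg hd]; exact h1 a a.2
  refine main.with_agree.mono fun s' ⟨h, A⟩ => ?_
  have R' : Ready W η T q S s' := hS.of_agree A (by cases b <;> decide) (by cases b <;> decide)
      (by cases b <;> decide)
  refine List.ext_getElem (by simp [State.dataset, hm]) fun j h1 h2 => ?_
  have hj : j < W.learner.size W.problem.rho η := by simpa [State.dataset] using h1
  have hj' : j < S.length := by omega
  simp only [State.dataset, List.getElem_map, List.getElem_range, List.getElem_take]
  refine Prod.ext (R'.stored j hj').1 ?_
  funext a
  exact h j hj' hj a

end specs

/-! ## Failure probabilities -/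

section fail

universe u
variable {X : Type u} {k nH nL : ℕ} {W : World X k nH nL} {s : State X} {c d : Cmd}
  {Q R : State X → Prop} {A B : ENNReal}

open Classical in
/-- The probability that the final state violates `Q`. -/
noncomputable def fail [NeZero k] (W : World X k nH nL) (c : Cmd) (s : State X) (Q
    : State X → Prop) :
    ENNReal := wsum (run W c s) fun s' => if Q s' then 0 else 1

theorem fail_of_post [NeZero k] (h : Post W c s Q) : fail W c s Q ≤ 0 :=
  wsum_le_of_support fun s' hs' => by rw [if_pos (h s' hs')]

theorem fail_le_one [NeZero k] : fail W c s Q ≤ 1 :=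
  wsum_le_of_support fun s' _ => by split_ifs <;> simp

theorem fail_mono [NeZero k] (h : fail W c s Q ≤ A) (hQ : ∀ s', Q s' → R s') : fail W c s R ≤ A
    := by
  refine le_trans (wsum_mono fun s' => ?_) h
  by_cases h1 : R s'
  · rw [if_pos h1]; exact bot_le
  · rw [if_neg h1, if_neg fun h2 => h1 (hQ s' h2)]

theorem fail_with_post [NeZero k] (h : fail W c s Q ≤ A) (hR : Post W c s R) :
    fail W c s (fun s' => Q s' ∧ R s') ≤ A := by
  refine le_trans (wsum_mono_support fun s' hs' => ?_) h
  by_cases h1 : Q s'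
  · rw [if_pos ⟨h1, hR s' hs'⟩]; exact bot_le
  · rw [if_neg h1, if_neg fun h2 => h1 h2.1]

/-- A union bound: if the intermediate assertion fails, the rest is charged only the trivial bound
`1`. -/
theorem fail_seq [NeZero k] (h : fail W c s R ≤ A) (h' : ∀ s', R s' → fail W d s' Q ≤ B) :
    fail W (.seq c d) s Q ≤ A + B := by
  classical
  calc fail W (.seq c d) s Q = wsum (run W c s) fun s' => fail W d s' Q := wsum_bind _ _ _
    _ ≤ wsum (run W c s) fun s' => (if R s' then 0 else 1) + B := by
        refine wsum_mono fun s' => ?_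
        by_cases hs' : R s'
        · rw [if_pos hs', zero_add]; exact h' s' hs'
        · rw [if_neg hs']; exact fail_le_one.trans le_self_add
    _ ≤ A + B := by
        rw [wsum_add, wsum_const]
        gcongr
        exact h

theorem fail_seq_post [NeZero k] (h : Post W c s R) (h' : ∀ s', R s' → fail W d s' Q ≤ B) :
    fail W (.seq c d) s Q ≤ B := by
  simpa using fail_seq (fail_of_post h) h'

theorem post_seq_fail [NeZero k] (h : fail W c s R ≤ A) (h' : ∀ s', R s' → Post W d s' Q) :
    fail W (.seq c d) s Q ≤ A := by
  simpa using fail_seq h fun s' hs' => fail_of_post (h' s' hs')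

/-- The bound for the continuation may depend on the returned hypothesis and is averaged over the
learner's coins, so that with an indicator `G` it becomes the probability of a bad answer. -/
theorem fail_learnerCall [NeZero k] {a p v : ℕ} {ρ δ : RExp} {G : Fin nH → ENNReal}
    (h : ∀ (i : Fin nH) (s' : State X), Agree [a] [] [] s s' → s'.N a 0 0 = i →
      fail W d s' Q ≤ G i) :
    fail W (.seq (.learnerCall a (.lit 0) (.lit 0) p v ρ δ) d) s Q ≤
      wsum (W.learner.hyp (ρ.eval s) (δ.eval s)
        (s.dataset k p v (W.learner.size (ρ.eval s) (δ.eval s)))) G := by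
  have e : run W (.seq (.learnerCall a (.lit 0) (.lit 0) p v ρ δ) d) s =
      (((W.learner.hyp (ρ.eval s) (δ.eval s)
        (s.dataset k p v (W.learner.size (ρ.eval s) (δ.eval s)))).map
          fun i : Fin nH => (i : ℕ)).map fun i : ℕ =>
          { (s.setN a 0 0 i).tick (1 + 1 + 1 + ρ.cost + δ.cost +
              W.learner.time (ρ.eval s) (δ.eval s)) with calls := s.calls + 1 }).bind
        (run W d) := rfl
  rw [fail, e, wsum_bind, wsum_map, wsum_map]
  refine wsum_mono fun i => ?_
  refine h i _ ⟨fun b hb => ?_, fun _ _ => rfl, fun _ _ => rfl⟩ ?_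
  · exact State.setN_N_of_ne _ (by simpa using hb) _ _ _
  · exact if_pos ⟨rfl, rfl, rfl⟩

theorem fail_loop [NeZero k] {v : ℕ} {n : NExp} (J : ℕ → State X → Prop) (B : ℕ → ENNReal)
    (h0 : J 0 (s.tick (1 + n.cost)))
    (hs : ∀ i < n.eval s, ∀ s', J i s' →
      fail W c ((s'.setN v 0 0 i).tick 1) (J (i + 1)) ≤ B i) :
    fail W (.loop v n c) s (J (n.eval s)) ≤ ∑ i ∈ Finset.range (n.eval s), B i := by
  classical
  change wsum (rounds _ _ (n.eval s)) _ ≤ _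
  generalize n.eval s = N at hs ⊢
  induction N with
  | zero => simp [rounds, wsum_pure, h0]
  | succ N ih =>
    rw [rounds, wsum_bind, Finset.sum_range_succ]
    refine le_trans (wsum_mono (h := fun s' => (if J N s' then 0 else 1) + B N) fun s' => ?_) ?_
    · by_cases hJ : J N s'
      · rw [if_pos hJ, zero_add]
        exact hs N (Nat.lt_succ_self N) s' hJ
      · rw [if_neg hJ]
        exact le_trans fail_le_one le_self_add
    · rw [wsum_add, wsum_const]
      gcongr
      exact ih fun i hi => hs i (Nat.lt_succ_of_lt hi)

end fail

/-! ### Failure probability of the audits within a round. -/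

section rounds

universe u
variable {X : Type u} {k nH nL : ℕ} {W : World X k nH nL} {s : State X}

/-- The probability, given the samples, that a call of the learner fails. -/
noncomputable def missProb [NeZero k] (W : World X k nH nL) (η : ℝ) (q : Predictor X k)
    (S : List (X × Fin k × Bool)) (l : Fin nL) (b : Bool) : ENNReal :=
  prob (W.learner.hyp W.problem.rho η
    ((S.take (W.learner.size W.problem.rho η)).map (W.problem.costExample q l b)))
    (W.problem.missed q l b)

/-- Outside the event `missed`, a hypothesis of signed error at least `ε` would make the returned
one have at least `ε/2`, contradicting the rejection by its audit. That audit is deterministic given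
an accurate sample, so only the learner contributes to the failure probability. -/
theorem fail_tryLearner [NeZero k] {η : ℝ} {T : ℕ} {us : List (Update nH nL)}
    {S : List (X × Fin k × Bool)} {l : Fin nL} (b : Bool) (hl0 : 0 < W.problem.lmax)
    (he : 0 < W.problem.eps) (h : Auditing W η T us S s) (hS : 0 < S.length)
    (hacc : W.problem.Accurate (W.problem.boost (1 / 8) us) S)
    (hm : W.learner.size W.problem.rho η ≤ S.length) (hl : s.N 21 0 0 = l) :
    fail W (tryLearner b) s (fun s' => Auditing W η T us S s' ∧ (s'.N 16 0 0 = 0 →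
      s.N 16 0 0 = 0 ∧ ∀ i, sgn b * W.problem.err (W.problem.boost (1 / 8) us) (some i) l <
        W.problem.eps)) ≤ missProb W η (W.problem.boost (1 / 8) us) S l b := by
  classical
  set q := W.problem.boost (1 / 8) us with hq
  rw [tryLearner]
  refine fail_seq_post (post_prepare b h.toReady hl hm).with_agree fun s₁ ⟨h1, A1⟩ => ?_
  have a1 : Auditing W η T us S s₁ := h.of_agree A1 (by cases b <;> decide)
    (by cases b <;> decide) (by cases b <;> decide)
  have hl1 : s₁.N 21 0 0 = l := by rw [A1.N 21 (by cases b <;> decide), hl]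
  have h16 : s₁.N 16 = s.N 16 := A1.N 16 (by cases b <;> decide)
  refine (fail_learnerCall (G := fun i => if i ∈ W.problem.missed q l b then 1 else 0)
    fun i s₂ A2 e18 => ?_).trans (le_of_eq ?_)
  swap
  · have e4 : (rv 4).eval s₁ = W.problem.rho := a1.hrho
    have e5 : (rv 5).eval s₁ = η := a1.heta
    rw [e4, e5, h1, missProb, prob_eq_wsum]
  by_cases hi : i ∈ W.problem.missed q l b
  · rw [if_pos hi]; exact fail_le_one
  rw [if_neg hi]
  refine fail_of_post ?_
  rw [post_seq, post_setN]
  set s₃ : State X := (s₂.setN _ _ _ _).tick _ with hs₃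
  have A3 : Agree [20] [] [] s₂ s₃ :=
    ⟨fun a ha => State.setN_N_of_ne _ (by simpa using ha) _ _ _, fun _ _ => rfl, fun _ _ => rfl⟩
  have e20 : s₃.N 20 0 0 = ruleCode (some i) := by
    simp [hs₃, State.setN_N, NExp.eval, e18, ruleCode]
  have a3 : Auditing W η T us S s₃ := (a1.of_agree A2 (by decide) (by decide) (by decide)).of_agree
    A3 (by decide) (by decide) (by decide)
  have h16' : s₃.N 16 = s.N 16 := by rw [A3.N 16 (by decide), A2.N 16 (by decide), h16]
  clear_value s₃
  refine (post_audit (r := some i) (l := l) hl0 he a3 hS hacc e20 ?_).mono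
    fun s' ⟨k1, k2⟩ => ⟨k1, fun h0 => ?_⟩
  · rw [A3.N 21 (by decide), A2.N 21 (by decide), hl1]
  · obtain ⟨k3, k4⟩ := k2 h0
    refine ⟨by rwa [h16'] at k3, fun j => ?_⟩
    by_contra hj
    refine hi ⟨⟨j, not_lt.1 hj⟩, fun hc => absurd (hc.trans (le_abs_self _)) (not_le.2 ?_)⟩
    rwa [abs_mul, abs_sgn, one_mul]

/-- The rule `f_ℓ` is audited directly; hypotheses need one call for each sign of the error, and
together the calls bound its absolute value. -/
theorem fail_auditLoss [NeZero k] {η : ℝ} {T : ℕ} {us : List (Update nH nL)}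
    {S : List (X × Fin k × Bool)} {l : Fin nL} (hl0 : 0 < W.problem.lmax)
    (he : 0 < W.problem.eps) (h : Auditing W η T us S s) (hS : 0 < S.length)
    (hacc : W.problem.Accurate (W.problem.boost (1 / 8) us) S)
    (hm : W.learner.size W.problem.rho η ≤ S.length) (hl : s.N 15 0 0 = l) :
    fail W auditLoss s (fun s' => Auditing W η T us S s' ∧ (s'.N 16 0 0 = 0 →
      s.N 16 0 0 = 0 ∧ ∀ r, |W.problem.err (W.problem.boost (1 / 8) us) r l| <
        W.problem.eps)) ≤ missProb W η (W.problem.boost (1 / 8) us) S l true +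
          missProb W η (W.problem.boost (1 / 8) us) S l false := by
  set q := W.problem.boost (1 / 8) us with hq
  rw [auditLoss]
  refine fail_seq_post (R := fun s' => Auditing W η T us S s' ∧ s'.N 16 = s.N 16 ∧
    s'.N 21 0 0 = l) ?_ fun s₁ ⟨a1, h1, l1⟩ => ?_
  · rw [post_setN]
    refine ⟨h.of_agree (wN := [21]) (wR := []) (wP := []) ⟨fun a ha => ?_, fun _ _ => rfl,
      fun _ _ => rfl⟩ (by decide) (by decide) (by decide), ?_, ?_⟩
    · exact State.setN_N_of_ne _ (by simpa using ha) _ _ _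
    · rw [State.tick_N]; exact State.setN_N_of_ne _ (by norm_num) _ _ _
    · simp [State.setN_N, NExp.eval, hl]
  refine fail_seq_post (R := fun s' => Auditing W η T us S s' ∧ s'.N 16 = s.N 16 ∧
    s'.N 21 0 0 = l ∧ s'.N 20 0 0 = ruleCode (none : Option (Fin nH))) ?_
    fun s₂ ⟨a2, h2, l2, r2⟩ => ?_
  · rw [post_setN]
    refine ⟨a1.of_agree (wN := [20]) (wR := []) (wP := []) ⟨fun a ha => ?_, fun _ _ => rfl,
      fun _ _ => rfl⟩ (by decide) (by decide) (by decide), ?_, ?_, ?_⟩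
    · exact State.setN_N_of_ne _ (by simpa using ha) _ _ _
    · rw [← h1, State.tick_N]; exact State.setN_N_of_ne _ (by norm_num) _ _ _
    · simp [State.setN_N, l1]
    · simp [State.setN_N, NExp.eval, ruleCode]
  refine fail_seq_post (post_audit (r := none) hl0 he a2 hS hacc r2 l2).with_agree
    fun s₃ ⟨⟨a3, h3⟩, A3⟩ => ?_
  have l3 : s₃.N 21 0 0 = l := by rw [A3.N 21 (by decide), l2]
  refine fail_seq (fail_with_post (fail_tryLearner true hl0 he a3 hS hacc hm l3)
    (post_agree _ _ _)) fun s₄ ⟨⟨a4, h4⟩, A4⟩ => ?_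
  have l4 : s₄.N 21 0 0 = l := by rw [A4.N 21 (by decide), l3]
  refine fail_mono (fail_tryLearner false hl0 he a4 hS hacc hm l4) fun s₅ ⟨a5, h5⟩ =>
    ⟨a5, fun h0 => ?_⟩
  -- Since the flag never falls during the audits, being down at the end it was down after each of
  -- them.
  obtain ⟨z4, e5⟩ := h5 h0
  obtain ⟨z3, e4⟩ := h4 z4
  obtain ⟨z2, e3⟩ := h3 z3
  refine ⟨by rwa [h2] at z2, fun r => ?_⟩
  cases r with
  | none => linarith
  | some i =>
    have := e4 i
    have := e5 i
    simp only [sgn] at *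
    rw [abs_lt]
    constructor
    · simp at *; linarith
    · simp at *; linarith

theorem fail_auditAll [NeZero k] {η : ℝ} {T : ℕ} {us : List (Update nH nL)}
    {S : List (X × Fin k × Bool)} (hl0 : 0 < W.problem.lmax)
    (he : 0 < W.problem.eps) (h : Auditing W η T us S s) (hS : 0 < S.length)
    (hacc : W.problem.Accurate (W.problem.boost (1 / 8) us) S)
    (hm : W.learner.size W.problem.rho η ≤ S.length) :
    fail W auditAll s (fun s' => Auditing W η T us S s' ∧ (s'.N 16 0 0 = 0 →
      ∀ r l, |W.problem.err (W.problem.boost (1 / 8) us) r l| < W.problem.eps)) ≤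
      ∑ l, (missProb W η (W.problem.boost (1 / 8) us) S l true +
          missProb W η (W.problem.boost (1 / 8) us) S l false) := by
  set q := W.problem.boost (1 / 8) us with hq
  have hn : (nv 4).eval s = nL := h.hnL
  have key := fail_loop (W := W) (c := auditLoss) (v := 15) (n := nv 4) (s := s)
    (fun i s' => Auditing W η T us S s' ∧ (s'.N 16 0 0 = 0 →
      ∀ r (l : Fin nL), (l : ℕ) < i → |W.problem.err q r l| < W.problem.eps))
    (fun i => if hi : i < nL then missProb W η q S ⟨i, hi⟩ true + missProb W η q S ⟨i, hi⟩ false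
      else 0)
    ⟨h.of_agree (wN := []) (wR := []) (wP := []) (agree_of_eq rfl rfl rfl) (by simp) (by simp)
      (by simp), by simp⟩ ?_
  · rw [hn, Finset.sum_range] at key
    simp only [Fin.is_lt, dite_true, Fin.eta] at key
    exact fail_mono key fun s' ⟨h1, h2⟩ => ⟨h1, fun h0 r l => h2 h0 r l trivial⟩
  · intro i hi s' ⟨a1, h1⟩
    rw [hn] at hi
    rw [dif_pos hi]
    have A : Agree [15] [] [] s' ((s'.setN 15 0 0 i).tick 1) :=
      ⟨fun a ha => State.setN_N_of_ne _ (by simpa using ha) _ _ _, fun _ _ => rfl, fun _ _ => rfl⟩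
    refine fail_mono (fail_auditLoss (l := ⟨i, hi⟩) hl0 he
      (a1.of_agree A (by decide) (by decide) (by decide)) hS hacc hm (by simp [State.setN_N]))
      fun s'' ⟨a2, h2⟩ => ⟨a2, fun h0 r l hl => ?_⟩
    obtain ⟨z, e⟩ := h2 h0
    rcases Nat.lt_succ_iff_lt_or_eq.1 hl with hl | hl
    · exact h1 (by rwa [A.N 16 (by decide)] at z) r l hl
    · rw [show l = ⟨i, hi⟩ from Fin.ext hl]; exact e r

end rounds

section rounds

universe u
variable {X : Type u} {k nH nL : ℕ} {W : World X k nH nL} {s : State X}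

/-! ### One round -/

/-- Passing from memory states to samples. As `g` and `G` are arbitrary, the induction can peel off
the last draw and treat its average as the new function of the shorter sample; `iid` also appends at
the end. -/
theorem wsum_rounds_draw [NeZero k] {n : ℕ} {g : State X → ENNReal} {G : List
    (X × Fin k × Bool) → ENNReal}
    {s₀ : State X} (h : ∀ S s', S.length = n → Stored s' S → Agree [12, 10, 11] [] [0] s₀ s' →
      g s' ≤ G S) :
    wsum (rounds (fun i s' => run W (.draw 0 10 11 (nv 12)) ((s'.setN 12 0 0 i).tick 1)) s₀ n) g ≤
      wsum (iid W.problem.rct n) G := by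
  induction n generalizing g G with
  | zero =>
    rw [rounds, iid, wsum_pure, wsum_pure]
    exact h [] s₀ rfl (fun j hj => absurd hj (by simp)) (agree_of_eq rfl rfl rfl)
  | succ n ih =>
    rw [rounds, wsum_bind, wsum_iid_succ]
    refine ih fun S s' hS hst hA => ?_
    rw [run, wsum_map]
    refine wsum_mono fun z => h _ _ (by simp [hS]) ?_ ?_
    · intro j hj
      have e12 : (nv 12).eval ((s'.setN 12 0 0 n).tick 1) = n := by simp [NExp.eval, State.setN_N]
      simp only [State.tick_N, State.tick_P, e12]
      rcases Nat.lt_or_ge j n with hjn | hjn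
      · have hj' : j < S.length := by omega
        obtain ⟨h1, h2, h3⟩ := hst j hj'
        rw [List.getElem_append_left hj', ← h1, ← h2, ← h3]
        simp [State.setN_N, State.setP_P, hjn.ne]
      · have : j = S.length := by simp at hj; omega
        subst this
        simp [State.setN_N, State.setP_P, hS]
    · refine ⟨fun a ha => ?_, fun a ha => ?_, fun a ha => ?_⟩
      · rw [← hA.N a ha]
        funext i j
        simp at ha
        simp [State.setN_N, ha]
      · rw [← hA.R a ha]; rfl
      · rw [← hA.P a ha]
        funext i
        simp at ha
        simp [State.setP_P, ha]

/-- The failure bound for the rest of the round may depend on the sample drawn; what counts is its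
mean over i.i.d. samples. -/
theorem fail_drawAll [NeZero k] {d : Cmd} {Q : State X → Prop} {G : List
    (X × Fin k × Bool) → ENNReal}
    (h : ∀ S s', S.length = s.N 7 0 0 → Stored s' S → Agree [12, 10, 11] [] [0] s s' →
      fail W d s' Q ≤ G S) :
    fail W (.seq drawAll d) s Q ≤ wsum (iid W.problem.rct (s.N 7 0 0)) G := by
  refine le_trans (le_of_eq (wsum_bind _ _ _)) ?_
  exact wsum_rounds_draw (s₀ := s.tick (1 + (nv 7).cost)) fun S s' h1 h2 h3 =>
    h S s' h1 h2 ⟨h3.N, h3.R, h3.P⟩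

theorem post_predictAll [NeZero k] {η : ℝ} {T : ℕ} {us : List (Update nH nL)}
    {S : List (X × Fin k × Bool)} (hP : Params W η T S.length s) (hS : Stored s S)
    (ho : s.Outputs us) :
    Post W predictAll s (Ready W η T (W.problem.boost (1 / 8) us) S) := by
  set q := W.problem.boost (1 / 8) us with hq
  have main : Post W predictAll s fun s' => ∀ j < S.length, ∀ a : Fin k,
      s'.R 6 j a = q (s.P 0 j) a := by
    refine post_loop_agree (fun i s' => ∀ j < i, ∀ a : Fin k, s'.R 6 j a = q (s.P 0 j) a)
      (by simp) (fun i hi s' hJ t ht hA hv => ?_) (fun s' h => by simpa [NExp.eval, hP.hM] using h)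
    have Pt : Params W η T S.length t := hP.of_agree hA (by decide) (by decide)
    have t6 : t.R 6 = s'.R 6 := by rw [ht]; rfl
    refine (post_predict (us := us) Pt.hk Pt.heps Pt.hlmax ?_).mono fun s₁ ⟨h1, h2⟩ j hj a => ?_
    · rw [outputs_iff] at ho ⊢
      rwa [hA.N 0 (by decide), hA.N 1 (by decide)]
    · rw [hv] at h1 h2
      rcases Nat.lt_succ_iff_lt_or_eq.1 hj with hj | rfl
      · rw [h2 j hj.ne, t6, hJ j hj]
      · rw [h1, hA.P 0 (by decide)]
  refine main.with_agree.mono fun s' ⟨h, A⟩ => ⟨hP.of_agree A (by decide) (by decide), ?_, ?_⟩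
  · unfold Stored
    rwa [A.P 0 (by decide), A.N 10 (by decide), A.N 11 (by decide)]
  · rwa [A.P 0 (by decide)]

/-- The situation after `i` rounds. -/
structure Running [NeZero k] (W : World X k nH nL) (η : ℝ) (T M i : ℕ) (s : State X) : Prop
    extends Params W η T M s where
  progress : (s.N 8 0 0 = 0 ∧ ∃ us : List (Update nH nL), s.Outputs us ∧
      W.problem.IsPartialRun (1 / 8) us ∧ us.length = i) ∨
    (s.N 8 0 0 = 1 ∧ ∃ us : List (Update nH nL), s.Outputs us ∧
      W.problem.IsPOIBoostRun (1 / 8) us)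

theorem Running.of_agree [NeZero k] {η : ℝ} {T M i : ℕ} {s s' : State X} {wN wR wP : List ℕ}
    (h : Running W η T M i s) (hA : Agree wN wR wP s s')
    (hN : ∀ a ∈ [0, 1, 2, 4, 5, 6, 7, 8], a ∉ wN)
    (hR : ∀ a ∈ [0, 1, 3, 4, 5], a ∉ wR) : Running W η T M i s' where
  toParams := h.toParams.of_agree hA (fun a ha => hN a (by simp at ha ⊢; omega)) hR
  progress := by
    have := h.progress
    simp only [outputs_iff] at this ⊢
    rwa [hA.N 8 (hN 8 (by decide)), hA.N 0 (hN 0 (by decide)), hA.N 1 (hN 1 (by decide))]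

theorem post_roundEnd [NeZero k] {η : ℝ} {T : ℕ} {us : List (Update nH nL)}
    {S : List (X × Fin k × Bool)} (h : Auditing W η T us S s)
    (hdone : s.N 16 0 0 = 0 → ∀ r l,
      |W.problem.err (W.problem.boost (1 / 8) us) r l| < W.problem.eps)
    (hrun : W.problem.IsPartialRun (1 / 8) us) (h8 : s.N 8 0 0 = 0) :
    Post W roundEnd s (Running W η T S.length (us.length + 1)) := by
  have ho := outputs_iff.1 h.out
  have hp : Post W roundEnd s (Params W η T S.length) :=
    (post_agree W roundEnd s).mono fun s' A => h.toParams.of_agree A (by decide) (by decide)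
  have main : Post W roundEnd s fun s' =>
    (s'.N 8 0 0 = 0 ∧ ∃ us' : List (Update nH nL), s'.Outputs us' ∧
      W.problem.IsPartialRun (1 / 8) us' ∧ us'.length = us.length + 1) ∨
    (s'.N 8 0 0 = 1 ∧ ∃ us' : List (Update nH nL), s'.Outputs us' ∧
      W.problem.IsPOIBoostRun (1 / 8) us') := by
    rw [roundEnd, post_ite, post_setN, post_setN]
    refine ⟨fun hb => .inl ⟨by simp [State.setN_N, h8], ?_⟩,
      fun hb => .inr ⟨by simp [State.setN_N, NExp.eval], us, ?_, hrun, ?_⟩⟩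
    · have h16 : s.N 16 0 0 ≠ 0 := by
        simp only [BExp.holds, NExp.eval] at hb
        omega
      obtain ⟨-, u, hu, herr⟩ := h.found.resolve_left h16
      refine ⟨us ++ [u], outputs_iff.2 ⟨?_, fun t ht => ?_⟩,
        isPartialRun_append.2 ⟨hrun, herr⟩, by simp⟩
      · simp [State.setN_N, NExp.eval, ho.1]
      · have e : ∀ j, (((s.tick (1 + (BExp.natLE (.lit 1) (nv 16)).cost)).setN 0
            (NExp.eval (s.tick (1 + (BExp.natLE (.lit 1) (nv 16)).cost)) (.lit 0))
            (NExp.eval (s.tick (1 + (BExp.natLE (.lit 1) (nv 16)).cost)) (.lit 0))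
            (NExp.eval (s.tick (1 + (BExp.natLE (.lit 1) (nv 16)).cost))
              (.add (nv 0) (.lit 1)))).tick
            (1 + (NExp.lit 0).cost + (NExp.lit 0).cost + (NExp.add (nv 0) (.lit 1)).cost)).N 1 t j =
            s.N 1 t j := fun j => by simp [State.setN_N]
        rw [e, e, e]
        rcases Nat.lt_or_ge t us.length with htu | htu
        · rw [List.getElem_append_left htu]
          exact ho.2 t htu
        · obtain rfl : t = us.length := by simp at ht; omega
          simpa [Holds] using hu
    · rw [outputs_iff]
      simpa [State.setN_N] using ho
    · rintro ⟨r, l, hrl⟩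
      refine absurd hrl (not_le.2 (hdone ?_ r l))
      simp only [BExp.holds, NExp.eval] at hb
      omega
  exact (hp.and main).mono fun s' ⟨h1, h2⟩ => ⟨h1, h2⟩

/-- The updates `us` are in memory before the draw, so relative to the new sample the predictor is
fixed and both sampling bounds apply. The learner's answers depend on the same sample as the
estimates; this is harmless because accuracy covers all hypotheses simultaneously. -/
theorem fail_boostRound [NeZero k] {η : ℝ} {T M i : ℕ} (hB : W.problem.Bounded) (hl0
    : 0 < W.problem.lmax)
    (he : 0 < W.problem.eps) (hA : W.learner.IsCostSensitiveWeakLearner W.problem.H)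
    (hη : 0 < η) (hη1 : η < 1) (hM : 0 < M) (hm : W.learner.size W.problem.rho η ≤ M)
    (h : Running W η T M i s) :
    fail W boostRound s (Running W η T M (i + 1)) ≤
      ENNReal.ofReal ((nH + 1) * nL * (2 * Real.exp (-(M * W.problem.rho ^ 2 / 1024)))) +
        ∑ _l : Fin nL, (ENNReal.ofReal η + ENNReal.ofReal η) := by
  classical
  have hN7 := h.hM
  by_cases hdone : (BExp.natLE (.lit 1) (nv 8)).holds s
  · refine (fail_of_post ?_).trans bot_le
    rw [boostRound, post_ite]
    refine ⟨fun _ => ?_, fun h' => absurd hdone h'⟩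
    rw [post_skip]
    simp only [BExp.holds, NExp.eval] at hdone
    refine ⟨h.toParams.of_agree (wN := []) (wR := []) (wP := []) (agree_of_eq rfl rfl rfl)
      (by simp) (by simp), ?_⟩
    rcases h.progress with ⟨h8, -⟩ | h8
    · omega
    · exact .inr h8
  have hrun : run W boostRound s = run W (.seq (.setN 16 (.lit 0) (.lit 0) (.lit 0))
      (.seq drawAll (.seq predictAll (.seq auditAll roundEnd))))
      (s.tick (1 + (BExp.natLE (.lit 1) (nv 8)).cost)) := by
    rw [boostRound]
    exact if_neg hdone
  simp only [BExp.holds, NExp.eval, not_le, Nat.lt_one_iff] at hdone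
  obtain ⟨-, us, ho, hus, hlen⟩ := h.progress.resolve_right fun h' => by rw [h'.1] at hdone; omega
  set q := W.problem.boost (1 / 8) us with hq
  rw [fail, hrun]
  refine fail_seq_post (R := fun s' => Agree [16] [] [] s s' ∧ s'.N 16 0 0 = 0) ?_
    fun s₁ ⟨A1, z1⟩ => ?_
  · rw [post_setN]
    exact ⟨⟨fun a ha => State.setN_N_of_ne _ (by simpa using ha) _ _ _, fun _ _ => rfl,
      fun _ _ => rfl⟩, by simp [State.setN_N, NExp.eval]⟩
  have e7 : s₁.N 7 0 0 = M := by rw [A1.N 7 (by decide), hN7]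
  -- For a fixed sample: failure is certain if the estimates are inaccurate, otherwise it is at most
  -- the sum of the learner's failure probabilities.
  refine (fail_drawAll (G := fun S => (if W.problem.Accurate q S then 0 else 1) +
    ∑ l, (missProb W η q S l true + missProb W η q S l false)) fun S s₂ hS hst A2 => ?_).trans ?_
  · rw [e7] at hS
    by_cases hacc : W.problem.Accurate q S
    swap
    · rw [if_neg hacc]; exact fail_le_one.trans le_self_add
    rw [if_pos hacc, zero_add]
    subst hS
    have A12 := A1.trans A2
    have P2 : Params W η T S.length s₂ := h.toParams.of_agree A12 (by decide) (by decide)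
    have o2 : s₂.Outputs us := by
      rw [outputs_iff] at ho ⊢
      rwa [A12.N 0 (by decide), A12.N 1 (by decide)]
    refine fail_seq_post (post_predictAll P2 hst o2).with_agree fun s₃ ⟨R3, A3⟩ => ?_
    have a3 : Auditing W η T us S s₃ := by
      refine ⟨R3, ?_, .inl ?_⟩
      · rw [outputs_iff] at o2 ⊢
        rwa [A3.N 0 (by decide), A3.N 1 (by decide)]
      · rw [A3.N 16 (by decide), A2.N 16 (by decide), z1]
    refine post_seq_fail (fail_with_post (fail_auditAll hl0 he a3 hM hacc hm) (post_agree _ _ _))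
      fun s₄ ⟨⟨a4, h4⟩, A4⟩ => ?_
    rw [← hlen]
    refine post_roundEnd a4 h4 hus ?_
    rw [A4.N 8 (by decide), A3.N 8 (by decide), A12.N 8 (by decide)]
    exact hdone
  · rw [e7, wsum_add, wsum_finset_sum]
    refine add_le_add (wsum_not_accurate_le hB hl0 he q M) (Finset.sum_le_sum fun l _ => ?_)
    rw [wsum_add]
    exact add_le_add (wsum_missed_le hB hl0 he hA hη hη1 q l true hm)
      (wsum_missed_le hB hl0 he hA hη hη1 q l false hm)

/-- The main loop. -/
theorem fail_boostLoop [NeZero k] {η : ℝ} {T M : ℕ} (hB : W.problem.Bounded) (hl0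
    : 0 < W.problem.lmax)
    (he : 0 < W.problem.eps) (hA : W.learner.IsCostSensitiveWeakLearner W.problem.H)
    (hη : 0 < η) (hη1 : η < 1) (hM : 0 < M) (hm : W.learner.size W.problem.rho η ≤ M)
    (h : Running W η T M 0 s) :
    fail W (.loop 9 (nv 5) boostRound) s (Running W η T M T) ≤
      T * (ENNReal.ofReal ((nH + 1) * nL * (2 * Real.exp (-(M * W.problem.rho ^ 2 / 1024)))) +
        ∑ _l : Fin nL, (ENNReal.ofReal η + ENNReal.ofReal η)) := by
  have hn : (nv 5).eval s = T := h.hT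
  have key := fail_loop (W := W) (c := boostRound) (v := 9) (n := nv 5) (s := s)
    (Running W η T M) (fun _ => ENNReal.ofReal ((nH + 1) * nL *
      (2 * Real.exp (-(M * W.problem.rho ^ 2 / 1024)))) +
        ∑ _l : Fin nL, (ENNReal.ofReal η + ENNReal.ofReal η))
    (h.of_agree (wN := []) (wR := []) (wP := []) (agree_of_eq rfl rfl rfl) (by simp) (by simp))
    fun i _ s' h' => fail_boostRound hB hl0 he hA hη hη1 hM hm
      (h'.of_agree (wN := [9]) (wR := []) (wP := [])
        ⟨fun a ha => State.setN_N_of_ne _ (by simpa using ha) _ _ _, fun _ _ => rfl,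
          fun _ _ => rfl⟩ (by decide) (by decide))
  rw [hn] at key
  rwa [Finset.sum_const, Finset.card_range, nsmul_eq_mul] at key

/-- After more rounds than there can be updates the run is complete. -/
theorem Running.complete [NeZero k] {η : ℝ} {T M : ℕ} (hB : W.problem.Bounded) (hl0
    : 0 < W.problem.lmax)
    (he : 0 < W.problem.eps)
    (hT : 64 * k * (W.problem.lmax * W.problem.lmax) / (W.problem.eps * W.problem.eps) < (T : ℝ))
    (h : Running W η T M T s) : ∃ us : List (Update nH nL),
      s.Outputs us ∧ W.problem.IsPOIBoostRun (1 / 8) us ∧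
      W.problem.IsPOI (W.problem.boost (1 / 8) us) W.problem.eps ∧
      W.problem.IsDOI (W.problem.boost (1 / 8) us) W.problem.eps ∧
      W.problem.IsOmnipredictor (W.problem.boost (1 / 8) us) (2 * W.problem.eps) := by
  rcases h.progress with ⟨-, us, -, hus, hlen⟩ | ⟨-, us, ho, hus⟩
  · have := length_mul_le hB hl0 he hus
    rw [hlen] at this
    linarith
  · have herr : ∀ r l, |W.problem.err (W.problem.boost (1 / 8) us) r l| < W.problem.eps :=
      fun r l => not_le.1 fun hc => hus.2 ⟨r, l, hc⟩
    have h1 := isPOI_of_err_lt herr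
    have h2 := isDOI_of_err_lt herr
    exact ⟨us, ho, hus, h1, h2, isOmnipredictor_of_isPOI_of_isDOI hB h1 h2⟩

/-! ### The parameters -/

/-- The number of rounds. -/
noncomputable def numRounds (P : Problem X k nH nL) : ℕ :=
  ⌈64 * k * (P.lmax * P.lmax) / (P.eps * P.eps)⌉₊ + 1

/-- The failure probability allowed to one call of the learner. -/
noncomputable def callFail (P : Problem X k nH nL) (δ : ℝ) : ℝ := δ / (4 * nL * numRounds P)

/-- The number of samples that suffices for accurate estimates. -/
noncomputable def numAudit (P : Problem X k nH nL) (δ : ℝ) : ℕ :=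
  ⌈1024 / (P.rho * P.rho) * Real.log (8 * nH * nL * numRounds P / δ)⌉₊

/-- The number of samples in one round. -/
noncomputable def numSamples (W : World X k nH nL) (δ : ℝ) : ℕ :=
  W.learner.size W.problem.rho (callFail W.problem δ) + (numAudit W.problem δ + 1)

/-- Steps are counted by hand here, since `used_le` does not cover `ceil`; the two roundings account
for `numRounds` and `numAudit`, and the numerical constants are generous. -/
theorem post_setup [NeZero k] (W : World X k nH nL) (δ : ℝ) (x₀ : X) :
    Post W setup (initial W.problem δ x₀) fun s =>
      Running W (callFail W.problem δ) (numRounds W.problem) (numSamples W δ) 0 s ∧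
      s.N 0 0 0 = 0 ∧
      s.used ≤ ![numRounds W.problem + numAudit W.problem δ + 250, 0, 0] := by
  set s₀ := initial W.problem δ x₀ with hs₀
  have n2 : s₀.N 2 0 0 = k := rfl
  have n3 : s₀.N 3 0 0 = nH := rfl
  have n4 : s₀.N 4 0 0 = nL := rfl
  have n8 : s₀.N 8 0 0 = 0 := rfl
  have n0 : s₀.N 0 0 0 = 0 := rfl
  have r0 : s₀.R 0 0 0 = W.problem.eps := rfl
  have r1 : s₀.R 1 0 0 = W.problem.lmax := rfl
  have r2 : s₀.R 2 0 0 = δ := rfl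
  have t0 : s₀.time = 0 ∧ s₀.samples = 0 ∧ s₀.calls = 0 := ⟨rfl, rfl, rfl⟩
  clear_value s₀
  rw [setup, post_seq, post_setR]
  set s₁ : State X := (s₀.setR _ _ _ _).tick _ with hs₁
  have n1 : s₁.N = s₀.N := rfl
  have r13 : s₁.R 3 0 0 = W.problem.eps / (k * W.problem.lmax) := by
    simp [hs₁, State.setR_R, NExp.eval, RExp.eval, n2, r0, r1]
  have r1a : ∀ a, a ≠ 3 → s₁.R a = s₀.R a := fun a ha => State.setR_R_of_ne _ ha _ _ _
  have t1 : s₁.time ≤ 50 ∧ s₁.samples = 0 ∧ s₁.calls = 0 := by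
    refine ⟨?_, t0.2.1, t0.2.2⟩
    simp [hs₁, State.tick, State.setR, t0.1, NExp.cost, RExp.cost]
  clear_value s₁
  have hite : Post W (.ite (.realLE (rv 3) (.ofNat (.lit 1)))
        (.setR 4 (.lit 0) (.lit 0) (rv 3))
        (.setR 4 (.lit 0) (.lit 0) (.ofNat (.lit 1)))) s₁ fun s' =>
      s'.N = s₁.N ∧ s'.R 4 0 0 = W.problem.rho ∧ (∀ a, a ≠ 4 → s'.R a = s₁.R a) ∧
      s'.time ≤ 100 ∧ s'.samples = 0 ∧ s'.calls = 0 := by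
    rw [post_ite, post_setR, post_setR]
    simp only [BExp.holds, RExp.eval, NExp.eval, r13, Nat.cast_one, State.tick_R, State.tick_N,
      State.setR_N]
    refine ⟨fun h => ⟨trivial, ?_, fun a ha => State.setR_R_of_ne _ ha _ _ _, ?_, t1.2⟩,
      fun h => ⟨trivial, ?_, fun a ha => State.setR_R_of_ne _ ha _ _ _, ?_, t1.2⟩⟩
    · rw [Problem.rho, min_eq_left h]; simp [State.setR_R]
    · have := t1.1
      simp [State.tick, State.setR, NExp.cost, RExp.cost, BExp.cost]
      omega
    · rw [Problem.rho, min_eq_right (not_le.1 h).le]; simp [State.setR_R]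
    · have := t1.1
      simp [State.tick, State.setR, NExp.cost, RExp.cost, BExp.cost]
      omega
  rw [post_seq]
  refine hite.mono fun s₂ ⟨n2', r4, r2a, t2⟩ => ?_
  have q0 : s₂.R 0 0 0 = W.problem.eps := by rw [r2a 0 (by simp), r1a 0 (by simp), r0]
  have q1 : s₂.R 1 0 0 = W.problem.lmax := by rw [r2a 1 (by simp), r1a 1 (by simp), r1]
  have q2 : s₂.R 2 0 0 = δ := by rw [r2a 2 (by simp), r1a 2 (by simp), r2]
  have q3 : s₂.R 3 0 0 = W.problem.eps / (k * W.problem.lmax) := by rw [r2a 3 (by simp), r13]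
  rw [← n1, ← n2'] at n0 n2 n3 n4 n8
  clear r0 r1 r2 n1 r13 r1a t1 r2a n2' hite
  rw [post_seq, post_ceil]
  set s₃ : State X := (s₂.setN _ _ _ _).tick _ with hs₃
  have e5 : s₃.N 5 0 0 + 1 = numRounds W.problem := by
    simp [hs₃, State.setN_N, NExp.eval, RExp.eval, n2, q0, q1, numRounds]
  have n3a : ∀ a, a ≠ 5 → s₃.N a = s₂.N a := fun a ha => State.setN_N_of_ne _ ha _ _ _
  have r3a : s₃.R = s₂.R := rfl
  have t3 : s₃.time + 1 ≤ 150 + numRounds W.problem ∧ s₃.samples = 0 ∧ s₃.calls = 0 := by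
    refine ⟨?_, t2.2.1, t2.2.2⟩
    have := t2.1
    simp [hs₃, State.tick, State.setN, NExp.eval, RExp.eval, n2, q0, q1, NExp.cost, RExp.cost,
      numRounds]
    omega
  clear_value s₃
  rw [post_seq, post_setN, post_seq, post_setR, post_seq, post_learnerSize, post_seq, post_ceil,
    post_setN]
  have hrun : ∀ t : State X, Params W (callFail W.problem δ) (numRounds W.problem) (numSamples W δ)
      t → t.N 8 0 0 = 0 → t.N 0 0 0 = 0 →
      Running W (callFail W.problem δ) (numRounds W.problem) (numSamples W δ) 0 t :=
    fun t h h8 h0 => ⟨h, .inl ⟨h8, [], outputs_iff.2 ⟨h0, by simp⟩,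
      fun t ht => absurd ht (by simp), rfl⟩⟩
  have m0 : s₃.N 0 0 0 = 0 := by rw [n3a 0 (by simp), n0]
  have m2 : s₃.N 2 0 0 = k := by rw [n3a 2 (by simp), n2]
  have m3 : s₃.N 3 0 0 = nH := by rw [n3a 3 (by simp), n3]
  have m4 : s₃.N 4 0 0 = nL := by rw [n3a 4 (by simp), n4]
  have m8 : s₃.N 8 0 0 = 0 := by rw [n3a 8 (by simp), n8]
  have e5' : ((s₃.N 5 0 0 : ℝ) + 1) = numRounds W.problem := by exact_mod_cast e5
  rw [← r3a] at q0 q1 q2 q3 r4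
  refine ⟨hrun _ ⟨?_, ?_, ?_, ?_, ?_, ?_, ?_, ?_, ?_, ?_⟩ ?_ ?_, ?_, ?_⟩
  · simp [State.setN_N, m2]
  · simp [State.setN_N, m4]
  · simp [State.setN_N, NExp.eval, e5]
  · simp [State.setN_N, State.setR_R, NExp.eval, RExp.eval, e5', m4, q2, r4, callFail]
  · simp [State.setN_N, State.setR_R, NExp.eval, RExp.eval, e5', m3, m4, q2, r4, callFail,
      numSamples, numAudit]
  · simp [State.setR_R, q0]
  · simp [State.setR_R, q1]
  · simp [State.setR_R, q3]
  · simp [State.setR_R, r4]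
  · simp [State.setN_N, State.setR_R, NExp.eval, RExp.eval, e5', m4, q2, callFail]
  · simp [State.setN_N, m8]
  · simp [State.setN_N, m0]
  · simp [State.setN_N, m0]
  · have h1 := t3.1
    intro i
    fin_cases i
    · simp [State.used, State.tick, State.setN, State.setR, NExp.eval, RExp.eval, e5',
        m3, m4, q2, r4, NExp.cost, RExp.cost, numAudit]
      omega
    · simpa [State.used, State.tick, State.setN, State.setR] using t3.2.1
    · simpa [State.used, State.tick, State.setN, State.setR] using t3.2.2

end rounds

/-! ## Resource bounds -/

section polynomials

/-- Natural coefficients make polynomials monotone on nonnegative arguments; this is why all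
resource bounds are polynomials over `ℕ`. -/
theorem aeval_mono {ι : Type*} (p : MvPolynomial ι ℕ) {x y : ι → ℝ} (hx : ∀ i, 0 ≤ x i)
    (hxy : ∀ i, x i ≤ y i) : MvPolynomial.aeval x p ≤ MvPolynomial.aeval y p := by
  rw [MvPolynomial.aeval_def, MvPolynomial.aeval_def, MvPolynomial.eval₂_eq,
    MvPolynomial.eval₂_eq]
  refine Finset.sum_le_sum fun d _ => mul_le_mul_of_nonneg_left ?_ (by simp)
  exact Finset.prod_le_prod (fun i _ => pow_nonneg (hx i) _)
    fun i _ => pow_le_pow_left₀ (hx i) (hxy i) _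

theorem cast_eval_le {ι : Type*} (p : MvPolynomial ℕ ℕ) {β : ℕ → ℕ} {x : ι → ℝ}
    {g : ℕ → MvPolynomial ι ℕ} (h : ∀ n, (β n : ℝ) ≤ MvPolynomial.aeval x (g n)) :
    ((MvPolynomial.eval β p : ℕ) : ℝ) ≤ MvPolynomial.aeval x (MvPolynomial.bind₁ g p) := by
  have h1 : ((MvPolynomial.eval β p : ℕ) : ℝ) = MvPolynomial.aeval (fun n => (β n : ℝ)) p := by
    rw [MvPolynomial.aeval_def, MvPolynomial.eval₂_eq, MvPolynomial.eval_eq]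
    push_cast
    rfl
  rw [h1, MvPolynomial.aeval_bind₁]
  exact aeval_mono p (fun n => Nat.cast_nonneg _) h

end polynomials

section resources

universe u
variable {X : Type u} {k nH nL : ℕ} {W : World X k nH nL} {s : State X}

/-- The resources used in one round outside of the audits. -/
noncomputable def roundPoly (i : Fin 3) : MvPolynomial ℕ ℕ :=
  (![20, 0, 0] : Fin 3 → MvPolynomial ℕ ℕ) i + drawAll.cost i + predictAll.cost i + roundEnd.cost i

/-- The resources used in one round for one loss. -/
noncomputable def auditPoly (i : Fin 3) : MvPolynomial ℕ ℕ :=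
  (![1, 0, 0] : Fin 3 → MvPolynomial ℕ ℕ) i + auditLoss.cost i

/-- The learner is called only inside the loop over losses. -/
theorem roundPoly_two : roundPoly 2 = 0 := by
  simp [roundPoly, drawAll, predictAll, predict, applyUpdate, ruleDec, loadVal, loadLoss,
    roundEnd, Cmd.cost]

/-- Audits draw no samples, so the sample bound carries no factor `|L|`. -/
theorem auditPoly_one : auditPoly 1 = 0 := by
  simp [auditPoly, auditLoss, audit, sumRule, record, tryLearner, prepare, ruleDec, loadVal,
    loadLoss, Cmd.cost]

/-- One call per sign of the error. -/
theorem auditPoly_two : auditPoly 2 = 2 := by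
  simp [auditPoly, auditLoss, audit, sumRule, record, tryLearner, prepare, ruleDec, loadVal,
    loadLoss, Cmd.cost]
  norm_num

/-- Bounds for the quantities on which the resources used depend. -/
noncomputable def bounds (W : World X k nH nL) (η : ℝ) (T M : ℕ) : ℕ → ℕ
  -- Indices as in `Cmd.cost`: `3`, `5`, `9`, `10` belong to the natural arrays `0`, `2`, `6`, `7`.
  -- The arrays `4` and `5`, controlling the loops over losses and rounds, are treated by hand.
  | 0 => W.tauH
  | 1 => W.tauL
  | 2 => W.learner.time W.problem.rho η
  | 3 => T
  | 5 => k
  | 9 => W.learner.size W.problem.rho η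
  | 10 => M
  | _ => 0

theorem simple_predictAll : predictAll.Simple [0, 2, 7] := by
  simp [predictAll, predict, applyUpdate, ruleDec, loadVal, loadLoss, Cmd.Simple]

theorem simple_auditLoss : auditLoss.Simple [2, 6, 7] := by
  simp [auditLoss, audit, sumRule, record, tryLearner, prepare, ruleDec, loadVal, loadLoss,
    Cmd.Simple]

theorem used_boostRound [NeZero k] {η : ℝ} {T M : ℕ} (hP : Params W η T M s) (h0 : s.N 0 0 0 ≤ T) :
    Post W boostRound s fun s' => ∀ i, s'.used i ≤ s.used i +
      (MvPolynomial.eval (bounds W η T M) (roundPoly i) +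
        nL * MvPolynomial.eval (bounds W η T M) (auditPoly i)) := by
  set β := bounds W η T M with hβ
  have hle : ∀ (t : State X) (c : Cmd) (A : List ℕ), Params W η T M t → t.N 0 0 0 ≤ T →
      c.Simple A → A ⊆ [0, 2, 6, 7] → (∀ a ∈ A, a ∉ c.wN) → 4 ∉ c.wR → 5 ∉ c.wR →
      Post W c t fun s' => ∀ i, s'.used i ≤ t.used i + MvPolynomial.eval β (c.cost i) := by
    intro t c A ht ht0 hc hA hw h4 h5
    refine used_le W β le_rfl le_rfl A c hc hw h4 h5 t (fun a ha => ?_) ?_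
    · have := hA ha
      simp only [List.mem_cons, List.not_mem_nil, or_false] at this
      rcases this with rfl | rfl | rfl | rfl
      · exact ht0
      · exact ht.hk.le
      · exact ht.hm.le
      · exact ht.hM.le
    · rw [ht.hrho, ht.heta]; exact le_rfl
  rw [boostRound, post_ite]
  refine ⟨fun _ => ?_, fun _ => ?_⟩
  · rw [post_skip]
    intro i
    fin_cases i <;>
      simp [State.used, State.tick, BExp.cost, NExp.cost, roundPoly] <;> omega
  · rw [post_seq, post_setN]
    set s₁ : State X := ((s.tick _).setN _ _ _ _).tick _ with hs₁
    have A1 : Agree [16] [] [] s s₁ := ⟨fun a ha => State.setN_N_of_ne _ (by simpa using ha) _ _ _,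
      fun _ _ => rfl, fun _ _ => rfl⟩
    have u1 : s₁.used = s.used + ![10, 0, 0] := by
      funext i
      fin_cases i <;> simp [hs₁, State.used, State.tick, State.setN, BExp.cost, NExp.cost]
    clear_value s₁
    have P1 : Params W η T M s₁ := hP.of_agree A1 (by decide) (by decide)
    have z1 : s₁.N 0 0 0 ≤ T := by rwa [A1.N 0 (by decide)]
    rw [post_seq]
    refine (hle s₁ drawAll [7] P1 z1 (by simp [drawAll, Cmd.Simple]) (by simp) (by decide)
      (by decide) (by decide)).with_agree.mono fun s₂ ⟨u2, A2⟩ => ?_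
    have P2 : Params W η T M s₂ := P1.of_agree A2 (by decide) (by decide)
    have z2 : s₂.N 0 0 0 ≤ T := by rwa [A2.N 0 (by decide)]
    rw [post_seq]
    refine (hle s₂ predictAll [0, 2, 7] P2 z2 simple_predictAll (by simp) (by decide)
      (by decide) (by decide)).with_agree.mono fun s₃ ⟨u3, A3⟩ => ?_
    have P3 : Params W η T M s₃ := P2.of_agree A3 (by decide) (by decide)
    have z3 : s₃.N 0 0 0 ≤ T := by rwa [A3.N 0 (by decide)]
    rw [post_seq]
    -- Here `|L|` appears as a factor instead of a polynomial variable.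
    have haudit : Post W auditAll s₃ _ := used_loop
      (B := fun i => MvPolynomial.eval β (auditLoss.cost i)) fun t A =>
      hle t auditLoss [2, 6, 7] (P3.of_agree A (by decide) (by decide))
        (by rwa [A.N 0 (by decide)]) simple_auditLoss (by simp) (by decide) (by decide) (by decide)
    refine haudit.with_agree.mono fun s₄ ⟨u4, A4⟩ => ?_
    have P4 : Params W η T M s₄ := P3.of_agree A4 (by decide) (by decide)
    have z4 : s₄.N 0 0 0 ≤ T := by rwa [A4.N 0 (by decide)]
    refine (hle s₄ roundEnd [] P4 z4 (by simp [roundEnd, Cmd.Simple]) (by simp) (by simp)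
      (by decide) (by decide)).mono fun s₅ u5 i => ?_
    have hn : (nv 4).eval s₃ = nL := P3.hnL
    rw [hn] at u4
    have v2 := u2 i
    have v3 := u3 i
    have v4 := u4 i
    have v5 := u5 i
    rw [u1] at v2
    have v1 : MvPolynomial.eval β ((![1, 0, 0] : Fin 3 → MvPolynomial ℕ ℕ) i) =
        (![1, 0, 0] : Fin 3 → ℕ) i := by fin_cases i <;> simp
    have v20 : MvPolynomial.eval β ((![20, 0, 0] : Fin 3 → MvPolynomial ℕ ℕ) i) =
        (![20, 0, 0] : Fin 3 → ℕ) i := by fin_cases i <;> simp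
    have e1 : MvPolynomial.eval β (auditPoly i) = (![1, 0, 0] : Fin 3 → ℕ) i +
        MvPolynomial.eval β (auditLoss.cost i) := by
      rw [auditPoly, map_add, v1]
    have e2 : MvPolynomial.eval β (roundPoly i) = (![20, 0, 0] : Fin 3 → ℕ) i +
        MvPolynomial.eval β (drawAll.cost i) + MvPolynomial.eval β (predictAll.cost i) +
        MvPolynomial.eval β (roundEnd.cost i) := by
      rw [roundPoly, map_add, map_add, map_add, v20]
    have e3 : (![10, 0, 0] : Fin 3 → ℕ) i + (![1 + (nv 4).cost, 0, 0] : Fin 3 → ℕ) i ≤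
        (![20, 0, 0] : Fin 3 → ℕ) i := by
      fin_cases i <;> simp [NExp.cost]
    rw [Pi.add_apply] at v2
    rw [e1, e2]
    omega

theorem used_poiBoost [NeZero k] (W : World X k nH nL) (δ : ℝ) (x₀ : X) :
    Post W poiBoost (initial W.problem δ x₀) fun s => ∀ i, s.used i ≤
      (![numRounds W.problem + numAudit W.problem δ + 255, 0, 0] : Fin 3 → ℕ) i +
      numRounds W.problem * ((![1, 0, 0] : Fin 3 → ℕ) i +
        (MvPolynomial.eval (bounds W (callFail W.problem δ) (numRounds W.problem)
          (numSamples W δ)) (roundPoly i) +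
        nL * MvPolynomial.eval (bounds W (callFail W.problem δ) (numRounds W.problem)
          (numSamples W δ)) (auditPoly i))) := by
  set η := callFail W.problem δ
  set T := numRounds W.problem
  set M := numSamples W δ
  set B : Fin 3 → ℕ := fun i => MvPolynomial.eval (bounds W η T M) (roundPoly i) +
    nL * MvPolynomial.eval (bounds W η T M) (auditPoly i) with hB
  rw [poiBoost, post_seq]
  refine (post_setup W δ x₀).mono fun s ⟨h1, h2, h3⟩ => ?_
  have hn : (nv 5).eval s = T := h1.hT
  -- A round adds at most one update, whether or not its audits were right, so the recorded list
  -- stays within `T` on every execution. This bounds the cost of replaying it.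
  refine post_loop (fun j s' => Params W η T M s' ∧ s'.N 0 0 0 ≤ j ∧
    ∀ i, s'.used i ≤ s.used i + (![4, 0, 0] : Fin 3 → ℕ) i +
      j * ((![1, 0, 0] : Fin 3 → ℕ) i + B i)) ⟨?_, ?_, fun i => ?_⟩ ?_ ?_
  · exact h1.toParams.of_agree (wN := []) (wR := []) (wP := []) (agree_of_eq rfl rfl rfl)
      (by simp) (by simp)
  · exact h2.le
  · fin_cases i <;> simp [State.used, State.tick, NExp.cost]
  · intro j hj s' ⟨P1, z1, u1⟩
    rw [hn] at hj
    set t : State X := (s'.setN 9 0 0 j).tick 1 with ht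
    have A : Agree [9] [] [] s' t := ⟨fun a ha => State.setN_N_of_ne _ (by simpa using ha) _ _ _,
      fun _ _ => rfl, fun _ _ => rfl⟩
    have Pt : Params W η T M t := P1.of_agree A (by decide) (by decide)
    have zt : t.N 0 0 0 ≤ j := by rwa [A.N 0 (by decide)]
    have ut : t.used = s'.used + ![1, 0, 0] := by
      funext i
      fin_cases i <;> simp [ht, State.used, State.tick, State.setN]
    clear_value t
    have hz : Post W boostRound t fun s'' => s''.N 0 0 0 ≤ j + 1 := by
      rw [boostRound, post_ite]
      refine ⟨fun _ => ?_, fun _ => ?_⟩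
      · rw [post_skip]; exact zt.trans (Nat.le_succ j)
      · simp only [post_seq, post_setN]
        refine (post_agree _ _ _).mono fun s₂ A2 => (post_agree _ _ _).mono fun s₃ A3 =>
          (post_agree _ _ _).mono fun s₄ A4 => ?_
        have z4 : s₄.N 0 0 0 ≤ j := by
          rw [A4.N 0 (by decide), A3.N 0 (by decide), A2.N 0 (by decide)]
          simpa [State.setN_N] using zt
        rw [roundEnd, post_ite, post_setN, post_setN]
        refine ⟨fun _ => ?_, fun _ => ?_⟩
        · simp [State.setN_N, NExp.eval]; exact z4
        · simp [State.setN_N]; omega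
    have hp : Post W boostRound t (Params W η T M) :=
      (post_agree _ _ _).mono fun s'' A' => Pt.of_agree A' (by decide) (by decide)
    refine (hp.and (hz.and (used_boostRound Pt (zt.trans hj.le)))).mono
      fun s'' ⟨k1, k2, k3⟩ => ⟨k1, k2, fun i => ?_⟩
    have k3i := k3 i
    have u1i := u1 i
    rw [ut, Pi.add_apply] at k3i
    have hBi : B i = MvPolynomial.eval (bounds W η T M) (roundPoly i) +
      nL * MvPolynomial.eval (bounds W η T M) (auditPoly i) := rfl
    rw [← hBi] at k3i
    rw [add_mul, one_mul]
    omega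
  · intro s' ⟨_, _, u⟩ i
    rw [hn] at u
    refine (u i).trans ?_
    gcongr
    have h3i := h3 i
    fin_cases i <;> simp at h3i ⊢ <;> omega

end resources

/-! ### Numerical estimates for the parameters of the program. -/

section estimates

universe u
variable {X : Type u} {k nH nL : ℕ} {P : Problem X k nH nL} {δ : ℝ}

theorem numRounds_le : (numRounds P : ℝ) ≤ 64 * k * P.lmax ^ 2 * (1 / P.eps) ^ 2 + 2 := by
  have h : 0 ≤ 64 * k * (P.lmax * P.lmax) / (P.eps * P.eps) :=
    div_nonneg (mul_nonneg (by positivity) (mul_self_nonneg _)) (mul_self_nonneg _)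
  have h2 : 64 * k * (P.lmax * P.lmax) / (P.eps * P.eps) =
      64 * k * P.lmax ^ 2 * (1 / P.eps) ^ 2 := by
    rw [div_pow, one_pow, sq, sq]; ring
  have := Nat.ceil_lt_add_one h
  rw [numRounds]
  push_cast
  rw [← h2]
  linarith

theorem one_le_numRounds : 1 ≤ numRounds P := Nat.le_add_left _ _

/-- `1 / min u 1` is the larger of `1/u` and `1`, hence at most their sum, which is a polynomial. -/
theorem one_div_rho_le [NeZero k] (hl : 0 < P.lmax) (he : 0 < P.eps) :
    1 / P.rho ≤ 1 + k * P.lmax * (1 / P.eps) := by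
  have hk : (0 : ℝ) < k := Nat.cast_pos.2 (NeZero.pos k)
  have h1 : 0 ≤ k * P.lmax * (1 / P.eps) := by positivity
  rw [Problem.rho]
  rcases le_total (P.eps / (k * P.lmax)) 1 with h | h
  · rw [min_eq_left h, one_div_div, mul_one_div]
    linarith
  · rw [min_eq_right h, one_div_one]
    linarith

theorem callFail_pos (hL : 0 < nL) (hδ : 0 < δ) : 0 < callFail P δ := by
  have h1 : (0 : ℝ) < numRounds P := Nat.cast_pos.2 one_le_numRounds
  have h2 : (0 : ℝ) < nL := Nat.cast_pos.2 hL
  rw [callFail]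
  positivity

theorem callFail_lt_one (hL : 0 < nL) (hδ1 : δ < 1) : callFail P δ < 1 := by
  have h1 : (1 : ℝ) ≤ numRounds P := Nat.one_le_cast.2 one_le_numRounds
  have h2 : (1 : ℝ) ≤ nL := Nat.one_le_cast.2 hL
  rw [callFail, div_lt_one (by positivity)]
  nlinarith

/-- The crude `log T ≤ T` keeps the bound polynomial: `T` is polynomial in the parameters, whose own
logarithms are not available as variables. -/
theorem log_one_div_callFail_le (hL : 0 < nL) (hδ : 0 < δ) :
    Real.log (1 / callFail P δ) ≤ Real.log (1 / δ) + 4 + Real.log nL + numRounds P := by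
  have h1 : (0 : ℝ) < numRounds P := Nat.cast_pos.2 one_le_numRounds
  have h2 : (0 : ℝ) < nL := Nat.cast_pos.2 hL
  have h3 : 1 / callFail P δ = 1 / δ * 4 * nL * numRounds P := by
    rw [callFail, one_div_div]; ring
  rw [h3, Real.log_mul (by positivity) h1.ne', Real.log_mul (by positivity) h2.ne',
    Real.log_mul (by positivity) (by norm_num)]
  have h4 := Real.log_le_self h1.le
  have h5 := Real.log_le_self (show (0 : ℝ) ≤ 4 by norm_num)
  linarith

theorem numAudit_le [NeZero k] (hl : 0 < P.lmax) (he : 0 < P.eps) (hH : 0 < nH) (hL : 0 < nL) (hδ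
    : 0 < δ)
    (hδ1 : δ < 1) : (numAudit P δ : ℝ) ≤ 1024 * (1 + k * P.lmax * (1 / P.eps)) ^ 2 *
      (8 + Real.log nH + Real.log nL + numRounds P + Real.log (1 / δ)) + 1 := by
  have h1 : (0 : ℝ) < numRounds P := Nat.cast_pos.2 one_le_numRounds
  have h1' : (1 : ℝ) ≤ numRounds P := Nat.one_le_cast.2 one_le_numRounds
  have h2 : (1 : ℝ) ≤ nL := Nat.one_le_cast.2 hL
  have h3 : (1 : ℝ) ≤ nH := Nat.one_le_cast.2 hH
  have hr := rho_pos hl he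
  have hlog : Real.log (8 * nH * nL * numRounds P / δ) ≤
      8 + Real.log nH + Real.log nL + numRounds P + Real.log (1 / δ) := by
    rw [div_eq_mul_one_div, Real.log_mul (by positivity) (by positivity),
      Real.log_mul (by positivity) h1.ne', Real.log_mul (by positivity) (by positivity),
      Real.log_mul (by norm_num) (by positivity)]
    have h4 := Real.log_le_self h1.le
    have h5 := Real.log_le_self (show (0 : ℝ) ≤ 8 by norm_num)
    linarith
  -- Positivity of the logarithm excludes the truncated case of the natural ceiling, where `⌈x⌉₊ < x
  -- + 1` may fail.
  have hlog0 : 0 ≤ Real.log (8 * nH * nL * numRounds P / δ) := by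
    refine Real.log_nonneg ?_
    rw [one_le_div hδ]
    have : (1 : ℝ) ≤ nH * nL * numRounds P := by
      have := one_le_mul_of_one_le_of_one_le h3 h2
      exact one_le_mul_of_one_le_of_one_le this h1'
    nlinarith
  have hc : 1024 / (P.rho * P.rho) = 1024 * (1 / P.rho) ^ 2 := by
    rw [div_pow, one_pow, sq]; ring
  rw [numAudit]
  refine (Nat.ceil_lt_add_one (mul_nonneg (by positivity) hlog0)).le.trans ?_
  rw [hc]
  gcongr
  exact one_div_rho_le hl he

/-- The failure probabilities of all rounds sum to at most `δ`. -/
theorem total_fail_le [NeZero k] {M : ℕ} (hl : 0 < P.lmax) (he : 0 < P.eps) (hH : 0 < nH) (hL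
    : 0 < nL)
    (hδ : 0 < δ) (hM : numAudit P δ ≤ M) :
    (numRounds P : ENNReal) *
      (ENNReal.ofReal ((nH + 1) * nL * (2 * Real.exp (-(M * P.rho ^ 2 / 1024)))) +
        ∑ _l : Fin nL, (ENNReal.ofReal (callFail P δ) + ENNReal.ofReal (callFail P δ))) ≤
      ENNReal.ofReal δ := by
  have h1 : (0 : ℝ) < numRounds P := Nat.cast_pos.2 one_le_numRounds
  have h2 : (0 : ℝ) < nL := Nat.cast_pos.2 hL
  have h3 : (1 : ℝ) ≤ nH := Nat.one_le_cast.2 hH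
  have hr := rho_pos hl he
  have hη := (callFail_pos (P := P) hL hδ).le
  rw [Finset.sum_const, Finset.card_univ, Fintype.card_fin, nsmul_eq_mul,
    ← ENNReal.ofReal_add hη hη, ← ENNReal.ofReal_natCast, ← ENNReal.ofReal_natCast,
    ← ENNReal.ofReal_mul h2.le, ← ENNReal.ofReal_add (by positivity) (by positivity),
    ← ENNReal.ofReal_mul h1.le]
  refine ENNReal.ofReal_le_ofReal ?_
  -- The choice of `numAudit`: its logarithm is inverted by the exponential.
  have hexp : Real.exp (-(M * P.rho ^ 2 / 1024)) ≤ δ / (8 * nH * nL * numRounds P) := by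
    have h4 : Real.log (8 * nH * nL * numRounds P / δ) ≤ M * P.rho ^ 2 / 1024 := by
      have h5 := (Nat.le_ceil (1024 / (P.rho * P.rho) *
        Real.log (8 * nH * nL * numRounds P / δ))).trans (Nat.cast_le.2 hM)
      rw [div_mul_eq_mul_div, div_le_iff₀ (by positivity)] at h5
      rw [le_div_iff₀ (by norm_num)]
      nlinarith
    refine (Real.exp_le_exp.2 (neg_le_neg h4)).trans (le_of_eq ?_)
    rw [Real.exp_neg, Real.exp_log (by positivity), inv_div]
  have hη2 : numRounds P * (nL * (callFail P δ + callFail P δ)) = δ / 2 := by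
    rw [callFail]; field_simp; norm_num
  -- As `1 ≤ |H|`, `|H| + 1 ≤ 2|H|`; the factors `2 · 2` against `8` leave `δ/2`, and the learner's
  -- calls take the other half.
  have hacc : numRounds P * ((nH + 1) * nL * (2 * Real.exp (-(M * P.rho ^ 2 / 1024)))) ≤ δ / 2 := by
    calc numRounds P * ((nH + 1) * nL * (2 * Real.exp (-(M * P.rho ^ 2 / 1024))))
        ≤ numRounds P * ((nH + nH) * nL * (2 * (δ / (8 * nH * nL * numRounds P)))) := by gcongr
      _ = δ / 2 := by
        have : (0 : ℝ) < nH := by linarith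
        field_simp; norm_num
  rw [mul_add, hη2]
  linarith

end estimates

/-! ### The explicit polynomials bounding the resources. -/

section bounds

/-- Bound for the number of rounds, in terms of `1 / ε`, `ℓ_max`, `k`. -/
noncomputable def roundsBound {R : Type*} [CommSemiring R] (a b c : R) : R :=
  64 * c * b ^ 2 * a ^ 2 + 2

open MvPolynomial in
/-- Bound for `1 / ρ`. -/
noncomputable def rhoBound : MvPolynomial (Fin 6) ℕ := 1 + X 2 * X 1 * X 0

open MvPolynomial in
/-- Bound for the logarithm of the failure probability of a call. -/
noncomputable def failBound : MvPolynomial (Fin 6) ℕ :=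
  X 5 + 4 + X 3 + roundsBound (X 0) (X 1) (X 2)

open MvPolynomial in
/-- Bound for the number of samples used for the estimates of one round. -/
noncomputable def auditBound : MvPolynomial (Fin 6) ℕ :=
  1024 * rhoBound ^ 2 * (8 + X 4 + X 3 + roundsBound (X 0) (X 1) (X 2) + X 5) + 1

open MvPolynomial in
/-- A bound given in terms of the parameters of the learner. -/
noncomputable def learnerBound (p : MvPolynomial (Fin 3) ℕ) : MvPolynomial (Fin 6) ℕ :=
  bind₁ ![X 4, rhoBound, failBound] p

open MvPolynomial in
/-- Bounds for the quantities on which the resources used depend. -/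
noncomputable def polyBounds (pH pL : Polynomial ℕ) (pTime pSize : MvPolynomial (Fin 3) ℕ) :
    ℕ → MvPolynomial (Fin 6) ℕ
  | 0 => Polynomial.aeval (X 4) pH
  | 1 => Polynomial.aeval (X 3) pL
  | 2 => learnerBound pTime
  | 3 => roundsBound (X 0) (X 1) (X 2)
  | 5 => X 2
  | 9 => learnerBound pSize
  | 10 => learnerBound pSize + (auditBound + 1)
  | _ => 0

open MvPolynomial in
/-- The bound for the running time. -/
noncomputable def timeBound (pH pL : Polynomial ℕ) (pTime pSize : MvPolynomial (Fin 3) ℕ) :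
    MvPolynomial (Fin 6) ℕ :=
  (roundsBound (X 0) (X 1) (X 2) + auditBound + 255) + roundsBound (X 0) (X 1) (X 2) *
    (1 + (bind₁ (polyBounds pH pL pTime pSize) (roundPoly 0) +
      bind₁ (polyBounds pH pL pTime pSize) (auditPoly 0)))

open MvPolynomial in
/-- The bound for the number of samples. -/
noncomputable def samplesBound (pH pL : Polynomial ℕ) (pTime pSize : MvPolynomial (Fin 3) ℕ) :
    MvPolynomial (Fin 6) ℕ :=
  roundsBound (X 0) (X 1) (X 2) * bind₁ (polyBounds pH pL pTime pSize) (roundPoly 1)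

open MvPolynomial in
/-- The bound for the number of calls, up to the factor `|L|`. -/
noncomputable def callsBound : MvPolynomial (Fin 3) ℕ :=
  roundsBound (X 0) (X 1) (X 2) * 2

universe u
variable {X : Type u} {k nH nL : ℕ}

/-- The values of the parameters of a problem. -/
noncomputable def values (P : Problem X k nH nL) (δ : ℝ) : Fin 6 → ℝ :=
  ![1 / P.eps, P.lmax, (k : ℝ), Real.log nL, Real.log nH, Real.log (1 / δ)]

theorem aeval_roundsBound (P : Problem X k nH nL) (δ : ℝ) :
    (numRounds P : ℝ) ≤ MvPolynomial.aeval (values P δ)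
      (roundsBound (.X 0) (.X 1) (.X 2) : MvPolynomial (Fin 6) ℕ) := by
  refine numRounds_le.trans (le_of_eq ?_)
  simp [roundsBound, values]

theorem aeval_learnerBound [NeZero k] {P : Problem X k nH nL} {δ : ℝ} (hl : 0 < P.lmax) (he
    : 0 < P.eps)
    (hH : 0 < nH) (hL : 0 < nL) (hδ : 0 < δ) (hδ1 : δ < 1) (p : MvPolynomial (Fin 3) ℕ) :
    MvPolynomial.aeval ![Real.log nH, 1 / P.rho, Real.log (1 / callFail P δ)] p ≤
      MvPolynomial.aeval (values P δ) (learnerBound p) := by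
  have hη := callFail_pos (P := P) hL hδ
  have hη1 := callFail_lt_one (P := P) hL hδ1
  rw [learnerBound, MvPolynomial.aeval_bind₁]
  refine aeval_mono p (fun i => ?_) fun i => ?_
  · fin_cases i
    · exact Real.log_nonneg (Nat.one_le_cast.2 hH)
    · exact (one_div_pos.2 (rho_pos hl he)).le
    · exact Real.log_nonneg (by rw [le_div_iff₀ hη]; linarith)
  · fin_cases i
    · simp [values]
    · simpa [values, rhoBound] using one_div_rho_le (P := P) hl he
    · refine (log_one_div_callFail_le hL hδ).trans ?_
      have := aeval_roundsBound P δ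
      simp only [failBound, Fin.reduceFinMk, Matrix.cons_val, map_add, MvPolynomial.aeval_X]
      have e : MvPolynomial.aeval (values P δ) (4 : MvPolynomial (Fin 6) ℕ) = 4 := by simp
      rw [e]
      have e5 : values P δ 5 = Real.log (1 / δ) := rfl
      have e3 : values P δ 3 = Real.log nL := rfl
      rw [e5, e3]
      linarith

theorem aeval_auditBound [NeZero k] {P : Problem X k nH nL} {δ : ℝ} (hl : 0 < P.lmax) (he
    : 0 < P.eps)
    (hH : 0 < nH) (hL : 0 < nL) (hδ : 0 < δ) (hδ1 : δ < 1) :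
    (numAudit P δ : ℝ) ≤ MvPolynomial.aeval (values P δ) auditBound := by
  refine (numAudit_le hl he hH hL hδ hδ1).trans ?_
  have h1 := aeval_roundsBound P δ
  have e : MvPolynomial.aeval (values P δ) auditBound =
      1024 * (1 + k * P.lmax * (1 / P.eps)) ^ 2 * (8 + Real.log nH + Real.log nL +
        MvPolynomial.aeval (values P δ)
          (roundsBound (.X 0) (.X 1) (.X 2) : MvPolynomial (Fin 6) ℕ) + Real.log (1 / δ)) + 1 := by
    simp [auditBound, rhoBound, values]
  rw [e]
  gcongr

theorem bounds_le_polyBounds [NeZero k] {W : World X k nH nL} {δ : ℝ} {pH pL : Polynomial ℕ}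
    {pTime pSize : MvPolynomial (Fin 3) ℕ} (hl : 0 < W.problem.lmax) (he : 0 < W.problem.eps)
    (hH : 0 < nH) (hL : 0 < nL) (hδ : 0 < δ) (hδ1 : δ < 1)
    (htH : (W.tauH : ℝ) ≤ Polynomial.aeval (Real.log nH) pH)
    (htL : (W.tauL : ℝ) ≤ Polynomial.aeval (Real.log nL) pL)
    (hA : ∀ ρ η : ℝ, 0 < ρ → ρ ≤ 1 → 0 < η → η < 1 →
        (W.learner.time ρ η : ℝ) ≤
            MvPolynomial.aeval ![Real.log nH, 1 / ρ, Real.log (1 / η)] pTime ∧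
        (W.learner.size ρ η : ℝ) ≤
            MvPolynomial.aeval ![Real.log nH, 1 / ρ, Real.log (1 / η)] pSize) (n : ℕ) :
    (bounds W (callFail W.problem δ) (numRounds W.problem) (numSamples W δ) n : ℝ) ≤
      MvPolynomial.aeval (values W.problem δ) (polyBounds pH pL pTime pSize n) := by
  obtain ⟨h1, h2⟩ := hA W.problem.rho (callFail W.problem δ) (rho_pos hl he) (min_le_right _ _)
    (callFail_pos hL hδ) (callFail_lt_one hL hδ1)
  have h3 := h1.trans (aeval_learnerBound hl he hH hL hδ hδ1 pTime)
  have h4 := h2.trans (aeval_learnerBound hl he hH hL hδ hδ1 pSize)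
  have h5 := aeval_auditBound hl he hH hL hδ hδ1 (P := W.problem)
  unfold bounds polyBounds
  split
  · change (W.tauH : ℝ) ≤ MvPolynomial.aeval (values W.problem δ) (Polynomial.aeval (.X 4) pH)
    rw [← Polynomial.aeval_algHom_apply, MvPolynomial.aeval_X]; exact htH
  · change (W.tauL : ℝ) ≤ MvPolynomial.aeval (values W.problem δ) (Polynomial.aeval (.X 3) pL)
    rw [← Polynomial.aeval_algHom_apply, MvPolynomial.aeval_X]; exact htL
  · exact h3
  · exact aeval_roundsBound _ _
  · change (k : ℝ) ≤ MvPolynomial.aeval (values W.problem δ) (.X 2)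
    rw [MvPolynomial.aeval_X]; exact le_rfl
  · exact h4
  · change (numSamples W δ : ℝ) ≤
      MvPolynomial.aeval (values W.problem δ) (learnerBound pSize + (auditBound + 1))
    rw [numSamples, map_add, map_add, map_one]
    push_cast
    linarith
  · simp

/-- Since `|L| ≥ 1`, the factor `n` may also be put on the terms that do not come from the loop over
losses. -/
theorem time_estimate {T A a b n T' A' a' b' : ℝ} (hT0 : 0 ≤ T) (hA0 : 0 ≤ A) (ha : 0 ≤ a)
    (hb : 0 ≤ b) (hn : 1 ≤ n) (hT : T ≤ T') (hA : A ≤ A') (ha' : a ≤ a') (hb' : b ≤ b') :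
    T + A + 255 + T * (1 + (a + n * b)) ≤ n * (T' + A' + 255 + T' * (1 + (a' + b'))) :=
  calc T + A + 255 + T * (1 + (a + n * b))
      ≤ n * (T + A + 255) + T * (n * (1 + (a + b))) := by
        gcongr
        · exact le_mul_of_one_le_left (by positivity) hn
        · nlinarith
    _ = n * (T + A + 255 + T * (1 + (a + b))) := by ring
    _ ≤ _ := by gcongr; exact hT0.trans hT

theorem time_le [NeZero k] {W : World X k nH nL} {δ : ℝ} {pH pL : Polynomial ℕ}
    {pTime pSize : MvPolynomial (Fin 3) ℕ} (hl : 0 < W.problem.lmax) (he : 0 < W.problem.eps)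
    (hH : 0 < nH) (hL : 0 < nL) (hδ : 0 < δ) (hδ1 : δ < 1)
    (hb : ∀ n, (bounds W (callFail W.problem δ) (numRounds W.problem) (numSamples W δ) n : ℝ) ≤
      MvPolynomial.aeval (values W.problem δ) (polyBounds pH pL pTime pSize n)) {s : State X}
    (hs : ∀ i, s.used i ≤
      (![numRounds W.problem + numAudit W.problem δ + 255, 0, 0] : Fin 3 → ℕ) i +
      numRounds W.problem * ((![1, 0, 0] : Fin 3 → ℕ) i +
        (MvPolynomial.eval (bounds W (callFail W.problem δ) (numRounds W.problem)
          (numSamples W δ)) (roundPoly i) +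
        nL * MvPolynomial.eval (bounds W (callFail W.problem δ) (numRounds W.problem)
          (numSamples W δ)) (auditPoly i)))) :
    (s.time : ℝ) ≤ nL * MvPolynomial.aeval (values W.problem δ) (timeBound pH pL pTime pSize) ∧
    (s.samples : ℝ) ≤
      MvPolynomial.aeval (values W.problem δ) (samplesBound pH pL pTime pSize) ∧
    (s.calls : ℝ) ≤ nL * MvPolynomial.aeval ![1 / W.problem.eps, W.problem.lmax, (k : ℝ)]
      callsBound := by
  have hT := aeval_roundsBound W.problem δ
  have hT0 : (0 : ℝ) ≤ numRounds W.problem := Nat.cast_nonneg _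
  have hn : (1 : ℝ) ≤ nL := Nat.one_le_cast.2 hL
  refine ⟨?_, ?_, ?_⟩
  · have h0 : (s.time : ℝ) ≤ _ := Nat.cast_le.2 (hs 0)
    refine h0.trans ?_
    have hA := aeval_auditBound hl he hH hL hδ hδ1 (P := W.problem)
    have e1 := cast_eval_le (roundPoly 0) hb
    have e2 := cast_eval_le (auditPoly 0) hb
    rw [timeBound]
    simp only [map_add, map_mul, map_one]
    have e255 : MvPolynomial.aeval (values W.problem δ) (255 : MvPolynomial (Fin 6) ℕ) = 255 := by
      simp
    rw [e255]
    simp only [Matrix.cons_val_zero]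
    push_cast
    exact time_estimate hT0 (Nat.cast_nonneg _) (Nat.cast_nonneg _) (Nat.cast_nonneg _) hn hT hA
      e1 e2
  · have h0 : (s.samples : ℝ) ≤ _ := Nat.cast_le.2 (hs 1)
    refine h0.trans ?_
    rw [auditPoly_one, samplesBound, map_mul]
    have e1 := cast_eval_le (roundPoly 1) hb
    simp only [Matrix.cons_val_one, Matrix.cons_val_zero, map_zero, mul_zero, add_zero, zero_add]
    push_cast
    exact mul_le_mul hT e1 (Nat.cast_nonneg _) (hT0.trans hT)
  · have h0 : (s.calls : ℝ) ≤ _ := Nat.cast_le.2 (hs 2)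
    refine h0.trans ?_
    rw [roundPoly_two, auditPoly_two, callsBound, map_mul]
    have e2 : MvPolynomial.eval (bounds W (callFail W.problem δ) (numRounds W.problem)
        (numSamples W δ)) (2 : MvPolynomial ℕ ℕ) = 2 := by simp
    have e3 : MvPolynomial.aeval ![1 / W.problem.eps, W.problem.lmax, (k : ℝ)]
        (roundsBound (.X 0) (.X 1) (.X 2) : MvPolynomial (Fin 3) ℕ) =
        MvPolynomial.aeval (values W.problem δ)
          (roundsBound (.X 0) (.X 1) (.X 2) : MvPolynomial (Fin 6) ℕ) := by
      simp [roundsBound, values]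
    have e4 : MvPolynomial.aeval ![1 / W.problem.eps, W.problem.lmax, (k : ℝ)]
        (2 : MvPolynomial (Fin 3) ℕ) = 2 := by simp
    rw [e2, e3, e4]
    simp only [Matrix.cons_val, map_zero, zero_add]
    push_cast
    nlinarith

end bounds

end PerfOmni

/-! ### Assembly of the resource bounds and the failure probability. -/

theorem mainTheorem5 :
    -- one program, for all problems and learners
    ∃ poiBoost : PerfOmni.Cmd,
    -- a polynomial bound on the number of calls to the learner
    ∃ Qcalls : MvPolynomial (Fin 3) ℕ,
    -- bounds for evaluating hypotheses and losses, and for the time and samples of the learner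
    ∀ (pH pL : Polynomial ℕ) (pTime pSize : MvPolynomial (Fin 3) ℕ),
    ∃ Qtime Qsamples : MvPolynomial (Fin 6) ℕ,
    ∀ (X : Type*) (k nH nL : ℕ) [NeZero k], 0 < nH → 0 < nL →
    ∀ (W : PerfOmni.World X k nH nL) (δ : ℝ) (x₀ : X),
      0 < W.problem.eps → 0 < W.problem.lmax → W.problem.Bounded → 0 < δ → δ < 1 →
      (W.tauH : ℝ) ≤ Polynomial.aeval (Real.log nH) pH →
      (W.tauL : ℝ) ≤ Polynomial.aeval (Real.log nL) pL →
      W.learner.IsCostSensitiveWeakLearner W.problem.H →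
      (∀ ρ η : ℝ, 0 < ρ → ρ ≤ 1 → 0 < η → η < 1 →
        (W.learner.time ρ η : ℝ) ≤
            MvPolynomial.aeval ![Real.log nH, 1 / ρ, Real.log (1 / η)] pTime ∧
        (W.learner.size ρ η : ℝ) ≤
            MvPolynomial.aeval ![Real.log nH, 1 / ρ, Real.log (1 / η)] pSize) →
      -- resource bounds, on every execution
      (∀ s ∈ (PerfOmni.run W poiBoost (PerfOmni.initial W.problem δ x₀)).support,
        (s.time : ℝ) ≤ nL * MvPolynomial.aeval ![1 / W.problem.eps, W.problem.lmax, (k : ℝ),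
            Real.log nL, Real.log nH, Real.log (1 / δ)] Qtime ∧
        (s.samples : ℝ) ≤ MvPolynomial.aeval ![1 / W.problem.eps, W.problem.lmax, (k : ℝ),
            Real.log nL, Real.log nH, Real.log (1 / δ)] Qsamples ∧
        (s.calls : ℝ) ≤ nL * MvPolynomial.aeval ![1 / W.problem.eps, W.problem.lmax, (k : ℝ)]
            Qcalls) ∧
      -- correctness, with probability at least `1 - δ`
      ENNReal.ofReal (1 - δ) ≤
        PerfOmni.prob (PerfOmni.run W poiBoost (PerfOmni.initial W.problem δ x₀))
          {s | ∃ us : List (PerfOmni.Update nH nL),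
            s.Outputs us ∧ W.problem.IsPOIBoostRun (1 / 8) us ∧
            W.problem.IsPOI (W.problem.boost (1 / 8) us) W.problem.eps ∧
            W.problem.IsDOI (W.problem.boost (1 / 8) us) W.problem.eps ∧
            W.problem.IsOmnipredictor (W.problem.boost (1 / 8) us) (2 * W.problem.eps)} := by
  classical
  refine ⟨PerfOmni.poiBoost, PerfOmni.callsBound, fun pH pL pTime pSize =>
    ⟨PerfOmni.timeBound pH pL pTime pSize, PerfOmni.samplesBound pH pL pTime pSize, ?_⟩⟩
  intro X k nH nL _ hH hL W δ x₀ he hl hB hδ hδ1 htH htL hA hres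
  refine ⟨fun s hs => ?_, ?_⟩
  · exact PerfOmni.time_le hl he hH hL hδ hδ1
      (PerfOmni.bounds_le_polyBounds hl he hH hL hδ hδ1 htH htL hres)
      (PerfOmni.used_poiBoost W δ x₀ s hs)
  · refine PerfOmni.le_prob_of_compl_le hδ.le ?_
    have hη := PerfOmni.callFail_pos (P := W.problem) hL hδ
    have hη1 := PerfOmni.callFail_lt_one (P := W.problem) hL hδ1
    have hT : 64 * k * (W.problem.lmax * W.problem.lmax) / (W.problem.eps * W.problem.eps) <
        (PerfOmni.numRounds W.problem : ℝ) := by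
      rw [PerfOmni.numRounds]
      push_cast
      exact (Nat.le_ceil _).trans_lt (lt_add_one _)
    have h1 : PerfOmni.fail W PerfOmni.poiBoost (PerfOmni.initial W.problem δ x₀)
        (PerfOmni.Running W (PerfOmni.callFail W.problem δ) (PerfOmni.numRounds W.problem)
          (PerfOmni.numSamples W δ) (PerfOmni.numRounds W.problem)) ≤ ENNReal.ofReal δ :=
      PerfOmni.fail_seq_post (PerfOmni.post_setup W δ x₀) fun s hs =>
        (PerfOmni.fail_boostLoop hB hl he hA hη hη1
          (by rw [PerfOmni.numSamples]; omega) (by rw [PerfOmni.numSamples]; omega) hs.1).trans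
          (PerfOmni.total_fail_le hl he hH hL hδ (by rw [PerfOmni.numSamples]; omega))
    -- After `T` rounds the loop invariant alone implies the conclusion: an unfinished run would
    -- contain `T` updates, more than the potential allows.
    have h2 := PerfOmni.fail_mono h1 fun s hs => hs.complete hB hl he hT
    refine le_trans (le_of_eq ?_) h2
    rw [PerfOmni.prob_eq_wsum, PerfOmni.fail]
    congr 1
    funext s
    by_cases hs : s ∈ {s : PerfOmni.State X | ∃ us : List (PerfOmni.Update nH nL),
            s.Outputs us ∧ W.problem.IsPOIBoostRun (1 / 8) us ∧
            W.problem.IsPOI (W.problem.boost (1 / 8) us) W.problem.eps ∧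
            W.problem.IsDOI (W.problem.boost (1 / 8) us) W.problem.eps ∧
            W.problem.IsOmnipredictor (W.problem.boost (1 / 8) us) (2 * W.problem.eps)}
    · rw [if_neg (fun h => h hs)]
      exact (if_pos hs).symm
    · rw [if_pos (show s ∈ _ᶜ from hs)]
      exact (if_neg hs).symm
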